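/- Let $F_N=F(A)$ be a free group of finite rank $N\ge 2$, and let $\Gamma$ be a finite connected graph with all vertices of degree $\ge 3$ and first Betti number $N$, with a marking isomorphism $\alpha\colon F_N\to\pi_1(\Gamma,x_0)$. Write $E\Gamma$ for the set of oriented edges, $o(e)$ and $t(e)$ for the initial and terminal vertex of $e$, and $T_0$ for the universal cover of $\Gamma$, where $\partial F_N$ is identified with $\partial T_0$ through $\alpha$. A geodesic current on $F_N$ is a locally finite Borel measure on $\partial^2F_N=\{(x,y)\in(\partial F_N)^2: x\ne y\}$ that is invariant under $F_N$ and under the flip; $\mathrm{Curr}(F_N)$ has the weak-* topology and $\mathbb P\mathrm{Curr}(F_N)=(\mathrm{Curr}(F_N)\setminus\{0\})/\mathbb R_{>0}$ the quotient topology. For $1\ne g\in F_N$ the counting current is $\eta_g=\sum_{h\in F_N/\langle g\rangle}\bigl(\delta_{h(g^{-\infty},g^{\infty})}+\delta_{h(g^{\infty},g^{-\infty})}\bigr)$; it depends only on the conjugacy class of $g$. Let $\mathcal X$ be an irreducible $\Gamma$-based finite-state Markov chain: its state set is $S\subseteq E\Gamma$ with $\#S\ge 2$, and $p_{\mathcal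 X}(e,e')>0$ implies $t(e)=o(e')$ and $e'\ne e^{-1}$. Let $\mu_0$ be its stationary probability distribution. For a reduced edge-path $v=e_1\dots e_k$ in $\Gamma$, $k\ge 1$, put $\mu_0[k](v)=\mu_0(e_1)p_{\mathcal X}(e_1,e_2)\cdots p_{\mathcal X}(e_{k-1},e_k)$ if all $e_i\in S$, and $\mu_0[k](v)=0$ otherwise. Then there is a unique geodesic current $\nu_{\mathcal X}$ on $F_N$, the characteristic current of $\mathcal X$, such that for every $k\ge1$, every reduced edge-path $v$ of length $k$ in $\Gamma$ and every lift $[p,q]$ of $v$ to $T_0$, the set of those $(x,y)\in\partial^2F_N$ for which the geodesic in $T_0$ from $x$ to $y$ passes through $[p,q]$, in the direction from $p$ to $q$, has $\nu_{\mathcal X}$-measure $\mu_0[k](v)+\mu_0[k](v^{-1})$. Let $\mu$ be any initial probability distribution on $S$, let $X_1,X_2,\dots$ be the corresponding Markov process, and let $W_n=X_1\dots X_n$. Let $\mathcal B=(\beta_{e,e'})_{e,e'\in E\Gamma}$ be a closing path system, that is, a family of (possibly degenerate) reduced edge-paths such that $e\,\beta_{e,e'}\,e'$ is a reduced edge-path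 for all $e,e'\in E\Gamma$. Let $\breve W_n$ be the modified $\mathcal B$-closing of $W_n$: if $W_n$ is a closed path, then $\breve W_n$ is the subpath of $W_n$ obtained by maximal cyclic reduction; otherwise $\breve W_n=W_n\beta_{e,e'}$, where $e$ is the last and $e'$ the first edge of $W_n$. Regard the closed path $\breve W_n$ as an element of $F_N$ via $\alpha$, after joining $x_0$ to its initial vertex by a path $\delta_v$ from a fixed family $(\delta_v)_{v\in V\Gamma}$ of paths from $x_0$ to $v$, chosen arbitrarily. Then the process $\breve W_1,\breve W_2,\dots$ is tame, that is, for every free basis $B$ of $F_N$ there is $C>0$ such that always $|\breve W_n|_B\le Cn$ for all $n\ge1$; and it is adapted to $\nu_{\mathcal X}$, that is, $\nu_{\mathcal X}\neq 0$ and for almost every trajectory $\breve W_n\ne1$ for all large $n$ and $\lim_{n\to\infty}[\eta_{\breve W_n}]=[\nu_{\mathcal X}]$ in $\mathbb P\mathrm{Curr}(F_N)$. -/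

import Mathlib

open MeasureTheory Filter Topology
open scoped NNReal ENNReal

namespace GraphWalk

/-! ### The boundary of a free group -/

section Boundary

/-- The boundary `∂F(A)` of the free group on `A`: infinite reduced words in the letters
`(a, true) = a` and `(a, false) = a⁻¹`. -/
def Boundary (A : Type*) : Type _ :=
  {x : ℕ → A × Bool // ∀ i, (x i).1 = (x (i + 1)).1 → (x i).2 = (x (i + 1)).2}

/-- Topology of pointwise convergence of letters. -/
instance (A : Type*) : TopologicalSpace (Boundary A) :=
  TopologicalSpace.induced (fun x : Boundary A => x.1)
    (@Pi.topologicalSpace ℕ (fun _ => A × Bool) (fun _ => ⊥))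

variable {A : Type*} [DecidableEq A]

/-- The element of `F(A)` spelled by the first `m` letters of a boundary point. -/
def Boundary.prefixElement (x : Boundary A) (m : ℕ) : FreeGroup A :=
  FreeGroup.mk (List.ofFn fun i : Fin m => x.1 i)

/-- Left multiplication of an infinite reduced word by one letter (with free cancellation). -/
def letterAct (l : A × Bool) (x : Boundary A) : Boundary A :=
  if h : x.1 0 = (l.1, !l.2) then ⟨fun i => x.1 (i + 1), fun i => x.2 (i + 1)⟩
  else ⟨fun i => Nat.casesOn i l (fun j => x.1 j), by
    rintro (_ | i)
    · intro h1
      by_contra h2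
      apply h
      ext
      · exact h1.symm
      · simp only at h2 ⊢
        revert h2
        cases l.2 <;> cases (x.1 0).2 <;> simp
    · exact x.2 i⟩

theorem letterAct_letterAct (l : A × Bool) (x : Boundary A) :
    letterAct (l.1, !l.2) (letterAct l x) = x := by
  by_cases h : x.1 0 = (l.1, !l.2)
  · have h' : ¬ x.1 1 = (l.1, l.2) := by
      intro h1
      have := x.2 0
      rw [h, h1] at this
      simp at this
    apply Subtype.ext
    funext i
    rcases i with _ | i <;> simp [letterAct, h, h']
  · apply Subtype.ext
    funext i
    rcases i with _ | i <;> simp [letterAct, h]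

/-- A free generator acts on the boundary as a permutation. -/
def letterPerm (a : A) : Equiv.Perm (Boundary A) where
  toFun := letterAct (a, true)
  invFun := letterAct (a, false)
  left_inv x := letterAct_letterAct (a, true) x
  right_inv x := letterAct_letterAct (a, false) x

/-- The left translation action of `F(A)` on `∂F(A)`. -/
def boundaryAct (g : FreeGroup A) (x : Boundary A) : Boundary A :=
  (FreeGroup.lift (letterPerm (A := A)) g) x

/-- Convergence of a sequence in `F(A)` to a boundary point, in `F(A) ∪ ∂F(A)`. -/
def ConvergesTo (u : ℕ → FreeGroup A) (x : Boundary A) : Prop :=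
  ∀ k : ℕ, ∀ᶠ n in atTop, (List.ofFn fun i : Fin k => x.1 i) <+: (u n).toWord

theorem toWord_pow_eq (g : FreeGroup A) (n : ℕ) (hn : n ≠ 0) :
    (g ^ n).toWord = FreeGroup.reduceCyclically.conjugator g.toWord ++
      (List.replicate n (FreeGroup.reduceCyclically g.toWord)).flatten ++
      FreeGroup.invRev (FreeGroup.reduceCyclically.conjugator g.toWord) := by
  rw [FreeGroup.toWord_pow,
    FreeGroup.reduceCyclically.reduce_flatten_replicate FreeGroup.isReduced_toWord, if_neg hn]

theorem reduceCyclically_ne_nil {g : FreeGroup A} (hg : g ≠ 1) :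
    FreeGroup.reduceCyclically g.toWord ≠ [] := by
  intro h
  apply hg
  have h1 := FreeGroup.reduceCyclically.conj_conjugator_reduceCyclically g.toWord
  rw [h] at h1
  rw [← FreeGroup.mk_toWord (x := g), ← h1, List.append_nil, ← FreeGroup.mul_mk,
    ← FreeGroup.inv_mk, mul_inv_cancel]

theorem exists_limit_pow {g : FreeGroup A} (hg : g ≠ 1) :
    ∃ x : Boundary A, ConvergesTo (fun n => g ^ n) x := by
  set u := FreeGroup.reduceCyclically.conjugator g.toWord with hu
  set c := FreeGroup.reduceCyclically g.toWord with hc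
  have hc0 : c ≠ [] := reduceCyclically_ne_nil hg
  have hcl : 0 < c.length := List.length_pos_iff.2 hc0
  let L : ℕ → List (A × Bool) := fun n => u ++ (List.replicate n c).flatten
  have hL : ∀ n, n ≤ (L n).length := by
    intro n
    simp only [L, List.length_append, List.length_flatten, List.map_replicate,
      List.sum_replicate, smul_eq_mul]
    nlinarith
  have hpre : ∀ n m, n ≤ m → L n <+: L m := by
    intro n m h
    obtain ⟨d, rfl⟩ := Nat.exists_eq_add_of_le h
    refine ⟨(List.replicate d c).flatten, ?_⟩
    simp only [L, List.replicate_add, List.flatten_append, List.append_assoc]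
  have hword : ∀ n, n ≠ 0 → L n <+: (g ^ n).toWord := by
    intro n hn
    rw [toWord_pow_eq g n hn]
    exact List.prefix_append _ _
  let x : ℕ → A × Bool := fun i => (L (i + 1))[i]'(hL (i + 1))
  have hx : ∀ i n (h : i < n), (L n)[i]'(lt_of_lt_of_le h (hL n)) = x i := by
    intro i n h
    exact ((hpre (i + 1) n h).getElem (hL (i + 1))).symm
  refine ⟨⟨x, ?_⟩, ?_⟩
  · intro i
    have hr : FreeGroup.IsReduced (L (i + 2)) :=
      FreeGroup.IsReduced.infix FreeGroup.isReduced_toWord (hword (i + 2) (by omega)).isInfix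
    have := List.isChain_iff_getElem.1 hr i (lt_of_lt_of_le (by omega) (hL (i + 2)))
    rw [hx i (i + 2) (by omega), hx (i + 1) (i + 2) (by omega)] at this
    exact this
  · intro k
    filter_upwards [eventually_ge_atTop (k + 1)] with n hn
    refine List.IsPrefix.trans ?_ (hword n (by omega))
    rw [List.prefix_iff_eq_take]
    apply List.ext_getElem
    · simp only [List.length_ofFn, List.length_take]
      have := hL n
      omega
    · intro i h1 h2
      simp only [List.length_ofFn] at h1
      simp only [List.getElem_ofFn, List.getElem_take]
      exact (hx i n (by omega)).symm

/-- The attracting pole `g^∞ = lim gⁿ` of a nontrivial element. -/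
noncomputable def pole (g : FreeGroup A) (hg : g ≠ 1) : Boundary A :=
  Classical.choose (exists_limit_pow hg)

theorem pole_ne_pole_inv (g : FreeGroup A) (hg : g ≠ 1) :
    pole g⁻¹ (inv_ne_one.2 hg) ≠ pole g hg := by
  intro heq
  have h1 := Classical.choose_spec (exists_limit_pow hg)
  have h2 := Classical.choose_spec (exists_limit_pow (inv_ne_one.2 hg))
  change ConvergesTo _ (pole g hg) at h1
  change ConvergesTo _ (pole g⁻¹ (inv_ne_one.2 hg)) at h2
  rw [heq] at h2
  set x := pole g hg
  set u := FreeGroup.reduceCyclically.conjugator g.toWord with hu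
  set c := FreeGroup.reduceCyclically g.toWord with hc
  have hc0 : c ≠ [] := reduceCyclically_ne_nil hg
  obtain ⟨n, ⟨ha, hb⟩, hn⟩ := (((h1 (u.length + 1)).and (h2 (u.length + 1))).and
    (eventually_ge_atTop 1)).exists
  obtain ⟨m, rfl⟩ := Nat.exists_eq_add_of_le' hn
  have e1 : (g ^ (m + 1)).toWord[u.length]? = some (c.head hc0) := by
    rw [toWord_pow_eq g _ (by omega), ← hu, ← hc, List.append_assoc,
      List.getElem?_append_right le_rfl, List.replicate_succ, List.flatten_cons,
      List.append_assoc, Nat.sub_self, ← List.head?_eq_getElem?, List.head?_append_of_ne_nil _ hc0,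
      List.head?_eq_some_head hc0]
  have e2 : (g⁻¹ ^ (m + 1)).toWord[u.length]? =
      some ((c.getLast hc0).1, !(c.getLast hc0).2) := by
    have hr : FreeGroup.invRev c ≠ [] := by simpa [FreeGroup.invRev] using hc0
    rw [inv_pow, FreeGroup.toWord_inv, toWord_pow_eq g _ (by omega), ← hu, ← hc,
      FreeGroup.invRev_append, FreeGroup.invRev_append, FreeGroup.invRev_invRev,
      List.getElem?_append_right le_rfl, List.replicate_succ', List.flatten_concat,
      FreeGroup.invRev_append, List.append_assoc, Nat.sub_self, ← List.head?_eq_getElem?,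
      List.head?_append_of_ne_nil _ hr]
    simp [FreeGroup.invRev, List.getLast?_eq_some_getLast hc0]
  have f : ∀ w : List (A × Bool), (List.ofFn fun i : Fin (u.length + 1) => x.1 i) <+: w →
      w[u.length]? = some (x.1 u.length) := by
    rintro w ⟨t, rfl⟩
    rw [List.getElem?_append_left (by simp), List.getElem?_ofFn, dif_pos (Nat.lt_succ_self _)]
  rw [f _ ha] at e1
  rw [f _ hb] at e2
  rw [e1] at e2
  have e3 := Option.some.inj e2
  have hcr : FreeGroup.IsCyclicallyReduced c :=
    FreeGroup.reduceCyclically.isCyclicallyReduced FreeGroup.isReduced_toWord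
  have := hcr.2 _ (List.getLast?_eq_some_getLast hc0) _ (List.head?_eq_some_head hc0)
  rw [e3] at this
  simp at this

/-- `∂²F(A)`: ordered pairs of distinct boundary points. -/
def DoubleBoundary (A : Type*) : Type _ := {z : Boundary A × Boundary A // z.1 ≠ z.2}

instance (A : Type*) : TopologicalSpace (DoubleBoundary A) := instTopologicalSpaceSubtype
instance (A : Type*) : MeasurableSpace (DoubleBoundary A) := borel _
instance (A : Type*) : BorelSpace (DoubleBoundary A) := ⟨rfl⟩

/-- The diagonal translation action on `∂²F(A)`. -/
def doubleAct (g : FreeGroup A) (z : DoubleBoundary A) : DoubleBoundary A :=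
  ⟨(boundaryAct g z.1.1, boundaryAct g z.1.2),
    fun h => z.2 ((FreeGroup.lift (letterPerm (A := A)) g).injective h)⟩

/-- The flip on `∂²F(A)`. -/
def flipPair (z : DoubleBoundary A) : DoubleBoundary A := ⟨(z.1.2, z.1.1), fun h => z.2 h.symm⟩

/-- The pair `(g^{-∞}, g^∞)`. -/
noncomputable def poles (g : FreeGroup A) (hg : g ≠ 1) : DoubleBoundary A :=
  ⟨(pole g⁻¹ (inv_ne_one.2 hg), pole g hg), pole_ne_pole_inv g hg⟩

end Boundary

/-! ### Geodesic currents -/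

section Currents

variable (A : Type*) [DecidableEq A]

/-- Geodesic currents on `F(A)`: Borel measures on `∂²F(A)`, finite on compact sets, invariant
under translations and under the flip. -/
structure Curr where
  measure : Measure (DoubleBoundary A)
  finite_on_compact : ∀ K, IsCompact K → measure K < ∞
  invariant : ∀ g : FreeGroup A, ∀ B, MeasurableSet B → measure (doubleAct g ⁻¹' B) = measure B
  flip_invariant : ∀ B, MeasurableSet B → measure (flipPair ⁻¹' B) = measure B

/-- The weak-* topology: the coarsest one making `ν ↦ ∫ f dν` continuous for every continuous
compactly supported `f`. -/
noncomputable instance : TopologicalSpace (Curr A) :=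
  TopologicalSpace.induced
    (fun (ν : Curr A) (f : CompactlySupportedContinuousMap (DoubleBoundary A) ℝ) =>
      ∫ z, f z ∂ν.measure)
    Pi.topologicalSpace

/-- Nonzero currents. -/
abbrev NonzeroCurr := {ν : Curr A // ν.measure ≠ 0}

/-- The space of projectivized currents, with the quotient topology. -/
abbrev PCurr := Quot fun ν ν' : NonzeroCurr A =>
  ∃ r : ℝ≥0, 0 < r ∧ ν'.1.measure = r • ν.1.measure

variable {A}

/-- The counting current `η_g`, as a measure: the sum over the cosets `h⟨g⟩` of the unit masses
at `h(g^{-∞}, g^∞)` and `h(g^∞, g^{-∞})`. -/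
noncomputable def countingMeasure (g : FreeGroup A) (hg : g ≠ 1) :
    Measure (DoubleBoundary A) :=
  Measure.sum fun h : FreeGroup A ⧸ Subgroup.zpowers g =>
    Measure.dirac (doubleAct h.out (poles g hg)) +
      Measure.dirac (doubleAct h.out (flipPair (poles g hg)))

/-- A process `W_1, W_2, …` of elements of `F(A)` is tame if for every free basis `B` there is
`C > 0` with `|W_n|_B ≤ C n` always. (All free bases of `F(A)` can be indexed by `A`.) -/
def IsTame {Ω : Type*} (W : ℕ → Ω → FreeGroup A) : Prop :=
  ∀ B : FreeGroupBasis A (FreeGroup A), ∃ C : ℝ, 0 < C ∧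
    ∀ n : ℕ, 1 ≤ n → ∀ ω, ((B.repr (W n ω)).norm : ℝ) ≤ C * n

/-- A process is adapted to `ν ≠ 0` if almost surely `W_n ≠ 1` for all large `n` and
`[η_{W_n}] → [ν]` in the space of projectivized currents. The sequence `c` lists the currents
`η_{W_n}`, with arbitrary values at the finitely many other indices. -/
def IsAdapted {Ω : Type*} [MeasurableSpace Ω] (P : Measure Ω) (W : ℕ → Ω → FreeGroup A)
    (ν : Curr A) : Prop :=
  ∃ hν : ν.measure ≠ 0, ∀ᵐ ω ∂P, ∃ c : ℕ → NonzeroCurr A,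
    (∀ᶠ n in atTop, ∃ h : W n ω ≠ 1, (c n).1.measure = countingMeasure (W n ω) h) ∧
    Tendsto (fun n => (Quot.mk _ (c n) : PCurr A)) atTop (𝓝 (Quot.mk _ ⟨ν, hν⟩))

end Currents

/-! ### Graphs, edge-paths, the fundamental group, the universal covering tree -/

section Graphs

/-- A graph with vertex set `V` and set `E` of oriented edges. -/
structure SerreGraph (V E : Type*) where
  /-- initial vertex -/
  o : E → V
  /-- the same edge with the opposite orientation -/
  inv : E → E
  inv_inv : ∀ e, inv (inv e) = e
  inv_ne : ∀ e, inv e ≠ e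

namespace SerreGraph

variable {V E : Type*} (Γ : SerreGraph V E)

/-- Terminal vertex. -/
def t (e : E) : V := Γ.o (Γ.inv e)

/-- `l` is an edge-path from `u` to `v`. -/
def IsPath : V → List E → V → Prop
  | u, [], v => u = v
  | u, e :: l, v => Γ.o e = u ∧ IsPath (Γ.t e) l v

/-- The inverse edge-path. -/
def invPath (l : List E) : List E := (l.map Γ.inv).reverse

/-- `l` is a reduced edge-path (`[]` stands for a degenerate path). -/
def IsReducedPath (l : List E) : Prop := l.IsChain fun e f => Γ.t e = Γ.o f ∧ f ≠ Γ.inv e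

/-- `l` is a closed edge-path. -/
def IsClosedPath (l : List E) : Prop := ∃ v, Γ.IsPath v l v

def Connected : Prop := ∀ u v, ∃ l, Γ.IsPath u l v

theorem IsPath.append {Γ : SerreGraph V E} {u v w : V} {l m : List E} (hl : Γ.IsPath u l v)
    (hm : Γ.IsPath v m w) : Γ.IsPath u (l ++ m) w := by
  induction l generalizing u with
  | nil => cases hl; exact hm
  | cons e l ih => exact ⟨hl.1, ih hl.2⟩

theorem IsPath.invPath {Γ : SerreGraph V E} {u v : V} {l : List E} (hl : Γ.IsPath u l v) :
    Γ.IsPath v (Γ.invPath l) u := by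
  induction l generalizing u with
  | nil => exact Eq.symm hl
  | cons e l ih =>
    have h := (ih hl.2).append (l := Γ.invPath l) (m := [Γ.inv e]) (w := u)
      ⟨rfl, by simp only [IsPath, t, Γ.inv_inv]; exact hl.1⟩
    simpa [SerreGraph.invPath] using h

/-- Closed edge-paths based at `x`. -/
def Loop (x : V) : Type _ := {l : List E // Γ.IsPath x l x}

/-- Elementary homotopy: insertion of a subpath `e e⁻¹`. -/
def Step (x : V) (p q : Γ.Loop x) : Prop :=
  ∃ l m e, p.1 = l ++ m ∧ q.1 = l ++ e :: Γ.inv e :: m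

/-- The fundamental group `π₁(Γ, x)`: closed edge-paths at `x` up to the equivalence relation
generated by elementary homotopies. -/
def Pi1 (x : V) : Type _ := Quot (Γ.Step x)

/-- The homotopy class of a closed edge-path. -/
def Pi1.mk {Γ : SerreGraph V E} {x : V} (l : List E) (h : Γ.IsPath x l x) : Γ.Pi1 x :=
  Quot.mk _ ⟨l, h⟩

theorem Pi1.mk_cancel {Γ : SerreGraph V E} {x y : V} (l : List E) :
    ∀ (a : List E) (h : Γ.IsPath x (a ++ Γ.invPath l ++ l) y)
      (_ : Γ.IsPath x a y) (hxy : y = x),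
      (Pi1.mk (Γ := Γ) (x := x) (a ++ Γ.invPath l ++ l) (by rw [hxy] at h; exact h)) =
        Pi1.mk a (by subst hxy; assumption) := by
  intro a h ha hxy
  subst hxy
  induction l generalizing a with
  | nil => simp [SerreGraph.invPath]
  | cons e l ih =>
    have key : Γ.IsPath y (a ++ Γ.invPath l ++ l) y := by
      clear ih
      have split : ∀ (p q : List E) (u w : V), Γ.IsPath u (p ++ q) w →
          ∃ v, Γ.IsPath u p v ∧ Γ.IsPath v q w := by
        intro p
        induction p with
        | nil => intro q u w h; exact ⟨u, rfl, h⟩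
        | cons f p ih =>
          intro q u w h
          obtain ⟨v, h1, h2⟩ := ih q _ _ h.2
          exact ⟨v, ⟨h.1, h1⟩, h2⟩
      have e1 : a ++ Γ.invPath (e :: l) ++ e :: l =
          (a ++ Γ.invPath l) ++ (Γ.inv e :: e :: l) := by simp [SerreGraph.invPath]
      rw [e1] at h
      obtain ⟨v, h1, h2⟩ := split _ _ _ _ h
      refine h1.append ?_
      obtain ⟨h3, h4, h5⟩ := h2
      rw [← h3]
      exact h5
    rw [← ih a key ha]
    refine (Quot.sound ⟨a ++ Γ.invPath l, l, Γ.inv e, rfl, ?_⟩).symm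
    simp [SerreGraph.invPath, Γ.inv_inv]

instance (x : V) : Group (Γ.Pi1 x) where
  mul := Quot.map₂ (fun p q => ⟨p.1 ++ q.1, p.2.append q.2⟩)
    (by
      rintro p q r ⟨l, m, e, h1, h2⟩
      exact ⟨p.1 ++ l, m, e, by simp [h1], by simp [h2]⟩)
    (by
      rintro p q r ⟨l, m, e, h1, h2⟩
      exact ⟨l, m ++ r.1, e, by simp [h1], by simp [h2]⟩)
  one := Pi1.mk [] rfl
  inv := Quot.map (fun p => ⟨Γ.invPath p.1, p.2.invPath⟩)
    (by
      rintro p q ⟨l, m, e, h1, h2⟩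
      refine ⟨Γ.invPath m, Γ.invPath l, e, by simp [h1, SerreGraph.invPath], ?_⟩
      simp [h2, SerreGraph.invPath, Γ.inv_inv])
  mul_assoc := by
    rintro ⟨p⟩ ⟨q⟩ ⟨r⟩
    exact congrArg (Quot.mk _) (Subtype.ext (List.append_assoc _ _ _))
  one_mul := by
    rintro ⟨p⟩
    rfl
  mul_one := by
    rintro ⟨p⟩
    exact congrArg (Quot.mk _) (Subtype.ext (List.append_nil _))
  inv_mul_cancel := by
    rintro ⟨p⟩
    exact Pi1.mk_cancel p.1 [] (by simpa using p.2.invPath.append p.2) rfl rfl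

/-- Vertices of the universal covering tree of `(Γ, x)`: reduced edge-paths starting at `x`. -/
def TreeVertex (x : V) : Type _ := {l : List E // Γ.IsReducedPath l ∧ ∃ y, Γ.IsPath x l y}

/-- The covering tree has an edge labelled `e` from `p` to `q`. -/
def EdgeOver {x : V} (p : Γ.TreeVertex x) (e : E) (q : Γ.TreeVertex x) : Prop :=
  q.1 = p.1 ++ [e] ∨ p.1 = q.1 ++ [Γ.inv e]

/-- The universal covering tree `T₀` of `(Γ, x)`. -/
def tree (x : V) : SimpleGraph (Γ.TreeVertex x) where
  Adj p q := ∃ e, Γ.EdgeOver p e q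
  symm := ⟨by
    rintro p q ⟨e, h | h⟩
    · exact ⟨Γ.inv e, Or.inr (by rw [Γ.inv_inv]; exact h)⟩
    · exact ⟨Γ.inv e, Or.inl h⟩⟩
  loopless := ⟨by
    rintro p ⟨e, h | h⟩ <;> simpa using congrArg List.length h⟩

/-- The segment `[p, q]` of the covering tree is a lift of the edge-path `v`. -/
def IsLift {x : V} : Γ.TreeVertex x → List E → Γ.TreeVertex x → Prop
  | p, [], q => p = q
  | p, e :: v, q => ∃ r, Γ.EdgeOver p e r ∧ IsLift r v q

open Classical in
/-- The subpath `cyc(γ)` obtained by maximal cyclic reduction: as long as the first and the last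
edge are mutually inverse, remove both. -/
noncomputable def cyc : List E → List E :=
  List.bidirectionalRec
    (nil := [])
    (singleton := fun e => [e])
    (cons_append := fun e l f r => if f = Γ.inv e then r else e :: l ++ [f])

/-- A closing path system: reduced edge-paths `β e e'` such that `e (β e e') e'` is a reduced
edge-path. -/
def IsClosingSystem (β : E → E → List E) : Prop :=
  ∀ e e', Γ.IsReducedPath (β e e') ∧ Γ.IsReducedPath (e :: β e e' ++ [e'])

/-- The closing `γ (β e e')` of a nondegenerate path `γ` with last edge `e`, first edge `e'`. -/
def closing (β : E → E → List E) : List E → List E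
  | [] => []
  | e' :: l => (e' :: l) ++ β ((e' :: l).getLast (List.cons_ne_nil _ _)) e'

open Classical in
/-- The modified closing: `cyc(γ)` if `γ` is closed, and the closing of `γ` otherwise. -/
noncomputable def modifiedClosing (β : E → E → List E) (γ : List E) : List E :=
  if Γ.IsClosedPath γ then Γ.cyc γ else closing β γ

end SerreGraph

end Graphs

/-! ### Simplicial charts -/

/-- A simplicial chart on `F(A)`: a finite connected graph with all vertices of degree at
least `3` and first Betti number `#A`, with a marking `F(A) ≅ π₁(Γ, x₀)`. -/
structure Chart (A V E : Type*) [Fintype A] extends SerreGraph V E where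
  finite_V : Finite V
  finite_E : Finite E
  connected : toSerreGraph.Connected
  degree : ∀ v, 3 ≤ Nat.card {e : E // toSerreGraph.o e = v}
  /-- `#E / 2 - #V + 1 = #A`, where `E` consists of the oriented edges -/
  betti : Nat.card E + 2 = 2 * Nat.card V + 2 * Fintype.card A
  x₀ : V
  marking : FreeGroup A ≃* toSerreGraph.Pi1 x₀

namespace Chart

variable {A V E : Type*} [Fintype A] [DecidableEq A] (Γ : Chart A V E)

/-- The covering tree of the chart. -/
abbrev T₀ : SimpleGraph (Γ.TreeVertex Γ.x₀) := Γ.tree Γ.x₀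

/-- `p` is the translate by `g` of the base vertex of the covering tree. -/
def IsOrbitVertex (g : FreeGroup A) (p : Γ.TreeVertex Γ.x₀) : Prop :=
  ∃ h : Γ.IsPath Γ.x₀ p.1 Γ.x₀, Γ.marking g = SerreGraph.Pi1.mk p.1 h

/-- A ray `ρ` of `T₀` ends at the boundary point `x`, where `∂F(A)` is identified with `∂T₀`
through the orbit map: `ρ` stays in a bounded neighbourhood of the translates of the base vertex
by the prefixes of `x`. -/
def EndsAt (ρ : ℕ → Γ.TreeVertex Γ.x₀) (x : Boundary A) : Prop :=
  ∃ C : ℕ, ∀ n, ∃ m p, Γ.IsOrbitVertex (x.prefixElement m) p ∧ Γ.T₀.dist (ρ n) p ≤ C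

/-- `γ` is the bi-infinite geodesic of `T₀` from `z.1` to `z.2`. -/
def IsGeodesicFromTo (γ : ℤ → Γ.TreeVertex Γ.x₀) (z : DoubleBoundary A) : Prop :=
  (∀ i j, Γ.T₀.dist (γ i) (γ j) = (i - j).natAbs) ∧
    Γ.EndsAt (fun n => γ (-n)) z.1.1 ∧ Γ.EndsAt (fun n => γ n) z.1.2

/-- The cylinder of the oriented segment `[p, q]`: the pairs whose geodesic passes through `[p, q]`
in the direction from `p` to `q`. -/
def cylinder (p q : Γ.TreeVertex Γ.x₀) : Set (DoubleBoundary A) :=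
  {z | ∃ γ, Γ.IsGeodesicFromTo γ z ∧ ∃ i j, i ≤ j ∧ γ i = p ∧ γ j = q}

open Classical in
/-- The element of `F(A)` represented, through the marking, by the closed edge-path `c` based at
a vertex `v`, with the base-points joined by `δ v`. Lists that are not closed paths, and the empty
list, give `1`. -/
noncomputable def pathElement (δ : V → List E) : List E → FreeGroup A
  | [] => 1
  | e :: l =>
    if h : Γ.IsPath Γ.x₀ (δ (Γ.o e) ++ (e :: l) ++ Γ.invPath (δ (Γ.o e))) Γ.x₀ then
      Γ.marking.symm (SerreGraph.Pi1.mk _ h)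
    else 1

end Chart

/-! ### Finite-state Markov chains -/

section Markov

/-- Probability distributions on a finite set. -/
def IsDistribution {S : Type*} [Fintype S] (μ : S → ℝ) : Prop :=
  (∀ s, 0 ≤ μ s) ∧ ∑ s, μ s = 1

/-- A finite-state Markov chain with state set `S`. -/
structure MarkovChain (S : Type*) [Fintype S] where
  p : S → S → ℝ
  nonneg : ∀ s s', 0 ≤ p s s'
  sum_eq_one : ∀ s, ∑ s', p s s' = 1

namespace MarkovChain

variable {S : Type*} [Fintype S] (X : MarkovChain S)

/-- `X.step n` is the matrix of `(n + 1)`-step transition probabilities. -/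
def step : ℕ → S → S → ℝ
  | 0, s, s' => X.p s s'
  | n + 1, s, s' => ∑ r, step n s r * X.p r s'

def IsIrreducible : Prop := ∀ s s', ∃ n, 0 < X.step n s s'

def IsStationary (μ : S → ℝ) : Prop :=
  IsDistribution μ ∧ ∀ s', ∑ s, μ s * X.p s s' = μ s'

/-- `p(s₁, s₂) ⋯ p(s_{n-1}, s_n)` for the word `s :: w = s₁ … s_n`. -/
def pathProb : S → List S → ℝ
  | _, [] => 1
  | s, s' :: w => X.p s s' * pathProb s' w

/-- `μ(s₁) p(s₁, s₂) ⋯ p(s_{n-1}, s_n)` for the word `s₁ … s_n`. -/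
def wordProb (μ : S → ℝ) : List S → ℝ
  | [] => 1
  | s :: w => μ s * X.pathProb s w

/-- `ξ 0, ξ 1, …` is the Markov process defined by the chain and the initial distribution `μ`:
its finite-dimensional distributions are given by `wordProb`. -/
def HasMarkovLaw {Ω : Type*} [MeasurableSpace Ω] (μ : S → ℝ) (P : Measure Ω) (ξ : ℕ → Ω → S) :
    Prop :=
  (∀ n s, MeasurableSet {ω | ξ n ω = s}) ∧
    ∀ (n : ℕ) (w : Fin n → S),
      P {ω | ∀ i : Fin n, ξ i ω = w i} = ENNReal.ofReal (X.wordProb μ (List.ofFn w))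

end MarkovChain

end Markov

namespace Chart

variable {A V E : Type*} [Fintype A] [DecidableEq A] (Γ : Chart A V E) {S : Finset E}

/-- A Markov chain with states in `S ⊆ E` is based on the graph: `#S ≥ 2`, and transitions of
positive probability are the length-two reduced edge-paths. -/
def IsBased (X : MarkovChain S) : Prop :=
  2 ≤ S.card ∧ ∀ e e' : S, 0 < X.p e e' → Γ.t e = Γ.o e' ∧ (e' : E) ≠ Γ.inv e

open Classical in
/-- `μ₀[k](v)` for an edge-path `v` of length `k`, extended by `0` if `v` leaves the state set. -/
noncomputable def pathWeight (X : MarkovChain S) (μ₀ : S → ℝ) (v : List E) : ℝ :=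
  if h : ∀ e ∈ v, e ∈ S then X.wordProb μ₀ (v.pmap Subtype.mk h) else 0

/-- `ν` is the characteristic current of the chain: the weight in `ν` of every nondegenerate reduced
edge-path `v`, that is, the measure of the cylinder of any lift of `v`, is
`μ₀[k](v) + μ₀[k](v⁻¹)`, where `μ₀` is the stationary distribution. -/
def IsCharacteristicCurrent (X : MarkovChain S) (ν : Curr A) : Prop :=
  ∃ μ₀, X.IsStationary μ₀ ∧
    ∀ v, v ≠ [] → Γ.IsReducedPath v → ∀ p q, Γ.IsLift p v q →
      ν.measure (Γ.cylinder p q) =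
        ENNReal.ofReal (pathWeight X μ₀ v + pathWeight X μ₀ (Γ.invPath v))

/-- The walk `W_n`: the word formed by the first `n` states of the process. -/
def walk {Ω : Type*} (ξ : ℕ → Ω → S) (n : ℕ) (ω : Ω) : List E :=
  List.ofFn fun i : Fin n => (ξ i ω : E)

/-- The modified closing of the walk, as a process of elements of `F(A)`. -/
noncomputable def modifiedWalk (β : E → E → List E) (δ : V → List E) {Ω : Type*}
    (ξ : ℕ → Ω → S) (n : ℕ) (ω : Ω) : FreeGroup A :=
  Γ.pathElement δ (Γ.modifiedClosing β (walk ξ n ω))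

end Chart

end GraphWalk

open GraphWalk

/-!
The idea is to describe everything by words. Choose one edge of each pair `{e, e⁻¹}` of `Γ` and
read edge-paths as elements of the free group `F` on the chosen edges. Then `π₁(Γ, x₀)`, and through
the marking `F(A)`, embeds into `F` (`pi1Hom_injective`, `Chart.emb`), the vertices of the universal
covering tree are elements of `F` (`TreeVertex.elt`), and the distance of the tree is the word
metric of `F` (`Chart.dist_eq`). The embedding of `F(A)` extends to the boundaries (`boundaryMap`),
so that a boundary point of `F(A)` becomes an infinite reduced word in the edges of `Γ`, and the
geodesic from `x` to `y` passes through `[p, q]` if and only if certain letters of `p⁻¹ x` and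
`q⁻¹ y` avoid given values (`Chart.mem_cylinder_iff`). Cylinders are therefore compact and open, and
those in which the two words are required to begin with distinct words of equal length form a basis
of the topology that is closed under nonempty intersections (`isTopologicalBasis_rootedCylinders`,
`isPiSystem_rootedCylinders`).

Consequently a current is determined by its weights, that is, its values on cylinders
(`HasWeights.eq`). Invariance under `F(A)` and under the flip follows from invariance of the weights,
convergence of weights implies weak-* convergence (`tendsto_integral_of_hasWeights`), since
continuous functions of compact support are uniform limits of combinations of indicator functions of
cylinders, and limits of weights are weights of a measure, by the Riesz–Markov–Kakutani theorem
(`exists_hasWeights`). In this language the counting current of a cyclically reduced closed path `c`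
gives to the cylinder of `v` the number of occurrences of `v` and `v⁻¹` in the cyclic word `c`
(`countingMeasure_cylinder`): the translates of the axis of `c` through a segment correspond to the
positions at which the segment is read along `c`.

It remains to count occurrences of `v` in the closings of a trajectory. Along almost every
trajectory the transitions out of each word have the expected frequencies
(`HasMarkovLaw.ae_isTypical`); this is a strong law for bounded, pairwise orthogonal variables
(`ae_tendsto_sum_div_of_orthogonal`), to which the Markov property applies without any assumption on
the initial distribution. Hence every limit point of the occupation frequencies of states is
stationary, the stationary distribution is unique by irreducibility, and by induction on the length
the frequency of each word tends to its stationary probability (`IsTypical.tendsto_frequency`).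

A cyclic reduction could destroy this only if it removed most of the trajectory, in which case the
last quarter of the trajectory would be the inverse of the first. If some state of the chain has two
successors, the probability of this decays exponentially and the Borel–Cantelli lemma excludes it;
otherwise the trajectory is periodic and would contain an edge followed by its inverse
(`HasMarkovLaw.ae_eventually_not_mirror`). So the modified closing consists of a segment of the
trajectory of length at least `n / 2` and a path of bounded length, and its cyclic frequencies have
the same limits (`tendsto_cyclicCount_div`). The weights of the counting currents, divided by the
length of the closing, therefore converge to `μ₀[k](v) + μ₀[k](v⁻¹)`. Applied to a single such
trajectory this yields the existence of the characteristic current, and applied to almost every one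
it yields adaptedness. The process is tame because the group element of a path is a product of
boundedly long contributions of its edges (`exists_norm_pathElement_le`).
-/

namespace GraphWalk

/-! ### Reduced words and convergence to the boundary of a free group -/

section Words

variable {B : Type*}

/-- The first `k` letters of a boundary point. -/
def Boundary.pre (x : Boundary B) (k : ℕ) : List (B × Bool) := List.ofFn fun i : Fin k => x.1 i

/-- The inverse letter. -/
def invLetter (l : B × Bool) : B × Bool := (l.1, !l.2)

@[simp] theorem invLetter_invLetter (l : B × Bool) : invLetter (invLetter l) = l := by
  simp [invLetter]

theorem ne_invLetter_iff {a b : B × Bool} : b ≠ invLetter a ↔ (a.1 = b.1 → a.2 = b.2) := by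
  obtain ⟨a1, a2⟩ := a
  obtain ⟨b1, b2⟩ := b
  simp only [invLetter, ne_eq, Prod.mk.injEq, not_and]
  constructor
  · intro h h1
    have := h h1.symm
    revert this
    cases a2 <;> cases b2 <;> simp
  · intro h h1 h2
    have := h h1.symm
    subst h2
    revert this
    cases a2 <;> simp

theorem isReduced_iff {L : List (B × Bool)} :
    FreeGroup.IsReduced L ↔ L.IsChain fun a b => b ≠ invLetter a := by
  unfold FreeGroup.IsReduced
  simp only [ne_invLetter_iff]

theorem Boundary.ne_invLetter (x : Boundary B) (i : ℕ) : x.1 (i + 1) ≠ invLetter (x.1 i) :=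
  ne_invLetter_iff.2 (x.2 i)

/-- The boundary point given by an infinite reduced word. -/
def Boundary.ofFun (f : ℕ → B × Bool) (hf : ∀ i, f (i + 1) ≠ invLetter (f i)) : Boundary B :=
  ⟨f, fun i => ne_invLetter_iff.1 (hf i)⟩

@[simp] theorem Boundary.length_pre (x : Boundary B) (k : ℕ) : (x.pre k).length = k := by
  simp [pre]

@[simp] theorem Boundary.pre_zero (x : Boundary B) : x.pre 0 = [] := by
  simp [pre]

@[simp] theorem Boundary.getElem_pre (x : Boundary B) (k i : ℕ) (h : i < (x.pre k).length) :
    (x.pre k)[i] = x.1 i := by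
  simp [pre]

theorem Boundary.pre_succ (x : Boundary B) (k : ℕ) : x.pre (k + 1) = x.pre k ++ [x.1 k] := by
  rw [pre, pre, List.ofFn_succ_last]
  rfl

theorem Boundary.pre_succ' (x : Boundary B) (k : ℕ) :
    x.pre (k + 1) = x.1 0 :: List.ofFn fun i : Fin k => x.1 (i + 1) := by
  simp [pre, List.ofFn_succ]

theorem Boundary.pre_prefix_pre (x : Boundary B) {k m : ℕ} (h : k ≤ m) : x.pre k <+: x.pre m := by
  induction m, h using Nat.le_induction with
  | base => exact List.prefix_rfl
  | succ m _ ih => exact ih.trans (by rw [pre_succ]; exact List.prefix_append _ _)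

theorem Boundary.isReduced_pre (x : Boundary B) (k : ℕ) : FreeGroup.IsReduced (x.pre k) := by
  rw [FreeGroup.IsReduced, List.isChain_iff_getElem]
  intro i hi
  simpa using x.2 i

theorem Boundary.pre_eq_iff (x : Boundary B) (L : List (B × Bool)) :
    x.pre L.length = L ↔ ∀ i (h : i < L.length), x.1 i = L[i] := by
  constructor
  · intro h i hi
    have : (x.pre L.length)[i]'(by simpa using hi) = L[i] := by simp only [h]
    rw [← this]
    simp
  · intro h
    apply List.ext_getElem (by simp)
    intro i h1 h2
    rw [Boundary.getElem_pre, h i h2]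

theorem Boundary.ext_pre {x y : Boundary B} (h : ∀ k, x.pre k = y.pre k) : x = y := by
  apply Subtype.ext
  funext i
  have h1 := h (i + 1)
  rw [pre_succ, pre_succ] at h1
  simpa using (List.append_inj' h1 rfl).2

theorem pre_prefix_iff {x : Boundary B} {k : ℕ} {L : List (B × Bool)} :
    x.pre k <+: L ↔ x.pre k = L.take k := by
  rw [List.prefix_iff_eq_take, Boundary.length_pre]

theorem Boundary.prefixElement_eq_mk (x : Boundary B) (k : ℕ) :
    x.prefixElement k = FreeGroup.mk (x.pre k) := rfl

theorem mk_singleton_mul_invLetter (l : B × Bool) :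
    (FreeGroup.mk [l] * FreeGroup.mk [invLetter l] : FreeGroup B) = 1 := by
  have : (FreeGroup.mk [invLetter l] : FreeGroup B) = (FreeGroup.mk [l])⁻¹ := by
    rw [FreeGroup.inv_mk]; rfl
  rw [this, mul_inv_cancel]

variable [DecidableEq B]

@[simp] theorem Boundary.toWord_prefixElement (x : Boundary B) (k : ℕ) :
    (x.prefixElement k).toWord = x.pre k := by
  rw [Boundary.prefixElement, FreeGroup.toWord_mk]
  exact (x.isReduced_pre k).reduce_eq

@[simp] theorem Boundary.norm_prefixElement (x : Boundary B) (k : ℕ) :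
    (x.prefixElement k).norm = k := by
  simp [FreeGroup.norm]

theorem toWord_mk_of_isReduced {L : List (B × Bool)} (h : FreeGroup.IsReduced L) :
    (FreeGroup.mk L).toWord = L := by
  rw [FreeGroup.toWord_mk, h.reduce_eq]

theorem norm_mul_inv_comm (g h : FreeGroup B) : (g⁻¹ * h).norm = (h⁻¹ * g).norm := by
  rw [← FreeGroup.norm_inv_eq]
  simp

theorem norm_triangle (g h k : FreeGroup B) :
    (g⁻¹ * k).norm ≤ (g⁻¹ * h).norm + (h⁻¹ * k).norm := by
  have := FreeGroup.norm_mul_le (g⁻¹ * h) (h⁻¹ * k)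
  simpa [mul_assoc] using this

theorem norm_le_norm_add (g h : FreeGroup B) : h.norm ≤ g.norm + (g⁻¹ * h).norm := by
  have := FreeGroup.norm_mul_le g (g⁻¹ * h)
  simpa using this

/-- Right multiplication by a letter either cancels the last letter or appends a new one. -/
theorem toWord_mul_letter (g : FreeGroup B) (l : B × Bool) :
    (g * FreeGroup.mk [l]).toWord =
      if g.toWord.getLast? = some (invLetter l) then g.toWord.dropLast else g.toWord ++ [l] := by
  have hr : FreeGroup.IsReduced g.toWord := FreeGroup.isReduced_toWord
  have hg : g = FreeGroup.mk g.toWord := FreeGroup.mk_toWord.symm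
  rcases List.eq_nil_or_concat' g.toWord with h | ⟨L, m, h⟩
  · rw [h] at hg
    rw [hg]
    simp [FreeGroup.toWord_mk]
  · rw [h] at hg hr
    rw [h, List.getLast?_concat]
    split_ifs with h1
    · have h1 := Option.some.inj h1
      have : g * FreeGroup.mk [l] = FreeGroup.mk L := by
        rw [hg, h1, ← FreeGroup.mul_mk, mul_assoc]
        have := mk_singleton_mul_invLetter (invLetter l)
        rw [invLetter_invLetter] at this
        rw [this, mul_one]
      rw [this, List.dropLast_concat]
      exact toWord_mk_of_isReduced (hr.infix ⟨[], [m], by simp⟩)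
    · rw [hg, FreeGroup.mul_mk]
      apply toWord_mk_of_isReduced
      rw [isReduced_iff] at hr ⊢
      rw [List.isChain_append]
      refine ⟨hr, List.isChain_singleton _, ?_⟩
      intro x hx y hy
      simp only [List.getLast?_concat, Option.mem_def, Option.some.injEq, List.head?_cons] at hx hy
      subst hx hy
      intro h2
      apply h1
      rw [h2, invLetter_invLetter]

/-- A path in the Cayley tree that leaves the subtree of the words beginning with `w` passes
through `w`. -/
theorem exists_split_of_not_prefix {w : List (B × Bool)} (L : List (B × Bool)) {g : FreeGroup B}
    (h : w <+: g.toWord) (h' : ¬ w <+: (g * FreeGroup.mk L).toWord) :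
    ∃ L₁ L₂, L = L₁ ++ L₂ ∧ (g * FreeGroup.mk L₁).toWord = w := by
  induction L generalizing g with
  | nil => exact absurd (by simpa [← FreeGroup.one_eq_mk] using h) h'
  | cons l L ih =>
    have e : g * FreeGroup.mk (l :: L) = g * FreeGroup.mk [l] * FreeGroup.mk L := by
      rw [mul_assoc, FreeGroup.mul_mk]; rfl
    by_cases h1 : w <+: (g * FreeGroup.mk [l]).toWord
    · rw [e] at h'
      obtain ⟨L₁, L₂, h2, h3⟩ := ih h1 h'
      refine ⟨l :: L₁, L₂, by rw [h2]; rfl, ?_⟩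
      rw [← h3, mul_assoc, FreeGroup.mul_mk]; rfl
    · refine ⟨[], l :: L, rfl, ?_⟩
      rw [toWord_mul_letter] at h1
      rw [← FreeGroup.one_eq_mk, mul_one]
      split_ifs at h1 with h2
      · rcases List.eq_nil_or_concat' g.toWord with h3 | ⟨L', m, h3⟩
        · rw [h3] at h2; simp at h2
        · rw [h3, List.dropLast_concat] at h1
          rw [h3] at h ⊢
          rcases List.prefix_concat_iff.1 h with h4 | h4
          · exact h4.symm
          · exact absurd h4 h1
      · exact absurd (h.trans (List.prefix_append _ _)) h1

/-- A point closer to `g` than `g` is to its prefix `w` lies in the subtree of `w`, because a path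
that leaves this subtree passes through `w`. -/
theorem prefix_of_norm_lt {w : List (B × Bool)} {g h : FreeGroup B} (hw : w <+: g.toWord)
    (hlt : w.length + (g⁻¹ * h).norm < g.norm) : w <+: h.toWord := by
  by_contra h'
  have e : h = g * FreeGroup.mk (g⁻¹ * h).toWord := by rw [FreeGroup.mk_toWord]; simp
  rw [e] at h'
  obtain ⟨L₁, L₂, h1, h2⟩ := exists_split_of_not_prefix _ hw h'
  have h3 := norm_le_norm_add (g * FreeGroup.mk L₁) g
  have h4 : ((g * FreeGroup.mk L₁)⁻¹ * g).norm ≤ L₁.length := by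
    rw [norm_mul_inv_comm]
    simpa using FreeGroup.norm_mk_le (L₁ := L₁)
  have h5 : (g * FreeGroup.mk L₁).norm = w.length := by rw [FreeGroup.norm, h2]
  have h6 : L₁.length ≤ (g⁻¹ * h).norm := by
    rw [FreeGroup.norm, h1]; simp
  omega

/-- If `g` lies in the subtree of `w` and `h` does not, then `w` is no farther from `h` than `g`
is, since it is on the geodesic from `g` to `h`. -/
theorem norm_le_of_not_prefix {w : List (B × Bool)} {g h : FreeGroup B} (hw : w <+: g.toWord)
    (h' : ¬ w <+: h.toWord) : (h⁻¹ * FreeGroup.mk w).norm ≤ (g⁻¹ * h).norm := by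
  have e : h = g * FreeGroup.mk (g⁻¹ * h).toWord := by rw [FreeGroup.mk_toWord]; simp
  rw [e] at h'
  obtain ⟨L₁, L₂, h1, h2⟩ := exists_split_of_not_prefix _ hw h'
  have h3 : FreeGroup.mk w = g * FreeGroup.mk L₁ := by rw [← h2, FreeGroup.mk_toWord]
  have h4 : h = FreeGroup.mk w * FreeGroup.mk L₂ := by
    rw [h3, mul_assoc, FreeGroup.mul_mk, ← h1]; exact e
  have h5 : (h⁻¹ * FreeGroup.mk w).norm ≤ L₂.length := by
    rw [norm_mul_inv_comm, h4, inv_mul_cancel_left]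
    exact FreeGroup.norm_mk_le
  have h6 : L₂.length ≤ (g⁻¹ * h).norm := by
    rw [FreeGroup.norm, h1]; simp
  omega

theorem convergesTo_iff {u : ℕ → FreeGroup B} {x : Boundary B} :
    ConvergesTo u x ↔ ∀ k, ∀ᶠ n in atTop, x.pre k <+: (u n).toWord := Iff.rfl

theorem ConvergesTo.eq {u : ℕ → FreeGroup B} {x y : Boundary B} (hx : ConvergesTo u x)
    (hy : ConvergesTo u y) : x = y := by
  apply Boundary.ext_pre
  intro k
  obtain ⟨n, h1, h2⟩ := ((convergesTo_iff.1 hx k).and (convergesTo_iff.1 hy k)).exists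
  rw [pre_prefix_iff] at h1 h2
  rw [h1, h2]

theorem ConvergesTo.comp {u : ℕ → FreeGroup B} {x : Boundary B} (hx : ConvergesTo u x)
    {m : ℕ → ℕ} (hm : Tendsto m atTop atTop) : ConvergesTo (fun n => u (m n)) x :=
  fun k => hm.eventually (hx k)

theorem ConvergesTo.of_dist_le {u v : ℕ → FreeGroup B} {x : Boundary B} (hx : ConvergesTo u x)
    {C : ℕ} (h : ∀ n, ((u n)⁻¹ * v n).norm ≤ C) : ConvergesTo v x := by
  rw [convergesTo_iff] at hx ⊢
  intro k
  filter_upwards [hx (k + C + 1)] with n hn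
  have h1 : k + C + 1 ≤ (u n).norm := by simpa [FreeGroup.norm] using hn.length_le
  refine prefix_of_norm_lt ((x.pre_prefix_pre (by omega)).trans hn) ?_
  have := h n
  simp only [Boundary.length_pre]
  omega

theorem convergesTo_prefixElement (x : Boundary B) : ConvergesTo x.prefixElement x := by
  rw [convergesTo_iff]
  intro k
  filter_upwards [eventually_ge_atTop k] with n hn
  rw [Boundary.toWord_prefixElement]
  exact x.pre_prefix_pre hn

/-- If a sequence with bounded jumps stays outside a large ball from time `N` on, then its prefix
of the corresponding length is constant from time `N` on. -/
theorem take_eq_of_bounded_jumps {u : ℕ → FreeGroup B} {C : ℕ}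
    (hC : ∀ n, ((u n)⁻¹ * u (n + 1)).norm ≤ C) {k N : ℕ} (hN : ∀ n, N ≤ n → k + C < (u n).norm)
    {n : ℕ} (hn : N ≤ n) : (u N).toWord.take k <+: (u n).toWord := by
  induction n, hn using Nat.le_induction with
  | base => exact List.take_prefix _ _
  | succ n hn ih =>
    refine prefix_of_norm_lt ih ?_
    have h1 := hC n
    have h2 := hN n hn
    have h3 : ((u N).toWord.take k).length ≤ k := by simp
    omega

/-- A sequence in the Cayley tree with bounded jumps that leaves every ball converges to a boundary
point, whose letters are the prefixes that are eventually constant. -/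
theorem exists_convergesTo {u : ℕ → FreeGroup B} {C : ℕ}
    (hC : ∀ n, ((u n)⁻¹ * u (n + 1)).norm ≤ C) (hu : Tendsto (fun n => (u n).norm) atTop atTop) :
    ∃ x, ConvergesTo u x := by
  have h1 : ∀ k, ∃ N, ∀ n, N ≤ n → k + C < (u n).norm := fun k =>
    eventually_atTop.1 (hu.eventually (eventually_gt_atTop (k + C)))
  choose N hN using h1
  have hlen : ∀ k, ((u (N k)).toWord.take k).length = k := by
    intro k
    have := hN k _ le_rfl
    rw [List.length_take]
    simp only [FreeGroup.norm] at this
    omega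
  have hp : ∀ k n, N k ≤ n → (u (N k)).toWord.take k <+: (u n).toWord := fun k n hn =>
    take_eq_of_bounded_jumps hC (hN k) hn
  let f : ℕ → B × Bool := fun i => ((u (N (i + 1))).toWord.take (i + 1))[i]'(by rw [hlen]; omega)
  have hf : ∀ i k n (h : i < k), N k ≤ n → (u n).toWord[i]? = some (f i) := by
    intro i k n h hn
    set M := max n (N (i + 1))
    have e1 : (u n).toWord.take k = (u (N k)).toWord.take k := by
      have := (List.prefix_iff_eq_take.1 (hp k n hn)).symm
      rwa [hlen] at this
    have e2 : (u M).toWord.take k = (u (N k)).toWord.take k := by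
      have := (List.prefix_iff_eq_take.1 (hp k M (hn.trans (le_max_left _ _)))).symm
      rwa [hlen] at this
    have e3 : (u M).toWord.take (i + 1) = (u (N (i + 1))).toWord.take (i + 1) := by
      have := (List.prefix_iff_eq_take.1 (hp (i + 1) M (le_max_right _ _))).symm
      rwa [hlen] at this
    have e4 : (u n).toWord[i]? = (u M).toWord[i]? := by
      rw [← List.getElem?_take_of_lt h, e1, ← e2, List.getElem?_take_of_lt h]
    rw [e4, ← List.getElem?_take_of_lt (Nat.lt_succ_self i), e3, List.getElem?_eq_getElem]
  have hr : ∀ i, f (i + 1) ≠ invLetter (f i) := by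
    intro i
    have h1 := hf i (i + 2) _ (by omega) le_rfl
    have h2 := hf (i + 1) (i + 2) _ (by omega) le_rfl
    have hr : FreeGroup.IsReduced (u (N (i + 2))).toWord := FreeGroup.isReduced_toWord
    rw [isReduced_iff, List.isChain_iff_getElem] at hr
    obtain ⟨h3, h4⟩ := List.getElem?_eq_some_iff.1 h2
    obtain ⟨h5, h6⟩ := List.getElem?_eq_some_iff.1 h1
    have := hr i h3
    rwa [h4, h6] at this
  refine ⟨Boundary.ofFun f hr, ?_⟩
  rw [convergesTo_iff]
  intro k
  filter_upwards [eventually_ge_atTop (N k)] with n hn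
  rw [pre_prefix_iff]
  apply List.ext_getElem?
  intro i
  by_cases hi : i < k
  · rw [List.getElem?_take_of_lt hi, hf i k n hi hn, List.getElem?_eq_getElem (by simpa using hi),
      Boundary.getElem_pre]
    rfl
  · rw [List.getElem?_eq_none (by simpa using hi), List.getElem?_eq_none]
    simp only [List.length_take]
    omega

/-- A sequence with bounded jumps that converges to `x` passes near every prefix of `x`. -/
theorem ConvergesTo.exists_near {u : ℕ → FreeGroup B} {x : Boundary B} (hx : ConvergesTo u x)
    {C : ℕ} (hC : ∀ n, ((u n)⁻¹ * u (n + 1)).norm ≤ C) (k : ℕ) :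
    ∃ n, ((u n)⁻¹ * x.prefixElement k).norm ≤ C + 2 * (u 0).norm := by
  classical
  have hex : ∃ n, x.pre k <+: (u n).toWord := (convergesTo_iff.1 hx k).exists
  rcases h0 : Nat.find hex with _ | n
  · have h1 := Nat.find_spec hex
    rw [h0] at h1
    refine ⟨0, ?_⟩
    have h2 : k ≤ (u 0).norm := by simpa [FreeGroup.norm] using h1.length_le
    have h3 := FreeGroup.norm_mul_le (u 0)⁻¹ (x.prefixElement k)
    rw [FreeGroup.norm_inv_eq, Boundary.norm_prefixElement] at h3
    omega
  · have h1 := Nat.find_spec hex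
    rw [h0] at h1
    have h2 : ¬ x.pre k <+: (u n).toWord := Nat.find_min hex (by omega)
    refine ⟨n, ?_⟩
    have h3 := norm_le_of_not_prefix h1 h2
    rw [norm_mul_inv_comm (u (n + 1))] at h3
    rw [Boundary.prefixElement_eq_mk]
    have := hC n
    omega

/-- A geodesic ray of the Cayley tree starting at `1` that converges to `x` spells `x`. -/
theorem ConvergesTo.eq_prefixElement {u : ℕ → FreeGroup B} {x : Boundary B} (hx : ConvergesTo u x)
    (hu : ∀ n, (u n).norm = n) (hd : ∀ n, ((u n)⁻¹ * u (n + 1)).norm ≤ 1) (n : ℕ) :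
    u n = x.prefixElement n := by
  have hmono : ∀ m, n ≤ m → (u n).toWord <+: (u m).toWord := by
    intro m hm
    induction m, hm using Nat.le_induction with
    | base => exact List.prefix_rfl
    | succ m hm ih =>
      refine ih.trans ?_
      by_contra h'
      have h1 : ¬ (u m).toWord <+: (u (m + 1)).toWord := h'
      have h2 := norm_le_of_not_prefix List.prefix_rfl h1
      obtain ⟨l, hl⟩ : ∃ l, (u m)⁻¹ * u (m + 1) = FreeGroup.mk [l] := by
        have h3 : ((u m)⁻¹ * u (m + 1)).norm = 1 := by
          have h4 := norm_le_norm_add (u m) (u (m + 1))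
          rw [hu, hu] at h4
          have := hd m
          omega
        obtain ⟨l, hl⟩ := List.length_eq_one_iff.1 h3
        exact ⟨l, by rw [← hl, FreeGroup.mk_toWord]⟩
      have h3 : u (m + 1) = u m * FreeGroup.mk [l] := by rw [← hl]; simp
      rw [h3, toWord_mul_letter] at h1
      split_ifs at h1 with h4
      · have h5 := congrArg List.length (toWord_mul_letter (u m) l)
        rw [if_pos h4, ← h3, List.length_dropLast] at h5
        have h6 := hu (m + 1)
        have h7 := hu m
        simp only [FreeGroup.norm] at h6 h7
        omega
      · exact h1 (List.prefix_append _ _)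
  obtain ⟨m, h1, h2⟩ := ((convergesTo_iff.1 hx n).and (eventually_ge_atTop n)).exists
  apply FreeGroup.toWord_injective
  rw [Boundary.toWord_prefixElement, pre_prefix_iff.1 h1]
  have h3 := List.prefix_iff_eq_take.1 (hmono m h2)
  rwa [show (u n).toWord.length = n from hu n] at h3

end Words

/-! ### The action on the boundary -/

section Action

variable {B : Type*}

/-- The boundary point obtained by deleting the first `n` letters. -/
def Boundary.shift (x : Boundary B) (n : ℕ) : Boundary B :=
  ⟨fun i => x.1 (n + i), fun i => x.2 (n + i)⟩

theorem Boundary.pre_add (x : Boundary B) (n k : ℕ) :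
    x.pre (n + k) = x.pre n ++ (x.shift n).pre k := by
  induction k with
  | zero => simp
  | succ k ih => rw [← add_assoc, pre_succ, pre_succ, ih, List.append_assoc]; rfl

theorem getLast_invRev (L : List (B × Bool)) :
    (FreeGroup.invRev L).getLast? = L.head?.map invLetter := by
  rw [FreeGroup.invRev, List.getLast?_reverse, List.head?_map]
  rfl

variable [DecidableEq B]

theorem letterAct_pre_of_ne {l : B × Bool} {x : Boundary B} (h : x.1 0 ≠ invLetter l) (k : ℕ) :
    (letterAct l x).pre (k + 1) = l :: x.pre k := by
  have e : (letterAct l x).1 = fun i => Nat.casesOn i l (fun j => x.1 j) := by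
    unfold letterAct
    exact congrArg Subtype.val (dif_neg (c := x.1 0 = (l.1, !l.2)) h)
  rw [Boundary.pre_succ', e]
  rfl

theorem letterAct_pre_of_eq {l : B × Bool} {x : Boundary B} (h : x.1 0 = invLetter l) (k : ℕ) :
    x.pre (k + 1) = invLetter l :: (letterAct l x).pre k := by
  have e : (letterAct l x).1 = fun i => x.1 (i + 1) := by
    unfold letterAct
    exact congrArg Subtype.val (dif_pos (c := x.1 0 = (l.1, !l.2)) h)
  rw [Boundary.pre_succ', Boundary.pre, e, h]

theorem boundaryAct_one (x : Boundary B) : boundaryAct 1 x = x := by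
  simp [boundaryAct]

theorem boundaryAct_mul (g h : FreeGroup B) (x : Boundary B) :
    boundaryAct (g * h) x = boundaryAct g (boundaryAct h x) := by
  simp [boundaryAct]

@[simp] theorem boundaryAct_inv_self (g : FreeGroup B) (x : Boundary B) :
    boundaryAct g⁻¹ (boundaryAct g x) = x := by
  rw [← boundaryAct_mul, inv_mul_cancel, boundaryAct_one]

@[simp] theorem boundaryAct_self_inv (g : FreeGroup B) (x : Boundary B) :
    boundaryAct g (boundaryAct g⁻¹ x) = x := by
  rw [← boundaryAct_mul, mul_inv_cancel, boundaryAct_one]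

theorem boundaryAct_letter (l : B × Bool) (x : Boundary B) :
    boundaryAct (FreeGroup.mk [l]) x = letterAct l x := by
  obtain ⟨a, b⟩ := l
  cases b
  · have : (FreeGroup.mk [(a, false)] : FreeGroup B) = (FreeGroup.of a)⁻¹ := by
      rw [FreeGroup.of, FreeGroup.inv_mk]; rfl
    rw [this, boundaryAct, map_inv, FreeGroup.lift_apply_of]
    rfl
  · have : (FreeGroup.mk [(a, true)] : FreeGroup B) = FreeGroup.of a := rfl
    rw [this, boundaryAct, FreeGroup.lift_apply_of]
    rfl

theorem boundaryAct_mk_cons (l : B × Bool) (L : List (B × Bool)) (x : Boundary B) :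
    boundaryAct (FreeGroup.mk (l :: L)) x = letterAct l (boundaryAct (FreeGroup.mk L) x) := by
  rw [← boundaryAct_letter, ← boundaryAct_mul, FreeGroup.mul_mk]; rfl

/-- If no cancellation occurs, then a reduced word acts by concatenation. -/
theorem pre_boundaryAct_mk {L : List (B × Bool)} (hL : FreeGroup.IsReduced L) {y : Boundary B}
    (h : ∀ m ∈ L.getLast?, y.1 0 ≠ invLetter m) (k : ℕ) :
    (boundaryAct (FreeGroup.mk L) y).pre (L.length + k) = L ++ y.pre k := by
  induction L with
  | nil => simp [← FreeGroup.one_eq_mk, boundaryAct_one]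
  | cons l L ih =>
    rw [isReduced_iff] at hL
    have hL' : FreeGroup.IsReduced L := isReduced_iff.2 hL.tail
    rcases L with _ | ⟨m, L⟩
    · have := h l (by simp)
      rw [boundaryAct_mk_cons, ← FreeGroup.one_eq_mk, boundaryAct_one, List.length_singleton,
        add_comm, letterAct_pre_of_ne this]
      rfl
    · have ih := ih hL' (fun a ha => h a (by simpa using ha))
      rw [boundaryAct_mk_cons]
      set z := boundaryAct (FreeGroup.mk (m :: L)) y
      have h0 : z.1 0 = m := by
        rw [List.length_cons, add_right_comm, Boundary.pre_succ'] at ih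
        exact (List.cons.inj ih).1
      have h1 : z.1 0 ≠ invLetter l := by
        rw [h0]
        exact (List.isChain_cons_cons.1 hL).1
      rw [List.length_cons, add_right_comm, letterAct_pre_of_ne h1, ih]
      rfl

/-- A boundary point `x` begins with `f` if and only if there is no cancellation in
`f · (f⁻¹ x)`. -/
theorem pre_norm_eq_iff (f : FreeGroup B) (x : Boundary B) :
    x.pre f.norm = f.toWord ↔
      ∀ m ∈ f.toWord.getLast?, (boundaryAct f⁻¹ x).1 0 ≠ invLetter m := by
  have hf : FreeGroup.IsReduced f.toWord := FreeGroup.isReduced_toWord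
  constructor
  · intro h
    have h1 : ∀ m ∈ f.toWord.getLast?, (x.shift f.norm).1 0 ≠ invLetter m := by
      intro m hm
      rw [← h] at hm
      rcases hn : f.norm with _ | n
      · rw [hn] at hm; simp at hm
      · rw [hn, Boundary.pre_succ] at hm
        simp only [List.getLast?_concat, Option.mem_def, Option.some.injEq] at hm
        subst hm
        exact x.ne_invLetter n
    have h2 : boundaryAct f (x.shift f.norm) = x := by
      apply Boundary.ext_pre
      intro k
      have h3 := pre_boundaryAct_mk hf h1 k
      rw [FreeGroup.mk_toWord, ← h, Boundary.length_pre, ← Boundary.pre_add] at h3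
      have h4 := (Boundary.pre_prefix_pre (boundaryAct f (x.shift f.norm))
        (show k ≤ f.norm + k by omega))
      rw [h3, pre_prefix_iff] at h4
      have h5 := pre_prefix_iff.1 (x.pre_prefix_pre (show k ≤ f.norm + k by omega))
      rw [h4, h5]
    have h3 : boundaryAct f⁻¹ x = x.shift f.norm := by
      conv_lhs => rw [← h2]
      simp
    rwa [h3]
  · intro h
    have := pre_boundaryAct_mk hf h 0
    rw [FreeGroup.mk_toWord, boundaryAct_self_inv, Boundary.pre_zero, List.append_nil] at this
    exact this

theorem pre_norm_add {f : FreeGroup B} {x : Boundary B} (h : x.pre f.norm = f.toWord) (k : ℕ) :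
    x.pre (f.norm + k) = f.toWord ++ (boundaryAct f⁻¹ x).pre k := by
  have := pre_boundaryAct_mk FreeGroup.isReduced_toWord ((pre_norm_eq_iff f x).1 h) k
  rwa [FreeGroup.mk_toWord, boundaryAct_self_inv] at this

theorem shift_eq_boundaryAct {f : FreeGroup B} {x : Boundary B} (h : x.pre f.norm = f.toWord) :
    boundaryAct f⁻¹ x = x.shift f.norm := by
  apply Boundary.ext_pre
  intro k
  have h1 := pre_norm_add h k
  rw [Boundary.pre_add, h] at h1
  exact (List.append_cancel_left h1).symm

/-- Unless `k` cancels completely against `y`, the point `k y` begins with the first letter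
of `k`. -/
theorem boundaryAct_zero_of_not_pre {k : FreeGroup B} {y : Boundary B} {l : B × Bool}
    (hl : l ∈ k.toWord.head?) (h : y.pre k.norm ≠ (k⁻¹).toWord) : (boundaryAct k y).1 0 = l := by
  by_contra h'
  apply h
  rw [← FreeGroup.norm_inv_eq, pre_norm_eq_iff, inv_inv]
  intro m hm
  rw [FreeGroup.toWord_inv, getLast_invRev, Option.mem_def.1 hl] at hm
  simp only [Option.map_some, Option.mem_def, Option.some.injEq] at hm
  rw [← hm, invLetter_invLetter]
  exact h'

theorem toWord_letter_mul_of_head_ne {l : B × Bool} {g : FreeGroup B}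
    (h : ∀ m ∈ g.toWord.head?, m ≠ invLetter l) :
    (FreeGroup.mk [l] * g).toWord = l :: g.toWord := by
  have e : FreeGroup.mk [l] * g = FreeGroup.mk (l :: g.toWord) := by
    conv_lhs => rw [← FreeGroup.mk_toWord (x := g), FreeGroup.mul_mk]
    rfl
  rw [e]
  apply toWord_mk_of_isReduced
  have hr : FreeGroup.IsReduced g.toWord := FreeGroup.isReduced_toWord
  rw [isReduced_iff] at hr ⊢
  rw [List.isChain_cons]
  exact ⟨h, hr⟩

theorem toWord_letter_mul_of_cons {l : B × Bool} {g : FreeGroup B} {L : List (B × Bool)}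
    (h : g.toWord = invLetter l :: L) : (FreeGroup.mk [l] * g).toWord = L := by
  have hr : FreeGroup.IsReduced g.toWord := FreeGroup.isReduced_toWord
  have e : FreeGroup.mk [l] * g = FreeGroup.mk L := by
    have : g = FreeGroup.mk [invLetter l] * FreeGroup.mk L := by
      rw [FreeGroup.mul_mk, ← FreeGroup.mk_toWord (x := g), h]; rfl
    rw [this, ← mul_assoc, mk_singleton_mul_invLetter, one_mul]
  rw [e]
  apply toWord_mk_of_isReduced
  rw [h] at hr
  exact hr.infix ⟨[invLetter l], [], by simp⟩

theorem ConvergesTo.letter_mul {u : ℕ → FreeGroup B} {y : Boundary B} (hu : ConvergesTo u y)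
    (l : B × Bool) : ConvergesTo (fun n => FreeGroup.mk [l] * u n) (letterAct l y) := by
  rw [convergesTo_iff] at hu ⊢
  intro k
  by_cases h : y.1 0 = invLetter l
  · filter_upwards [hu (k + 1)] with n hn
    rw [letterAct_pre_of_eq h] at hn
    obtain ⟨t, ht⟩ := hn
    rw [toWord_letter_mul_of_cons ht.symm]
    exact List.prefix_append _ _
  · filter_upwards [hu (k + 1)] with n hn
    refine ((letterAct l y).pre_prefix_pre (show k ≤ k + 1 + 1 by omega)).trans ?_
    rw [letterAct_pre_of_ne h, toWord_letter_mul_of_head_ne]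
    · exact (List.cons_prefix_cons).2 ⟨rfl, hn⟩
    · intro m hm
      obtain ⟨t, ht⟩ := hn
      rw [← ht, Boundary.pre_succ'] at hm
      simp only [List.cons_append, List.head?_cons, Option.mem_def, Option.some.injEq] at hm
      rwa [← hm]

theorem ConvergesTo.mul_left {u : ℕ → FreeGroup B} {y : Boundary B} (hu : ConvergesTo u y)
    (g : FreeGroup B) : ConvergesTo (fun n => g * u n) (boundaryAct g y) := by
  rw [← FreeGroup.mk_toWord (x := g)]
  induction g.toWord with
  | nil => simpa [← FreeGroup.one_eq_mk, boundaryAct_one] using hu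
  | cons l L ih =>
    rw [boundaryAct_mk_cons]
    have e : ∀ n, FreeGroup.mk (l :: L) * u n = FreeGroup.mk [l] * (FreeGroup.mk L * u n) := by
      intro n
      rw [← mul_assoc, FreeGroup.mul_mk]; rfl
    simp only [e]
    exact ih.letter_mul l

end Action

/-! ### The boundary map of an injective homomorphism -/

section BoundaryMap

variable {A B : Type*} [DecidableEq A] [DecidableEq B]

theorem finite_norm_le [Finite B] (R : ℕ) : {g : FreeGroup B | g.norm ≤ R}.Finite := by
  refine ((List.finite_length_le (B × Bool) R).image FreeGroup.mk).subset ?_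
  intro g hg
  exact ⟨g.toWord, hg, FreeGroup.mk_toWord⟩

theorem exists_norm_map_le [Finite A] (ι : FreeGroup A →* FreeGroup B) :
    ∃ K : ℕ, ∀ g, (ι g).norm ≤ K * g.norm := by
  obtain ⟨K, hK⟩ := (Set.finite_range fun a : A => (ι (FreeGroup.of a)).norm).bddAbove
  have hK' : ∀ l : A × Bool, (ι (FreeGroup.mk [l])).norm ≤ K := by
    rintro ⟨a, b⟩
    have h1 : (ι (FreeGroup.of a)).norm ≤ K := hK ⟨a, rfl⟩
    cases b
    · have : (FreeGroup.mk [(a, false)] : FreeGroup A) = (FreeGroup.of a)⁻¹ := by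
        rw [FreeGroup.of, FreeGroup.inv_mk]; rfl
      rw [this, map_inv, FreeGroup.norm_inv_eq]
      exact h1
    · exact h1
  have h : ∀ L : List (A × Bool), (ι (FreeGroup.mk L)).norm ≤ K * L.length := by
    intro L
    induction L with
    | nil => simp [← FreeGroup.one_eq_mk]
    | cons l L ih =>
      have e : (FreeGroup.mk (l :: L) : FreeGroup A) = FreeGroup.mk [l] * FreeGroup.mk L := by
        rw [FreeGroup.mul_mk]; rfl
      rw [e, map_mul, List.length_cons, mul_add, mul_one, add_comm]
      exact (FreeGroup.norm_mul_le _ _).trans (add_le_add (hK' l) ih)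
  refine ⟨K, fun g => ?_⟩
  have := h g.toWord
  rwa [FreeGroup.mk_toWord] at this

/-- An injective homomorphism is proper, because balls of a free group of finite rank are finite. -/
theorem exists_norm_le_of_norm_map_le [Finite B] {ι : FreeGroup A →* FreeGroup B}
    (hι : Function.Injective ι) (R : ℕ) : ∃ D : ℕ, ∀ g, (ι g).norm ≤ R → g.norm ≤ D := by
  have h1 : {g : FreeGroup A | (ι g).norm ≤ R}.Finite :=
    (finite_norm_le (B := B) R).preimage hι.injOn
  obtain ⟨D, hD⟩ := (h1.image FreeGroup.norm).bddAbove
  exact ⟨D, fun g hg => hD ⟨g, hg, rfl⟩⟩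

theorem tendsto_of_tendsto_norm {u : ℕ → FreeGroup A} {n : ℕ → ℕ}
    (h : Tendsto (fun k => (u (n k)).norm) atTop atTop) : Tendsto n atTop atTop := by
  rw [tendsto_atTop]
  intro M
  obtain ⟨R, hR⟩ := ((Set.finite_lt_nat M).image fun i => (u i).norm).bddAbove
  filter_upwards [h.eventually (eventually_gt_atTop R)] with k hk
  by_contra h'
  have : (u (n k)).norm ≤ R := hR ⟨n k, by simpa using h', rfl⟩
  omega

theorem Boundary.norm_inv_mul_succ (x : Boundary A) (n : ℕ) :
    ((x.prefixElement n)⁻¹ * x.prefixElement (n + 1)).norm ≤ 1 := by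
  have : x.prefixElement (n + 1) = x.prefixElement n * FreeGroup.mk [x.1 n] := by
    rw [prefixElement_eq_mk, prefixElement_eq_mk, FreeGroup.mul_mk, pre_succ]
  rw [this, inv_mul_cancel_left]
  exact FreeGroup.norm_mk_le

theorem norm_map_le_of_le {ι : FreeGroup A →* FreeGroup B} {K : ℕ}
    (hK : ∀ g, (ι g).norm ≤ K * g.norm) {C : ℕ} {g h : FreeGroup A} (hgh : (g⁻¹ * h).norm ≤ C) :
    ((ι g)⁻¹ * ι h).norm ≤ K * C := by
  rw [← map_inv, ← map_mul]
  exact (hK _).trans (Nat.mul_le_mul_left _ hgh)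

theorem tendsto_norm_map [Finite B] {ι : FreeGroup A →* FreeGroup B}
    (hι : Function.Injective ι) {u : ℕ → FreeGroup A}
    (hu : Tendsto (fun n => (u n).norm) atTop atTop) :
    Tendsto (fun n => (ι (u n)).norm) atTop atTop := by
  rw [tendsto_atTop]
  intro R
  obtain ⟨D, hD⟩ := exists_norm_le_of_norm_map_le hι R
  filter_upwards [hu.eventually (eventually_gt_atTop D)] with n hn
  by_contra h'
  have := hD (u n) (by omega)
  omega

variable [Finite A] [Finite B]

/-- The images of the prefixes of a boundary point have bounded jumps and leave every ball. -/
theorem exists_boundaryMap {ι : FreeGroup A →* FreeGroup B} (hι : Function.Injective ι)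
    (x : Boundary A) :
    ∃ ξ : Boundary B, ConvergesTo (fun m => ι (x.prefixElement m)) ξ := by
  obtain ⟨K, hK⟩ := exists_norm_map_le ι
  refine exists_convergesTo (C := K * 1) (fun n => norm_map_le_of_le hK (x.norm_inv_mul_succ n)) ?_
  apply tendsto_norm_map hι
  simp only [Boundary.norm_prefixElement]
  exact tendsto_id

variable {ι : FreeGroup A →* FreeGroup B} (hι : Function.Injective ι)

/-- The map `∂F(A) → ∂F(B)` induced by an injective homomorphism `F(A) → F(B)`. -/
noncomputable def boundaryMap (x : Boundary A) : Boundary B :=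
  Classical.choose (exists_boundaryMap hι x)

theorem convergesTo_boundaryMap (x : Boundary A) :
    ConvergesTo (fun m => ι (x.prefixElement m)) (boundaryMap hι x) :=
  Classical.choose_spec (exists_boundaryMap hι x)

/-- The boundary map can be computed along any sequence with bounded jumps. -/
theorem boundaryMap_eq {u : ℕ → FreeGroup A} {x : Boundary A} (hu : ConvergesTo u x) {C : ℕ}
    (hC : ∀ n, ((u n)⁻¹ * u (n + 1)).norm ≤ C) {ξ : Boundary B}
    (hξ : ConvergesTo (fun n => ι (u n)) ξ) : boundaryMap hι x = ξ := by
  obtain ⟨K, hK⟩ := exists_norm_map_le ι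
  choose n hn using hu.exists_near hC
  have h1 : Tendsto n atTop atTop := by
    apply tendsto_of_tendsto_norm (u := u)
    rw [tendsto_atTop]
    intro M
    filter_upwards [eventually_ge_atTop (M + (C + 2 * (u 0).norm))] with k hk
    have h2 := norm_le_norm_add (u (n k)) (x.prefixElement k)
    have := hn k
    rw [Boundary.norm_prefixElement] at h2
    omega
  exact (convergesTo_boundaryMap hι x).eq
    ((hξ.comp h1).of_dist_le fun k => norm_map_le_of_le hK (hn k))

theorem boundaryMap_boundaryAct (g : FreeGroup A) (x : Boundary A) :
    boundaryMap hι (boundaryAct g x) = boundaryAct (ι g) (boundaryMap hι x) := by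
  refine boundaryMap_eq hι (C := 1) ((convergesTo_prefixElement x).mul_left g) ?_ ?_
  · intro n
    have := x.norm_inv_mul_succ n
    simpa [mul_assoc] using this
  · simp only [map_mul]
    exact (convergesTo_boundaryMap hι x).mul_left (ι g)

/-- The image of a ray stays within bounded distance of the ray of the image of its end. -/
theorem exists_near_boundaryMap : ∃ C : ℕ, ∀ (x : Boundary A) (k : ℕ), ∃ n,
    ((ι (x.prefixElement n))⁻¹ * (boundaryMap hι x).prefixElement k).norm ≤ C := by
  obtain ⟨K, hK⟩ := exists_norm_map_le ι
  refine ⟨K, fun x k => ?_⟩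
  obtain ⟨n, hn⟩ := (convergesTo_boundaryMap hι x).exists_near (C := K * 1)
    (fun n => norm_map_le_of_le hK (x.norm_inv_mul_succ n)) k
  refine ⟨n, hn.trans ?_⟩
  simp [Boundary.prefixElement_eq_mk, ← FreeGroup.one_eq_mk]

/-- If two rays had the same image, then the prefixes of each would be near prefixes of the other,
by properness, so that their ends agree. -/
theorem boundaryMap_injective : Function.Injective (boundaryMap hι) := by
  intro x y hxy
  obtain ⟨C, hC⟩ := exists_near_boundaryMap hι
  obtain ⟨D, hD⟩ := exists_norm_le_of_norm_map_le hι (C + C)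
  choose n hn using hC x
  choose m hm using hC y
  have key : ∀ (z : Boundary A) (n : ℕ → ℕ), (∀ k, ((ι (z.prefixElement (n k)))⁻¹ *
      (boundaryMap hι z).prefixElement k).norm ≤ C) → Tendsto n atTop atTop := by
    intro z n hn
    apply tendsto_of_tendsto_norm (u := fun k => ι (z.prefixElement k))
    rw [tendsto_atTop]
    intro M
    filter_upwards [eventually_ge_atTop (M + C)] with k hk
    have h2 := norm_le_norm_add (ι (z.prefixElement (n k))) ((boundaryMap hι z).prefixElement k)
    have := hn k
    rw [Boundary.norm_prefixElement] at h2
    omega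
  have h1 := (convergesTo_prefixElement x).comp (key x n hn)
  have h2 := (convergesTo_prefixElement y).comp (key y m hm)
  refine (h1.of_dist_le (C := D) (v := fun k => y.prefixElement (m k)) fun k => ?_).eq h2
  apply hD
  rw [map_mul, map_inv]
  refine (norm_triangle _ ((boundaryMap hι x).prefixElement k) _).trans (add_le_add (hn k) ?_)
  rw [hxy, norm_mul_inv_comm]
  exact hm k

/-- Uniform continuity of the boundary map. -/
theorem exists_pre_boundaryMap_prefix (k : ℕ) :
    ∃ M : ℕ, ∀ x : Boundary A, (boundaryMap hι x).pre k <+: (ι (x.prefixElement M)).toWord := by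
  obtain ⟨K, hK⟩ := exists_norm_map_le ι
  obtain ⟨D, hD⟩ := exists_norm_le_of_norm_map_le hι (k + K * 1)
  refine ⟨D + 1, fun x => ?_⟩
  have hN : ∀ n, D + 1 ≤ n → k + K * 1 < (ι (x.prefixElement n)).norm := by
    intro n hn
    by_contra h
    have := hD (x.prefixElement n) (by omega)
    rw [Boundary.norm_prefixElement] at this
    omega
  obtain ⟨n, h1, h2⟩ := ((convergesTo_iff.1 (convergesTo_boundaryMap hι x) k).and
    (eventually_ge_atTop (D + 1))).exists
  have h3 := take_eq_of_bounded_jumps (u := fun n => ι (x.prefixElement n))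
    (fun n => norm_map_le_of_le hK (x.norm_inv_mul_succ n)) hN h2
  have h4 := hN _ le_rfl
  have h5 := List.prefix_iff_eq_take.1 h3
  have h6 : ((ι (x.prefixElement (D + 1))).toWord.take k).length = k := by
    rw [List.length_take]
    simp only [FreeGroup.norm] at h4
    omega
  rw [h6] at h5
  rw [pre_prefix_iff.1 h1, ← h5]
  exact List.take_prefix _ _

end BoundaryMap

/-! ### Topology of the boundary and of the double boundary -/

section BoundaryTopology

variable {A : Type*}

theorem isOpen_setOf_letter_eq (i : ℕ) (l : A × Bool) : IsOpen {x : Boundary A | x.1 i = l} := by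
  let _ : TopologicalSpace (A × Bool) := ⊥
  have _ : DiscreteTopology (A × Bool) := ⟨rfl⟩
  have h1 : Continuous (fun x : Boundary A => x.1) := continuous_induced_dom
  have h2 : Continuous (fun x : Boundary A => x.1 i) := (continuous_apply i).comp h1
  exact (isOpen_discrete {l}).preimage h2

theorem isOpen_setOf_pre_eq (k : ℕ) (L : List (A × Bool)) :
    IsOpen {x : Boundary A | x.pre k = L} := by
  by_cases hL : L.length = k
  · subst hL
    have : {x : Boundary A | x.pre L.length = L} = ⋂ i : Fin L.length, {x | x.1 i = L[i]} := by
      ext x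
      simp only [Set.mem_ofPred_eq, Boundary.pre_eq_iff, Set.mem_iInter, Fin.forall_iff]
      rfl
    rw [this]
    exact isOpen_iInter_of_finite fun i => isOpen_setOf_letter_eq _ _
  · convert isOpen_empty
    rw [Set.eq_empty_iff_forall_notMem]
    rintro x rfl
    simp at hL

theorem isClopen_setOf_pre_eq (k : ℕ) (L : List (A × Bool)) :
    IsClopen {x : Boundary A | x.pre k = L} := by
  refine ⟨?_, isOpen_setOf_pre_eq k L⟩
  rw [← isOpen_compl_iff]
  have : {x : Boundary A | x.pre k = L}ᶜ =
      ⋃ L' : {L' : List (A × Bool) // L' ≠ L}, {x | x.pre k = L'.1} := by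
    ext x
    simp
  rw [this]
  exact isOpen_iUnion fun L' => isOpen_setOf_pre_eq _ _

theorem exists_pre_subset {U : Set (Boundary A)} (hU : IsOpen U) {x : Boundary A} (hx : x ∈ U) :
    ∃ k, ∀ m, k ≤ m → ∀ y : Boundary A, y.pre m = x.pre m → y ∈ U := by
  let _ : TopologicalSpace (A × Bool) := ⊥
  obtain ⟨V, hV, rfl⟩ := isOpen_induced_iff.1 hU
  obtain ⟨I, u, h1, h2⟩ := isOpen_pi_iff.1 hV _ hx
  refine ⟨I.sup id + 1, fun m hm y hy => h2 ?_⟩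
  intro i hi
  have h3 : i ≤ I.sup id := Finset.le_sup (f := id) hi
  have h4 : y.1 i = x.1 i := by
    have e1 : (y.pre m)[i]'(by simp; omega) = y.1 i := Boundary.getElem_pre _ _ _ _
    have e2 : (x.pre m)[i]'(by simp; omega) = x.1 i := Boundary.getElem_pre _ _ _ _
    rw [← e1, ← e2]
    simp only [hy]
  change y.1 i ∈ u i
  rw [h4]
  exact (h1 i hi).2

instance : T2Space (Boundary A) := by
  constructor
  intro x y hxy
  obtain ⟨k, hk⟩ : ∃ k, x.pre k ≠ y.pre k := by
    by_contra h
    push Not at h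
    exact hxy (Boundary.ext_pre h)
  refine ⟨_, _, isOpen_setOf_pre_eq k (x.pre k), isOpen_setOf_pre_eq k (y.pre k), rfl, rfl, ?_⟩
  rw [Set.disjoint_left]
  intro z h1 h2
  exact hk (h1.symm.trans h2)

instance [Finite A] : CompactSpace (Boundary A) := by
  let _ : TopologicalSpace (A × Bool) := ⊥
  have _ : DiscreteTopology (A × Bool) := ⟨rfl⟩
  have h1 : IsInducing (fun x : Boundary A => x.1) := ⟨rfl⟩
  have h2 : IsClosedEmbedding (fun x : Boundary A => x.1) := by
    refine ⟨⟨h1, Subtype.val_injective⟩, ?_⟩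
    have : Set.range (fun x : Boundary A => x.1) =
        ⋂ i : ℕ, {f | (f i).1 = (f (i + 1)).1 → (f i).2 = (f (i + 1)).2} := by
      ext f
      simp only [Set.mem_range, Set.mem_iInter, Set.mem_ofPred_eq]
      exact ⟨fun ⟨x, hx⟩ i => hx ▸ x.2 i, fun h => ⟨⟨f, h⟩, rfl⟩⟩
    rw [this]
    refine isClosed_iInter fun i => ?_
    have h3 : Continuous fun f : ℕ → A × Bool => (f i, f (i + 1)) :=
      (continuous_apply i).prodMk (continuous_apply (i + 1))
    exact (isClosed_discrete {p : (A × Bool) × (A × Bool) | p.1.1 = p.2.1 → p.1.2 = p.2.2}).preimage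
      h3
  exact h2.compactSpace

instance : T2Space (DoubleBoundary A) :=
  inferInstanceAs (T2Space {z : Boundary A × Boundary A // z.1 ≠ z.2})

theorem isOpenEmbedding_val :
    IsOpenEmbedding (X := DoubleBoundary A) (fun z => z.1) := by
  refine IsOpen.isOpenEmbedding_subtypeVal (s := {z : Boundary A × Boundary A | z.1 ≠ z.2}) ?_
  exact isOpen_ne_fun continuous_fst continuous_snd

instance [Finite A] : LocallyCompactSpace (DoubleBoundary A) :=
  isOpenEmbedding_val.locallyCompactSpace

theorem measurable_flipPair : Measurable (flipPair : DoubleBoundary A → DoubleBoundary A) := by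
  apply Continuous.measurable
  refine isOpenEmbedding_val.isEmbedding.continuous_iff.2 ?_
  exact (continuous_snd.comp isOpenEmbedding_val.continuous).prodMk
    (continuous_fst.comp isOpenEmbedding_val.continuous)

variable [DecidableEq A]

theorem continuous_boundaryAct (g : FreeGroup A) :
    Continuous (boundaryAct g : Boundary A → Boundary A) := by
  have key : ∀ l : A × Bool, Continuous (letterAct l) := by
    intro l
    rw [continuous_def]
    intro U hU
    rw [isOpen_iff_forall_mem_open]
    intro x hx
    obtain ⟨k, hk⟩ := exists_pre_subset hU (show letterAct l x ∈ U from hx)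
    refine ⟨_, ?_, isOpen_setOf_pre_eq (k + 1) (x.pre (k + 1)), rfl⟩
    intro y hy
    have hy : y.pre (k + 1) = x.pre (k + 1) := hy
    have h0 : y.1 0 = x.1 0 := by
      rw [Boundary.pre_succ', Boundary.pre_succ'] at hy
      exact (List.cons.inj hy).1
    by_cases h : x.1 0 = invLetter l
    · apply hk k le_rfl
      rw [letterAct_pre_of_eq h, letterAct_pre_of_eq (h0.trans h)] at hy
      exact (List.cons.inj hy).2
    · apply hk (k + 1) (by omega)
      rw [letterAct_pre_of_ne h, letterAct_pre_of_ne (by rwa [h0])]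
      rw [Boundary.pre_succ, Boundary.pre_succ] at hy
      rw [(List.append_inj' hy rfl).1]
  rw [← FreeGroup.mk_toWord (x := g)]
  induction g.toWord with
  | nil =>
    rw [← FreeGroup.one_eq_mk]
    convert continuous_id
    funext x
    exact boundaryAct_one x
  | cons l L ih =>
    have e : boundaryAct (FreeGroup.mk (l :: L)) =
        letterAct l ∘ boundaryAct (FreeGroup.mk L) := by
      funext x
      exact boundaryAct_mk_cons l L x
    rw [e]
    exact (key l).comp ih

theorem measurable_doubleAct (g : FreeGroup A) :
    Measurable (doubleAct g : DoubleBoundary A → DoubleBoundary A) := by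
  apply Continuous.measurable
  refine isOpenEmbedding_val.isEmbedding.continuous_iff.2 ?_
  exact ((continuous_boundaryAct g).comp
    (continuous_fst.comp isOpenEmbedding_val.continuous)).prodMk
    ((continuous_boundaryAct g).comp (continuous_snd.comp isOpenEmbedding_val.continuous))

end BoundaryTopology

/-! ### Rooted cylinders -/

section Rooted

variable {A B : Type*} [DecidableEq A] [DecidableEq B] [Finite A] [Finite B]
  {ι : FreeGroup A →* FreeGroup B} (hι : Function.Injective ι)

theorem isClopen_setOf_boundaryMap_pre_eq (k : ℕ) (L : List (B × Bool)) :
    IsClopen {x : Boundary A | (boundaryMap hι x).pre k = L} := by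
  obtain ⟨M, hM⟩ := exists_pre_boundaryMap_prefix hι k
  have h : ∀ L : List (B × Bool), IsOpen {x : Boundary A | (boundaryMap hι x).pre k = L} := by
    intro L
    rw [isOpen_iff_forall_mem_open]
    intro x hx
    refine ⟨_, ?_, isOpen_setOf_pre_eq M (x.pre M), rfl⟩
    intro y hy
    have hy : y.pre M = x.pre M := hy
    have e : y.prefixElement M = x.prefixElement M := by
      rw [Boundary.prefixElement_eq_mk, Boundary.prefixElement_eq_mk, hy]
    have h1 := pre_prefix_iff.1 (hM y)
    have h2 := pre_prefix_iff.1 (hM x)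
    rw [e, ← h2] at h1
    exact h1.trans hx
  refine ⟨?_, h L⟩
  rw [← isOpen_compl_iff]
  have : {x : Boundary A | (boundaryMap hι x).pre k = L}ᶜ =
      ⋃ L' : {L' : List (B × Bool) // L' ≠ L}, {x | (boundaryMap hι x).pre k = L'.1} := by
    ext x
    simp
  rw [this]
  exact isOpen_iUnion fun L' => h _

theorem continuous_boundaryMap : Continuous (boundaryMap hι) := by
  rw [continuous_def]
  intro U hU
  rw [isOpen_iff_forall_mem_open]
  intro x hx
  obtain ⟨k, hk⟩ := exists_pre_subset hU (show boundaryMap hι x ∈ U from hx)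
  exact ⟨_, fun y hy => hk k le_rfl _ hy, (isClopen_setOf_boundaryMap_pre_eq hι k _).2, rfl⟩

/-- The rooted cylinder of two words `a`, `b`: the pairs `(x, y)` whose images in `∂F(B)` begin
with `a` and with `b`. -/
def rootedCylinder (a b : List (B × Bool)) : Set (DoubleBoundary A) :=
  {z | (boundaryMap hι z.1.1).pre a.length = a ∧ (boundaryMap hι z.1.2).pre b.length = b}

theorem isClopen_rootedCylinder (a b : List (B × Bool)) : IsClopen (rootedCylinder hι a b) :=
  ((isClopen_setOf_boundaryMap_pre_eq hι _ a).preimage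
    (continuous_fst.comp isOpenEmbedding_val.continuous)).inter
  ((isClopen_setOf_boundaryMap_pre_eq hι _ b).preimage
    (continuous_snd.comp isOpenEmbedding_val.continuous))

/-- As the two words differ, the rooted cylinder is a product of two closed subsets of the boundary
that does not meet the diagonal. -/
theorem isCompact_rootedCylinder {a b : List (B × Bool)} (hl : a.length = b.length)
    (hab : a ≠ b) : IsCompact (rootedCylinder hι a b) := by
  rw [isOpenEmbedding_val.isEmbedding.isCompact_iff]
  have : (fun z : DoubleBoundary A => z.1) '' rootedCylinder hι a b =
      {x : Boundary A | (boundaryMap hι x).pre a.length = a} ×ˢ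
        {x : Boundary A | (boundaryMap hι x).pre b.length = b} := by
    ext ⟨x, y⟩
    constructor
    · rintro ⟨z, hz, h⟩
      rw [← h]
      exact hz
    · rintro ⟨h1, h2⟩
      refine ⟨⟨(x, y), ?_⟩, ⟨h1, h2⟩, rfl⟩
      rintro (rfl : x = y)
      simp only [Set.mem_ofPred_eq] at h1 h2
      rw [← hl, h1] at h2
      exact hab h2
  rw [this]
  exact ((isClopen_setOf_boundaryMap_pre_eq hι _ a).1.prod
    (isClopen_setOf_boundaryMap_pre_eq hι _ b).1).isCompact

/-- The rooted cylinders of two distinct words of equal length. -/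
def rootedCylinders : Set (Set (DoubleBoundary A)) :=
  {D | ∃ a b, a.length = b.length ∧ a ≠ b ∧ D = rootedCylinder hι a b}

theorem rootedCylinder_mem {a b : List (B × Bool)} (hl : a.length = b.length) (hab : a ≠ b) :
    rootedCylinder hι a b ∈ rootedCylinders hι := ⟨a, b, hl, hab, rfl⟩

theorem countable_rootedCylinders : (rootedCylinders hι).Countable := by
  refine (Set.countable_range fun p : List (B × Bool) × List (B × Bool) =>
    rootedCylinder hι p.1 p.2).mono ?_
  rintro D ⟨a, b, -, -, rfl⟩
  exact ⟨(a, b), rfl⟩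

theorem exists_pre_ne (z : DoubleBoundary A) :
    ∃ k, ∀ m, k ≤ m → (boundaryMap hι z.1.1).pre m ≠ (boundaryMap hι z.1.2).pre m := by
  have h1 : boundaryMap hι z.1.1 ≠ boundaryMap hι z.1.2 := fun h =>
    z.2 (boundaryMap_injective hι h)
  obtain ⟨k, hk⟩ : ∃ k, (boundaryMap hι z.1.1).pre k ≠ (boundaryMap hι z.1.2).pre k := by
    by_contra h
    push Not at h
    exact h1 (Boundary.ext_pre h)
  refine ⟨k, fun m hm h => hk ?_⟩
  have h2 := pre_prefix_iff.1 ((boundaryMap hι z.1.1).pre_prefix_pre hm)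
  have h3 := pre_prefix_iff.1 ((boundaryMap hι z.1.2).pre_prefix_pre hm)
  rw [h2, h3, h]

theorem isInducing_boundaryMap_prod : IsInducing fun z : DoubleBoundary A =>
    (boundaryMap hι z.1.1, boundaryMap hι z.1.2) := by
  have h1 : IsClosedEmbedding (boundaryMap hι) :=
    (continuous_boundaryMap hι).isClosedEmbedding (boundaryMap_injective hι)
  exact (h1.isInducing.prodMap h1.isInducing).comp isOpenEmbedding_val.isInducing

/-- The sets `{z' | z' and z agree to depth n}` form a neighbourhood basis at `z`. -/
theorem exists_depth_subset {U : Set (DoubleBoundary A)} (hU : IsOpen U) {z : DoubleBoundary A}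
    (hz : z ∈ U) : ∃ k, ∀ m, k ≤ m → ∀ z' : DoubleBoundary A,
      (boundaryMap hι z'.1.1).pre m = (boundaryMap hι z.1.1).pre m →
      (boundaryMap hι z'.1.2).pre m = (boundaryMap hι z.1.2).pre m → z' ∈ U := by
  obtain ⟨V, hV, rfl⟩ := (isInducing_boundaryMap_prod hι).isOpen_iff.1 hU
  obtain ⟨V1, V2, h1, h2, h3, h4, h5⟩ := isOpen_prod_iff.1 hV _ _ hz
  obtain ⟨k1, hk1⟩ := exists_pre_subset h1 h3
  obtain ⟨k2, hk2⟩ := exists_pre_subset h2 h4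
  refine ⟨max k1 k2, fun m hm z' e1 e2 => h5 ⟨?_, ?_⟩⟩
  · exact hk1 m (le_trans (le_max_left _ _) hm) _ e1
  · exact hk2 m (le_trans (le_max_right _ _) hm) _ e2

theorem mem_rootedCylinder_pre (z : DoubleBoundary A) (m : ℕ) :
    z ∈ rootedCylinder hι ((boundaryMap hι z.1.1).pre m) ((boundaryMap hι z.1.2).pre m) := by
  simp [rootedCylinder]

theorem isTopologicalBasis_rootedCylinders :
    TopologicalSpace.IsTopologicalBasis (rootedCylinders hι) := by
  apply TopologicalSpace.isTopologicalBasis_of_isOpen_of_nhds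
  · rintro D ⟨a, b, -, -, rfl⟩
    exact (isClopen_rootedCylinder hι a b).2
  · intro z U hz hU
    obtain ⟨k, hk⟩ := exists_depth_subset hι hU hz
    obtain ⟨k', hk'⟩ := exists_pre_ne hι z
    set m := max k k'
    refine ⟨_, rootedCylinder_mem hι (a := (boundaryMap hι z.1.1).pre m)
      (b := (boundaryMap hι z.1.2).pre m) (by simp) (hk' m (le_max_right _ _)),
      mem_rootedCylinder_pre hι z m, ?_⟩
    rintro z' ⟨h1, h2⟩
    rw [Boundary.length_pre] at h1 h2
    exact hk m (le_max_left _ _) z' h1 h2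

theorem borel_eq_generateFrom_rootedCylinders :
    (inferInstance : MeasurableSpace (DoubleBoundary A)) =
      MeasurableSpace.generateFrom (rootedCylinders hι) := by
  have _ : SecondCountableTopology (DoubleBoundary A) :=
    (isTopologicalBasis_rootedCylinders hι).secondCountableTopology (countable_rootedCylinders hι)
  exact (isTopologicalBasis_rootedCylinders hι).borel_eq_generateFrom

theorem rootedCylinder_subset {a b a' b' : List (B × Bool)} (ha : a <+: a') (hb : b <+: b') :
    rootedCylinder hι a' b' ⊆ rootedCylinder hι a b := by
  rintro z ⟨h1, h2⟩
  constructor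
  · have := pre_prefix_iff.1 ((boundaryMap hι z.1.1).pre_prefix_pre ha.length_le)
    rw [this, h1]
    exact (List.prefix_iff_eq_take.1 ha).symm
  · have := pre_prefix_iff.1 ((boundaryMap hι z.1.2).pre_prefix_pre hb.length_le)
    rw [this, h2]
    exact (List.prefix_iff_eq_take.1 hb).symm

/-- If two rooted cylinders meet, then the one with the longer words is contained in the other. -/
theorem isPiSystem_rootedCylinders : IsPiSystem (rootedCylinders hι) := by
  have key : ∀ a b a' b' : List (B × Bool), a.length = b.length → a' ≠ b' →
      a'.length = b'.length → a.length ≤ a'.length →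
      (rootedCylinder hι a b ∩ rootedCylinder hι a' b').Nonempty →
      rootedCylinder hι a b ∩ rootedCylinder hι a' b' ∈ rootedCylinders hι := by
    rintro a b a' b' h1 h2 h3 h4 ⟨z, ⟨e1, e2⟩, ⟨e3, e4⟩⟩
    rw [Set.inter_eq_right.2]
    · exact rootedCylinder_mem hι h3 h2
    · apply rootedCylinder_subset
      · rw [← e1, ← e3]; exact Boundary.pre_prefix_pre _ h4
      · rw [← e2, ← e4]; exact Boundary.pre_prefix_pre _ (by omega)
  rintro D ⟨a, b, h1, h2, rfl⟩ D' ⟨a', b', h3, h4, rfl⟩ hne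
  rcases le_total a.length a'.length with h | h
  · exact key a b a' b' h1 h4 h3 h hne
  · rw [Set.inter_comm] at hne ⊢
    exact key a' b' a b h3 h2 h1 h hne

theorem measure_ext_rootedCylinders {m m' : Measure (DoubleBoundary A)}
    (hfin : ∀ D ∈ rootedCylinders hι, m D ≠ ∞) (h : ∀ D ∈ rootedCylinders hι, m D = m' D) :
    m = m' := by
  exact Measure.ext_of_generateFrom_of_cover_subset (borel_eq_generateFrom_rootedCylinders hι)
    (isPiSystem_rootedCylinders hι) subset_rfl (countable_rootedCylinders hι)
    (isTopologicalBasis_rootedCylinders hι).sUnion_eq hfin h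

end Rooted

/-! ### Weak-* convergence from convergence on rooted cylinders -/

section WeakConvergence

/-- The pairs of distinct words of length `n`. -/
noncomputable def wordPairs (B : Type*) [Finite B] (n : ℕ) :
    Finset (List (B × Bool) × List (B × Bool)) :=
  Set.Finite.toFinset (s := {p | p.1.length = n ∧ p.2.length = n ∧ p.1 ≠ p.2})
    (((List.finite_length_eq (B × Bool) n).prod (List.finite_length_eq (B × Bool) n)).subset
      fun _ hp => ⟨hp.1, hp.2.1⟩)

theorem mem_wordPairs {B : Type*} [Finite B] {n : ℕ} {p : List (B × Bool) × List (B × Bool)} :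
    p ∈ wordPairs B n ↔ p.1.length = n ∧ p.2.length = n ∧ p.1 ≠ p.2 := by
  simp [wordPairs]

variable {A B : Type*} [DecidableEq A] [DecidableEq B] [Finite A] [Finite B]
  {ι : FreeGroup A →* FreeGroup B} (hι : Function.Injective ι)

/-- The pairs whose images in `∂F(B)` are distinguished by their first `n` letters. These sets
form an exhaustion of the double boundary by compact open sets. -/
def separatedPairs (n : ℕ) : Set (DoubleBoundary A) :=
  {z | (boundaryMap hι z.1.1).pre n ≠ (boundaryMap hι z.1.2).pre n}

theorem rootedCylinder_mem_of_mem_wordPairs {n : ℕ} {p : List (B × Bool) × List (B × Bool)}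
    (hp : p ∈ wordPairs B n) : rootedCylinder hι p.1 p.2 ∈ rootedCylinders hι := by
  obtain ⟨h1, h2, h3⟩ := mem_wordPairs.1 hp
  exact rootedCylinder_mem hι (h1.trans h2.symm) h3

theorem mem_rootedCylinder_iff_of_mem_wordPairs {n : ℕ} {p : List (B × Bool) × List (B × Bool)}
    (hp : p ∈ wordPairs B n) (z : DoubleBoundary A) : z ∈ rootedCylinder hι p.1 p.2 ↔
      ((boundaryMap hι z.1.1).pre n, (boundaryMap hι z.1.2).pre n) = p := by
  obtain ⟨h1, h2, h3⟩ := mem_wordPairs.1 hp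
  rw [Prod.ext_iff]
  simp only [rootedCylinder, Set.mem_ofPred_eq, h1, h2]

theorem separatedPairs_eq (n : ℕ) :
    separatedPairs hι n = ⋃ p ∈ wordPairs B n, rootedCylinder hι p.1 p.2 := by
  ext z
  simp only [Set.mem_iUnion, exists_prop]
  constructor
  · intro hz
    have hp : ((boundaryMap hι z.1.1).pre n, (boundaryMap hι z.1.2).pre n) ∈ wordPairs B n :=
      mem_wordPairs.2 ⟨by simp, by simp, hz⟩
    exact ⟨_, hp, (mem_rootedCylinder_iff_of_mem_wordPairs hι hp z).2 rfl⟩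
  · rintro ⟨p, hp, hz⟩
    have h1 := (mem_rootedCylinder_iff_of_mem_wordPairs hι hp z).1 hz
    have h2 := (mem_wordPairs.1 hp).2.2
    rw [← h1] at h2
    exact h2

theorem isOpen_separatedPairs (n : ℕ) : IsOpen (separatedPairs hι n) := by
  rw [separatedPairs_eq]
  exact isOpen_biUnion fun p _ => (isClopen_rootedCylinder hι p.1 p.2).2

theorem separatedPairs_mono : Monotone (separatedPairs hι) := by
  intro n m h z hz h'
  apply hz
  have h2 := pre_prefix_iff.1 ((boundaryMap hι z.1.1).pre_prefix_pre h)
  have h3 := pre_prefix_iff.1 ((boundaryMap hι z.1.2).pre_prefix_pre h)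
  rw [h2, h3, h']

/-- Distinct boundary points have distinct images, so they are separated at some depth; by
compactness one depth suffices for all of `K`. -/
theorem exists_subset_separatedPairs {K : Set (DoubleBoundary A)} (hK : IsCompact K) :
    ∃ n, K ⊆ separatedPairs hι n := by
  refine hK.elim_directed_cover _ (isOpen_separatedPairs hι) ?_
    (separatedPairs_mono hι).directed_le
  intro z _
  obtain ⟨k, hk⟩ := exists_pre_ne hι z
  exact Set.mem_iUnion.2 ⟨k, hk k le_rfl⟩

theorem isFiniteMeasureOnCompacts_of_rootedCylinders {m : Measure (DoubleBoundary A)}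
    (hm : ∀ D ∈ rootedCylinders hι, m D ≠ ∞) : IsFiniteMeasureOnCompacts m := by
  constructor
  intro K hK
  obtain ⟨n, hn⟩ := exists_subset_separatedPairs hι hK
  refine (measure_mono hn).trans_lt ?_
  rw [separatedPairs_eq]
  refine (measure_biUnion_finset_le _ _).trans_lt ?_
  rw [ENNReal.sum_lt_top]
  intro p hp
  exact (hm _ (rootedCylinder_mem_of_mem_wordPairs hι hp)).lt_top

theorem measure_separatedPairs (m : Measure (DoubleBoundary A)) (n : ℕ) :
    m (separatedPairs hι n) = ∑ p ∈ wordPairs B n, m (rootedCylinder hι p.1 p.2) := by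
  rw [separatedPairs_eq]
  apply measure_biUnion_finset
  · intro p hp q hq hpq
    rw [Function.onFun, Set.disjoint_left]
    intro z h1 h2
    rw [mem_rootedCylinder_iff_of_mem_wordPairs hι hp] at h1
    rw [mem_rootedCylinder_iff_of_mem_wordPairs hι hq] at h2
    exact hpq (h1.symm.trans h2)
  · intro p _
    exact (isClopen_rootedCylinder hι p.1 p.2).2.measurableSet

theorem real_separatedPairs {m : Measure (DoubleBoundary A)}
    (hm : ∀ D ∈ rootedCylinders hι, m D ≠ ∞) (n : ℕ) :
    m.real (separatedPairs hι n) = ∑ p ∈ wordPairs B n, m.real (rootedCylinder hι p.1 p.2) := by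
  rw [Measure.real, measure_separatedPairs, ENNReal.toReal_sum]
  · rfl
  · intro p hp
    exact hm _ (rootedCylinder_mem_of_mem_wordPairs hι hp)

/-- A continuous function with support in `separatedPairs n₀` is uniformly approximated by
functions of the first `n` letters, with the same restriction on the support. -/
theorem exists_step_approx (f : CompactlySupportedContinuousMap (DoubleBoundary A) ℝ) :
    ∃ n₀, (∀ z ∉ separatedPairs hι n₀, f z = 0) ∧ ∀ ε > 0, ∃ n, n₀ ≤ n ∧
      ∃ c : List (B × Bool) × List (B × Bool) → ℝ, ∀ z,
        |f z - c ((boundaryMap hι z.1.1).pre n, (boundaryMap hι z.1.2).pre n)| ≤ ε ∧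
        (z ∉ separatedPairs hι n₀ →
          c ((boundaryMap hι z.1.1).pre n, (boundaryMap hι z.1.2).pre n) = 0) := by
  classical
  have hK : IsCompact (tsupport f) := f.hasCompactSupport
  obtain ⟨n₀, hn₀⟩ := exists_subset_separatedPairs hι hK
  have h0 : ∀ z ∉ separatedPairs hι n₀, f z = 0 := fun z hz =>
    image_eq_zero_of_notMem_tsupport fun h => hz (hn₀ h)
  refine ⟨n₀, h0, fun ε hε => ?_⟩
  have hcont : Continuous f := f.continuous
  have hloc : ∀ z, ∃ k, ∀ m, k ≤ m → ∀ z' : DoubleBoundary A,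
      (boundaryMap hι z'.1.1).pre m = (boundaryMap hι z.1.1).pre m →
      (boundaryMap hι z'.1.2).pre m = (boundaryMap hι z.1.2).pre m → |f z' - f z| < ε / 2 := by
    intro z
    have hU : IsOpen {z' | |f z' - f z| < ε / 2} :=
      isOpen_lt (continuous_abs.comp (hcont.sub continuous_const)) continuous_const
    exact exists_depth_subset hι hU (by simpa using half_pos hε)
  choose k hk using hloc
  obtain ⟨t, ht⟩ := hK.elim_nhds_subcover (fun z => rootedCylinder hι
    ((boundaryMap hι z.1.1).pre (k z)) ((boundaryMap hι z.1.2).pre (k z)))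
    (fun z _ => (isClopen_rootedCylinder hι _ _).2.mem_nhds (mem_rootedCylinder_pre hι z _))
  set n := max n₀ (t.sup k) with hn
  have hsame : ∀ {m} {z z' : DoubleBoundary A}, m ≤ n →
      (boundaryMap hι z'.1.1).pre n = (boundaryMap hι z.1.1).pre n →
      (boundaryMap hι z'.1.2).pre n = (boundaryMap hι z.1.2).pre n →
      (boundaryMap hι z'.1.1).pre m = (boundaryMap hι z.1.1).pre m ∧
      (boundaryMap hι z'.1.2).pre m = (boundaryMap hι z.1.2).pre m := by
    intro m z z' hm h1 h2
    constructor
    · rw [pre_prefix_iff.1 (Boundary.pre_prefix_pre _ hm), h1,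
        ← pre_prefix_iff.1 (Boundary.pre_prefix_pre _ hm)]
    · rw [pre_prefix_iff.1 (Boundary.pre_prefix_pre _ hm), h2,
        ← pre_prefix_iff.1 (Boundary.pre_prefix_pre _ hm)]
  have hunif1 : ∀ z z' : DoubleBoundary A, z ∈ tsupport f →
      (boundaryMap hι z'.1.1).pre n = (boundaryMap hι z.1.1).pre n →
      (boundaryMap hι z'.1.2).pre n = (boundaryMap hι z.1.2).pre n → |f z - f z'| ≤ ε := by
    intro z z' hz h1 h2
    obtain ⟨w, hw, hzw⟩ := Set.mem_iUnion₂.1 (ht.2 hz)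
    obtain ⟨e1, e2⟩ := hzw
    rw [Boundary.length_pre] at e1 e2
    have hle : k w ≤ n := (Finset.le_sup hw).trans (le_max_right _ _)
    obtain ⟨e3, e4⟩ := hsame hle h1 h2
    have a1 := hk w (k w) le_rfl z e1 e2
    have a2 := hk w (k w) le_rfl z' (e3.trans e1) (e4.trans e2)
    rw [abs_lt] at a1 a2
    rw [abs_le]
    constructor <;> linarith
  have hunif : ∀ z z' : DoubleBoundary A,
      (boundaryMap hι z'.1.1).pre n = (boundaryMap hι z.1.1).pre n →
      (boundaryMap hι z'.1.2).pre n = (boundaryMap hι z.1.2).pre n → |f z - f z'| ≤ ε := by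
    intro z z' h1 h2
    by_cases hz : z ∈ tsupport f
    · exact hunif1 z z' hz h1 h2
    · by_cases hz' : z' ∈ tsupport f
      · rw [abs_sub_comm]
        exact hunif1 z' z hz' h1.symm h2.symm
      · rw [image_eq_zero_of_notMem_tsupport hz, image_eq_zero_of_notMem_tsupport hz']
        simpa using hε.le
  refine ⟨n, le_max_left _ _, fun p => if h : ∃ z : DoubleBoundary A,
    ((boundaryMap hι z.1.1).pre n, (boundaryMap hι z.1.2).pre n) = p then f h.choose else 0, ?_⟩
  intro z
  have hex : ∃ z' : DoubleBoundary A,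
    ((boundaryMap hι z'.1.1).pre n, (boundaryMap hι z'.1.2).pre n) =
      ((boundaryMap hι z.1.1).pre n, (boundaryMap hι z.1.2).pre n) := ⟨z, rfl⟩
  simp only [dif_pos hex]
  obtain ⟨e1, e2⟩ := Prod.ext_iff.1 hex.choose_spec
  refine ⟨hunif z _ e1 e2, fun hz => h0 _ fun h => hz ?_⟩
  obtain ⟨e3, e4⟩ := hsame (le_max_left _ _) e1 e2
  intro h'
  apply h
  rw [e3, e4, h']

/-- The error in replacing a function by a step function on rooted cylinders of depth `n`: it is at
most the uniform distance times the measure of a set that does not depend on `n`. -/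
theorem abs_integral_sub_sum_le {m : Measure (DoubleBoundary A)}
    (hm : ∀ D ∈ rootedCylinders hι, m D ≠ ∞)
    {f : CompactlySupportedContinuousMap (DoubleBoundary A) ℝ} {n₀ n : ℕ} (hn : n₀ ≤ n)
    (hf : ∀ z ∉ separatedPairs hι n₀, f z = 0) {ε : ℝ}
    {c : List (B × Bool) × List (B × Bool) → ℝ}
    (hc : ∀ z, |f z - c ((boundaryMap hι z.1.1).pre n, (boundaryMap hι z.1.2).pre n)| ≤ ε ∧
        (z ∉ separatedPairs hι n₀ →
          c ((boundaryMap hι z.1.1).pre n, (boundaryMap hι z.1.2).pre n) = 0)) :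
    |∫ z, f z ∂m - ∑ p ∈ wordPairs B n, c p * m.real (rootedCylinder hι p.1 p.2)| ≤
      ε * m.real (separatedPairs hι n₀) := by
  have _ := isFiniteMeasureOnCompacts_of_rootedCylinders hι hm
  have hfi : Integrable f m := f.continuous.integrable_of_hasCompactSupport f.hasCompactSupport
  have hmeas : ∀ p : List (B × Bool) × List (B × Bool),
      MeasurableSet (rootedCylinder hι p.1 p.2) := fun p =>
    (isClopen_rootedCylinder hι p.1 p.2).2.measurableSet
  have hind : ∀ p ∈ wordPairs B n,
      Integrable ((rootedCylinder hι p.1 p.2).indicator fun _ => c p) m := by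
    intro p hp
    rw [integrable_indicator_iff (hmeas p)]
    exact integrableOn_const (hm _ (rootedCylinder_mem_of_mem_wordPairs hι hp))
  have hsum : ∑ p ∈ wordPairs B n, c p * m.real (rootedCylinder hι p.1 p.2) =
      ∫ z, ∑ p ∈ wordPairs B n, (rootedCylinder hι p.1 p.2).indicator (fun _ => c p) z ∂m := by
    rw [integral_finsetSum _ hind]
    refine Finset.sum_congr rfl fun p _ => ?_
    rw [integral_indicator_const _ (hmeas p), smul_eq_mul, mul_comm]
  have hKm : m (separatedPairs hι n₀) ≠ ∞ := by
    rw [measure_separatedPairs]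
    exact (ENNReal.sum_lt_top.2 fun p hp =>
      (hm _ (rootedCylinder_mem_of_mem_wordPairs hι hp)).lt_top).ne
  have hKmeas := (isOpen_separatedPairs hι n₀).measurableSet
  rw [hsum, ← integral_sub hfi (integrable_finsetSum _ hind), ← Real.norm_eq_abs]
  have hb : ∫ z, (separatedPairs hι n₀).indicator (fun _ => ε) z ∂m =
      ε * m.real (separatedPairs hι n₀) := by
    rw [integral_indicator_const _ hKmeas, smul_eq_mul, mul_comm]
  rw [← hb]
  refine norm_integral_le_of_norm_le ?_ (ae_of_all _ fun z => ?_)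
  · rw [integrable_indicator_iff hKmeas]
    exact integrableOn_const hKm
  have hval : z ∈ separatedPairs hι n →
      ∑ p ∈ wordPairs B n, (rootedCylinder hι p.1 p.2).indicator (fun _ => c p) z =
      c ((boundaryMap hι z.1.1).pre n, (boundaryMap hι z.1.2).pre n) := by
    intro hz
    have hp : ((boundaryMap hι z.1.1).pre n, (boundaryMap hι z.1.2).pre n) ∈ wordPairs B n :=
      mem_wordPairs.2 ⟨by simp, by simp, hz⟩
    rw [Finset.sum_eq_single_of_mem _ hp]
    · rw [Set.indicator_of_mem]
      exact (mem_rootedCylinder_iff_of_mem_wordPairs hι hp z).2 rfl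
    · intro q hq hne
      rw [Set.indicator_of_notMem]
      rw [mem_rootedCylinder_iff_of_mem_wordPairs hι hq z]
      exact fun h => hne h.symm
  have hval' : z ∉ separatedPairs hι n →
      ∑ p ∈ wordPairs B n, (rootedCylinder hι p.1 p.2).indicator (fun _ => c p) z = 0 := by
    intro hz
    refine Finset.sum_eq_zero fun p hp => Set.indicator_of_notMem ?_ _
    intro h
    apply hz
    rw [separatedPairs_eq]
    exact Set.mem_biUnion hp h
  rw [Real.norm_eq_abs]
  by_cases hz : z ∈ separatedPairs hι n₀
  · rw [hval (separatedPairs_mono hι hn hz), Set.indicator_of_mem hz]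
    exact (hc z).1
  · rw [Set.indicator_of_notMem hz, hf z hz]
    by_cases hz' : z ∈ separatedPairs hι n
    · rw [hval hz', (hc z).2 hz]; simp
    · rw [hval' hz']; simp

/-- Convergence on every rooted cylinder implies weak-* convergence. -/
theorem tendsto_integral_of_rootedCylinders {I : Type*} {l : Filter I}
    {m : I → Measure (DoubleBoundary A)} {m₀ : Measure (DoubleBoundary A)}
    (hm : ∀ i, ∀ D ∈ rootedCylinders hι, m i D ≠ ∞) (hm₀ : ∀ D ∈ rootedCylinders hι, m₀ D ≠ ∞)
    (h : ∀ D ∈ rootedCylinders hι, Tendsto (fun i => (m i).real D) l (𝓝 (m₀.real D)))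
    (f : CompactlySupportedContinuousMap (DoubleBoundary A) ℝ) :
    Tendsto (fun i => ∫ z, f z ∂(m i)) l (𝓝 (∫ z, f z ∂m₀)) := by
  obtain ⟨n₀, hf, happrox⟩ := exists_step_approx hι f
  have hK : Tendsto (fun i => (m i).real (separatedPairs hι n₀)) l
      (𝓝 (m₀.real (separatedPairs hι n₀))) := by
    simp only [real_separatedPairs hι (hm _), real_separatedPairs hι hm₀]
    exact tendsto_finsetSum _ fun p hp => h _ (rootedCylinder_mem_of_mem_wordPairs hι hp)
  rw [Metric.tendsto_nhds]
  intro ε hε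
  set M := m₀.real (separatedPairs hι n₀) + 1 with hM
  have hM0 : 0 < M := by positivity
  obtain ⟨n, hn, c, hc⟩ := happrox (ε / (4 * M)) (by positivity)
  have hS : Tendsto (fun i => ∑ p ∈ wordPairs B n, c p * (m i).real (rootedCylinder hι p.1 p.2)) l
      (𝓝 (∑ p ∈ wordPairs B n, c p * m₀.real (rootedCylinder hι p.1 p.2))) :=
    tendsto_finsetSum _ fun p hp =>
      (h _ (rootedCylinder_mem_of_mem_wordPairs hι hp)).const_mul _
  filter_upwards [Metric.tendsto_nhds.1 hS (ε / 4) (by positivity),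
    hK.eventually (gt_mem_nhds (show m₀.real (separatedPairs hι n₀) < M by linarith))] with i h1 h2
  have h3 := abs_integral_sub_sum_le hι (hm i) hn hf hc
  have h4 := abs_integral_sub_sum_le hι hm₀ hn hf hc
  have e : ε / (4 * M) * M = ε / 4 := by field_simp
  have h5 : ε / (4 * M) * (m i).real (separatedPairs hι n₀) ≤ ε / 4 := by
    rw [← e]; gcongr
  have h6 : ε / (4 * M) * m₀.real (separatedPairs hι n₀) ≤ ε / 4 := by
    rw [← e]; gcongr; linarith
  rw [Real.dist_eq, abs_lt] at h1 ⊢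
  rw [abs_le] at h3 h4
  constructor <;> linarith

/-- The indicator function of a rooted cylinder. -/
noncomputable def cylinderIndicator {a b : List (B × Bool)} (hl : a.length = b.length)
    (hab : a ≠ b) : CompactlySupportedContinuousMap (DoubleBoundary A) ℝ where
  toFun := (rootedCylinder hι a b).indicator fun _ => 1
  continuous_toFun := continuous_const.indicator fun z hz => by
    rw [(isClopen_rootedCylinder hι a b).frontier_eq] at hz
    exact absurd hz (Set.notMem_empty z)
  hasCompactSupport' := HasCompactSupport.intro (isCompact_rootedCylinder hι hl hab)
    fun z hz => Set.indicator_of_notMem hz _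

theorem integral_cylinderIndicator {a b : List (B × Bool)} (hl : a.length = b.length)
    (hab : a ≠ b) (m : Measure (DoubleBoundary A)) :
    ∫ z, cylinderIndicator hι hl hab z ∂m = m.real (rootedCylinder hι a b) := by
  change ∫ z, (rootedCylinder hι a b).indicator (fun _ => (1 : ℝ)) z ∂m = _
  rw [integral_indicator_const _ (isClopen_rootedCylinder hι a b).2.measurableSet, smul_eq_mul,
    mul_one]

/-- If a sequence of measures converges on every rooted cylinder, then the limits are the values
of a measure: the limit of the integrals along an ultrafilter is a positive functional, and the
Riesz–Markov–Kakutani theorem applies. -/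
theorem exists_measure_of_tendsto {m : ℕ → Measure (DoubleBoundary A)}
    (hm : ∀ i, ∀ D ∈ rootedCylinders hι, m i D ≠ ∞) {w : Set (DoubleBoundary A) → ℝ}
    (h : ∀ D ∈ rootedCylinders hι, Tendsto (fun i => (m i).real D) atTop (𝓝 (w D))) :
    ∃ ν : Measure (DoubleBoundary A), ∀ D ∈ rootedCylinders hι, ν D ≠ ∞ ∧ ν.real D = w D := by
  have hfc := fun i => isFiniteMeasureOnCompacts_of_rootedCylinders hι (hm i)
  have hint : ∀ i (f : CompactlySupportedContinuousMap (DoubleBoundary A) ℝ),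
      Integrable f (m i) := fun i f =>
    f.continuous.integrable_of_hasCompactSupport f.hasCompactSupport
  let U : Ultrafilter ℕ := Ultrafilter.of atTop
  have hU : (U : Filter ℕ) ≤ atTop := Ultrafilter.of_le atTop
  have hlim : ∀ f : CompactlySupportedContinuousMap (DoubleBoundary A) ℝ,
      ∃ L : ℝ, Tendsto (fun i => ∫ z, f z ∂(m i)) U (𝓝 L) := by
    intro f
    obtain ⟨n₀, hf, -⟩ := exists_step_approx hι f
    obtain ⟨C, hC⟩ := f.continuous.bounded_above_of_compact_support f.hasCompactSupport
    have hK : Tendsto (fun i => (m i).real (separatedPairs hι n₀)) atTop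
        (𝓝 (∑ p ∈ wordPairs B n₀, w (rootedCylinder hι p.1 p.2))) := by
      simp only [real_separatedPairs hι (hm _)]
      exact tendsto_finsetSum _ fun p hp => h _ (rootedCylinder_mem_of_mem_wordPairs hι hp)
    set M := ∑ p ∈ wordPairs B n₀, w (rootedCylinder hι p.1 p.2) + 1 with hM
    have hC0 : 0 ≤ |C| := abs_nonneg C
    have hev : ∀ᶠ i in (U : Filter ℕ), ∫ z, f z ∂(m i) ∈ Set.Icc (-(|C| * M)) (|C| * M) := by
      apply hU
      filter_upwards [hK.eventually (gt_mem_nhds (show _ < M by rw [hM]; linarith))] with i hi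
      have hKm : m i (separatedPairs hι n₀) ≠ ∞ := by
        rw [measure_separatedPairs]
        exact (ENNReal.sum_lt_top.2 fun p hp =>
          (hm i _ (rootedCylinder_mem_of_mem_wordPairs hι hp)).lt_top).ne
      have hKmeas := (isOpen_separatedPairs hι n₀).measurableSet
      have hb : ∫ z, (separatedPairs hι n₀).indicator (fun _ => |C|) z ∂(m i) =
          |C| * (m i).real (separatedPairs hι n₀) := by
        rw [integral_indicator_const _ hKmeas, smul_eq_mul, mul_comm]
      rw [Set.mem_Icc, ← abs_le, ← Real.norm_eq_abs]
      refine (norm_integral_le_of_norm_le (g := (separatedPairs hι n₀).indicator fun _ => |C|)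
        ?_ (ae_of_all _ fun z => ?_)).trans ?_
      · rw [integrable_indicator_iff hKmeas]
        exact integrableOn_const hKm
      · by_cases hz : z ∈ separatedPairs hι n₀
        · rw [Set.indicator_of_mem hz]
          exact (hC z).trans (le_abs_self C)
        · rw [Set.indicator_of_notMem hz, hf z hz, norm_zero]
      · rw [hb]
        gcongr
    obtain ⟨L, -, hL⟩ := (isCompact_Icc (a := -(|C| * M)) (b := |C| * M)).ultrafilter_le_nhds
      (U.map fun i => ∫ z, f z ∂(m i)) (by rw [le_principal_iff]; exact hev)
    exact ⟨L, hL⟩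
  choose Λ hΛ using hlim
  let Λ' : CompactlySupportedContinuousMap (DoubleBoundary A) ℝ →ₗ[ℝ] ℝ :=
    { toFun := Λ
      map_add' := fun f g => by
        refine tendsto_nhds_unique (hΛ (f + g)) ?_
        refine ((hΛ f).add (hΛ g)).congr fun i => ?_
        rw [← integral_add (hint i f) (hint i g)]
        rfl
      map_smul' := fun r f => by
        refine tendsto_nhds_unique (hΛ (r • f)) ?_
        refine ((hΛ f).const_mul r).congr fun i => ?_
        rw [← integral_const_mul]
        rfl }
  let Λ'' : CompactlySupportedContinuousMap (DoubleBoundary A) ℝ →ₚ[ℝ] ℝ :=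
    PositiveLinearMap.mk₀ Λ' fun f hf => by
      refine ge_of_tendsto' (hΛ f) fun i => integral_nonneg fun z => hf z
  refine ⟨RealRMK.rieszMeasure Λ'', ?_⟩
  rintro D ⟨a, b, hl, hab, rfl⟩
  refine ⟨?_, ?_⟩
  · exact (isCompact_rootedCylinder hι hl hab).measure_lt_top.ne
  · rw [← integral_cylinderIndicator hι hl hab, RealRMK.integral_rieszMeasure]
    refine tendsto_nhds_unique (hΛ (cylinderIndicator hι hl hab)) ?_
    simp only [integral_cylinderIndicator]
    exact (h _ (rootedCylinder_mem hι hl hab)).mono_left hU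

end WeakConvergence

/-! ### Edge-paths as elements of a free group -/

namespace SerreGraph

variable {V E : Type*} (Γ : SerreGraph V E)

/-- The edges that are smaller than their inverses for a fixed well-ordering: one edge from each
pair of mutually inverse edges. -/
def PosEdge : Type _ := {e : E // WellOrderingRel e (Γ.inv e)}

noncomputable instance : DecidableEq Γ.PosEdge := Classical.decEq _

instance [Finite E] : Finite Γ.PosEdge :=
  inferInstanceAs (Finite {e : E // WellOrderingRel e (Γ.inv e)})

theorem wellOrderingRel_inv {e : E} (h : ¬ WellOrderingRel e (Γ.inv e)) :
    WellOrderingRel (Γ.inv e) (Γ.inv (Γ.inv e)) := by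
  rw [Γ.inv_inv]
  rcases trichotomous_of WellOrderingRel e (Γ.inv e) with h1 | h1 | h1
  · exact absurd h1 h
  · exact absurd h1.symm (Γ.inv_ne e)
  · exact h1

theorem wellOrderingRel_asymm {e : E} (h : WellOrderingRel e (Γ.inv e)) :
    ¬ WellOrderingRel (Γ.inv e) (Γ.inv (Γ.inv e)) := by
  rw [Γ.inv_inv]
  exact asymm_of WellOrderingRel h

open Classical in
/-- Edges as letters of the free group on the chosen edges: the chosen edges are the generators,
the other edges are their inverses. -/
noncomputable def letter : E ≃ Γ.PosEdge × Bool where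
  toFun e := if h : WellOrderingRel e (Γ.inv e) then (⟨e, h⟩, true)
    else (⟨Γ.inv e, Γ.wellOrderingRel_inv h⟩, false)
  invFun l := if l.2 then l.1.1 else Γ.inv l.1.1
  left_inv e := by
    by_cases h : WellOrderingRel e (Γ.inv e)
    · simp [h]
    · simp [h, Γ.inv_inv]
  right_inv := by
    rintro ⟨⟨e, h⟩, b⟩
    cases b
    · have := Γ.wellOrderingRel_asymm h
      simp only [Bool.false_eq_true, if_false, dif_neg this]
      congr 2
      exact Γ.inv_inv e
    · simp [h]

theorem letter_inv (e : E) : Γ.letter (Γ.inv e) = invLetter (Γ.letter e) := by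
  by_cases h : WellOrderingRel e (Γ.inv e)
  · have h' := Γ.wellOrderingRel_asymm h
    simp only [letter, Equiv.coe_fn_mk, dif_pos h, dif_neg h', invLetter]
    congr 2
    exact Γ.inv_inv e
  · have h' := Γ.wellOrderingRel_inv h
    simp only [letter, Equiv.coe_fn_mk, dif_neg h, dif_pos h', invLetter]
    rfl

theorem letter_symm_invLetter (l : Γ.PosEdge × Bool) :
    Γ.letter.symm (invLetter l) = Γ.inv (Γ.letter.symm l) := by
  rw [Equiv.symm_apply_eq, letter_inv, Equiv.apply_symm_apply]

/-- The element of the free group spelled by a list of edges. -/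
noncomputable def word (l : List E) : FreeGroup Γ.PosEdge := FreeGroup.mk (l.map Γ.letter)

theorem word_nil : Γ.word [] = 1 := rfl

theorem word_append (l m : List E) : Γ.word (l ++ m) = Γ.word l * Γ.word m := by
  rw [word, word, word, FreeGroup.mul_mk, List.map_append]

theorem word_cons (e : E) (l : List E) : Γ.word (e :: l) = Γ.word [e] * Γ.word l :=
  Γ.word_append [e] l

theorem word_invPath (l : List E) : Γ.word (Γ.invPath l) = (Γ.word l)⁻¹ := by
  rw [word, word, FreeGroup.inv_mk, FreeGroup.invRev, invPath, List.map_reverse, List.map_map,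
    List.map_map]
  congr 3
  funext e
  exact Γ.letter_inv e

theorem norm_word_le (l : List E) : (Γ.word l).norm ≤ l.length := by
  have := FreeGroup.norm_mk_le (L₁ := l.map Γ.letter)
  rwa [List.length_map] at this

variable {Γ}

theorem isPath_append_iff {u w : V} {p q : List E} :
    Γ.IsPath u (p ++ q) w ↔ ∃ v, Γ.IsPath u p v ∧ Γ.IsPath v q w := by
  constructor
  · induction p generalizing u with
    | nil => exact fun h => ⟨u, rfl, h⟩
    | cons f p ih =>
      rintro ⟨h1, h2⟩
      obtain ⟨v, h3, h4⟩ := ih h2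
      exact ⟨v, ⟨h1, h3⟩, h4⟩
  · rintro ⟨v, h1, h2⟩
    exact h1.append h2

theorem IsPath.endpoint_unique {u v w : V} {l : List E} (h : Γ.IsPath u l v)
    (h' : Γ.IsPath u l w) : v = w := by
  induction l generalizing u with
  | nil => exact h.symm.trans h'
  | cons e l ih => exact ih h.2 h'.2

theorem isPath_singleton {u v : V} {e : E} : Γ.IsPath u [e] v ↔ Γ.o e = u ∧ Γ.t e = v := Iff.rfl

theorem t_inv (e : E) : Γ.t (Γ.inv e) = Γ.o e := by rw [t, Γ.inv_inv]

theorem isReduced_map_letter {l : List E} (h : Γ.IsReducedPath l) :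
    FreeGroup.IsReduced (l.map Γ.letter) := by
  rw [isReduced_iff, List.isChain_map]
  refine List.IsChain.imp ?_ h
  rintro e f ⟨-, h⟩ h'
  rw [← letter_inv] at h'
  exact h (Γ.letter.injective h')

/-- A reduced edge-path spells a reduced word, so that no information is lost by reading it in the
free group. -/
theorem toWord_word {l : List E} (h : Γ.IsReducedPath l) :
    (Γ.word l).toWord = l.map Γ.letter :=
  toWord_mk_of_isReduced (isReduced_map_letter h)

theorem IsPath.isReducedPath {u v : V} {l : List E} (h : Γ.IsPath u l v)
    (hr : FreeGroup.IsReduced (l.map Γ.letter)) : Γ.IsReducedPath l := by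
  rw [isReduced_iff, List.isChain_map] at hr
  induction l generalizing u with
  | nil => exact List.isChain_nil
  | cons e l ih =>
    rcases l with _ | ⟨f, l⟩
    · exact List.isChain_singleton _
    · rw [List.isChain_cons_cons] at hr
      refine List.isChain_cons_cons.2 ⟨⟨h.2.1.symm, fun h' => hr.1 ?_⟩, ih h.2 hr.2⟩
      rw [h', letter_inv]

theorem IsReducedPath.isPath {e : E} {l : List E} (h : Γ.IsReducedPath (e :: l)) :
    Γ.IsPath (Γ.o e) (e :: l) (Γ.t ((e :: l).getLast (List.cons_ne_nil _ _))) := by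
  induction l generalizing e with
  | nil => exact ⟨rfl, rfl⟩
  | cons f l ih =>
    have h' := List.isChain_cons_cons.1 h
    refine ⟨rfl, ?_⟩
    rw [h'.1.1, List.getLast_cons (List.cons_ne_nil _ _)]
    exact ih h'.2

/-- Free reduction preserves being an edge-path with given ends, since the two letters that cancel
are an edge followed by its inverse. -/
theorem isPath_of_red {u v : V} {L L' : List (Γ.PosEdge × Bool)} (h : FreeGroup.Red L L')
    (hL : Γ.IsPath u (L.map Γ.letter.symm) v) : Γ.IsPath u (L'.map Γ.letter.symm) v := by
  induction h with
  | refl => exact hL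
  | tail _ hs ih =>
    cases hs with
    | @not L₁ L₂ x b =>
      rw [List.map_append, isPath_append_iff] at ih
      obtain ⟨w, h1, h2⟩ := ih
      rw [List.map_append]
      refine h1.append ?_
      obtain ⟨h3, h4, h5⟩ := h2
      have e : Γ.letter.symm (x, !b) = Γ.inv (Γ.letter.symm (x, b)) :=
        Γ.letter_symm_invLetter (x, b)
      rw [e, t_inv, h3] at h5
      exact h5

variable (Γ) in
/-- `g` is the class of an edge-path from `u` to `v`. -/
def IsPathElement (u : V) (g : FreeGroup Γ.PosEdge) (v : V) : Prop :=
  Γ.IsPath u (g.toWord.map Γ.letter.symm) v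

theorem map_letter_symm_map_letter (l : List E) : (l.map Γ.letter).map Γ.letter.symm = l := by
  simp

theorem map_letter_map_letter_symm (L : List (Γ.PosEdge × Bool)) :
    (L.map Γ.letter.symm).map Γ.letter = L := by
  simp

theorem word_map_letter_symm (g : FreeGroup Γ.PosEdge) :
    Γ.word (g.toWord.map Γ.letter.symm) = g := by
  rw [word, map_letter_map_letter_symm, FreeGroup.mk_toWord]

theorem IsPath.isPathElement {u v : V} {l : List E} (h : Γ.IsPath u l v) :
    Γ.IsPathElement u (Γ.word l) v := by
  rw [← map_letter_symm_map_letter (Γ := Γ) l] at h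
  rw [IsPathElement, word, FreeGroup.toWord_mk]
  exact isPath_of_red FreeGroup.reduce.red h

theorem isPathElement_word_iff {u v : V} {l : List E} (hl : Γ.IsReducedPath l) :
    Γ.IsPathElement u (Γ.word l) v ↔ Γ.IsPath u l v := by
  rw [IsPathElement, toWord_word hl, map_letter_symm_map_letter]

theorem IsPathElement.mul {u v w : V} {g h : FreeGroup Γ.PosEdge} (hg : Γ.IsPathElement u g v)
    (hh : Γ.IsPathElement v h w) : Γ.IsPathElement u (g * h) w := by
  have := (IsPath.append hg hh).isPathElement
  rwa [word_append, word_map_letter_symm, word_map_letter_symm] at this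

theorem IsPathElement.inv {u v : V} {g : FreeGroup Γ.PosEdge} (hg : Γ.IsPathElement u g v) :
    Γ.IsPathElement v g⁻¹ u := by
  have := (IsPath.invPath hg).isPathElement
  rwa [word_invPath, word_map_letter_symm] at this

theorem isPathElement_one (u : V) : Γ.IsPathElement u 1 u := by
  rw [IsPathElement, FreeGroup.toWord_one]
  rfl

theorem IsPathElement.endpoint_unique {u v w : V} {g : FreeGroup Γ.PosEdge}
    (h : Γ.IsPathElement u g v) (h' : Γ.IsPathElement u g w) : v = w :=
  IsPath.endpoint_unique h h'

theorem IsPathElement.of_prefix {u v : V} {g h : FreeGroup Γ.PosEdge}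
    (hg : Γ.IsPathElement u g v) (hh : h.toWord <+: g.toWord) : ∃ w, Γ.IsPathElement u h w := by
  obtain ⟨t, ht⟩ := hh
  rw [IsPathElement, ← ht, List.map_append, isPath_append_iff] at hg
  obtain ⟨w, h1, -⟩ := hg
  exact ⟨w, h1⟩

/-! ### The fundamental group -/

theorem Pi1.mk_eq_of_red {x : V} {L L' : List (Γ.PosEdge × Bool)} (h : FreeGroup.Red L L')
    (hL : Γ.IsPath x (L.map Γ.letter.symm) x) :
    (Pi1.mk (L.map Γ.letter.symm) hL : Γ.Pi1 x) =
      Pi1.mk (L'.map Γ.letter.symm) (isPath_of_red h hL) := by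
  induction h with
  | refl => rfl
  | tail h' hs ih =>
    rw [ih]
    cases hs with
    | @not L₁ L₂ y b =>
      symm
      refine Quot.sound ⟨L₁.map Γ.letter.symm, L₂.map Γ.letter.symm, Γ.letter.symm (y, b), ?_, ?_⟩
      · simp
      · have e : Γ.letter.symm (y, !b) = Γ.inv (Γ.letter.symm (y, b)) :=
          Γ.letter_symm_invLetter (y, b)
        simp [e]

variable (Γ) in
/-- The embedding of the fundamental group into the free group on the chosen edges. -/
noncomputable def pi1Hom (x : V) : Γ.Pi1 x →* FreeGroup Γ.PosEdge where
  toFun := Quot.lift (fun p => Γ.word p.1) (by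
    rintro p q ⟨l, m, e, h1, h2⟩
    have h3 : Γ.word [Γ.inv e] = (Γ.word [e])⁻¹ := by
      rw [← word_invPath]; rfl
    simp only [h1, h2]
    rw [word_append, word_append, word_cons, word_cons Γ (Γ.inv e), h3, mul_inv_cancel_left])
  map_one' := Γ.word_nil
  map_mul' := by
    rintro ⟨p⟩ ⟨q⟩
    exact Γ.word_append p.1 q.1

theorem pi1Hom_mk {x : V} {l : List E} (h : Γ.IsPath x l x) :
    Γ.pi1Hom x (Pi1.mk l h) = Γ.word l := rfl

/-- Each loop is homotopic to its reduced form, and the reduced form is the reduced word of the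
associated group element. -/
theorem pi1Hom_injective (x : V) : Function.Injective (Γ.pi1Hom x) := by
  have key : ∀ l (h : Γ.IsPath x l x), (Pi1.mk l h : Γ.Pi1 x) =
      Pi1.mk ((Γ.word l).toWord.map Γ.letter.symm) h.isPathElement := by
    intro l h
    have h' : Γ.IsPath x ((l.map Γ.letter).map Γ.letter.symm) x := by
      rwa [map_letter_symm_map_letter]
    have h1 := Pi1.mk_eq_of_red (FreeGroup.reduce.red (L := l.map Γ.letter)) h'
    simp only [map_letter_symm_map_letter] at h1
    exact h1
  rintro ⟨p⟩ ⟨q⟩ h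
  have h' : Γ.word p.1 = Γ.word q.1 := h
  have h1 := key p.1 p.2
  have h2 := key q.1 q.2
  simp only [h'] at h1
  exact h1.trans h2.symm

theorem mem_range_pi1Hom {x : V} {g : FreeGroup Γ.PosEdge} :
    (∃ a, Γ.pi1Hom x a = g) ↔ Γ.IsPathElement x g x := by
  constructor
  · rintro ⟨⟨p⟩, rfl⟩
    exact p.2.isPathElement
  · intro h
    exact ⟨Pi1.mk _ h, (pi1Hom_mk h).trans (word_map_letter_symm g)⟩

/-! ### The universal covering tree -/

/-- A vertex of the covering tree as an element of the free group. -/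
noncomputable def TreeVertex.elt {x : V} (p : Γ.TreeVertex x) : FreeGroup Γ.PosEdge := Γ.word p.1

theorem TreeVertex.elt_injective {x : V} :
    Function.Injective (TreeVertex.elt : Γ.TreeVertex x → FreeGroup Γ.PosEdge) := by
  intro p q h
  have h1 := congrArg FreeGroup.toWord h
  rw [elt, elt, toWord_word p.2.1, toWord_word q.2.1] at h1
  exact Subtype.ext (List.map_injective_iff.2 Γ.letter.injective h1)

theorem TreeVertex.isPathElement_iff {x y : V} (p : Γ.TreeVertex x) :
    Γ.IsPathElement x p.elt y ↔ Γ.IsPath x p.1 y :=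
  isPathElement_word_iff p.2.1

theorem TreeVertex.exists_isPathElement {x : V} (p : Γ.TreeVertex x) :
    ∃ y, Γ.IsPathElement x p.elt y := by
  obtain ⟨y, hy⟩ := p.2.2
  exact ⟨y, hy.isPathElement⟩

theorem exists_treeVertex {x y : V} {g : FreeGroup Γ.PosEdge} (h : Γ.IsPathElement x g y) :
    ∃ p : Γ.TreeVertex x, p.elt = g := by
  refine ⟨⟨g.toWord.map Γ.letter.symm, ?_, y, h⟩, word_map_letter_symm g⟩
  apply IsPath.isReducedPath h
  rw [map_letter_map_letter_symm]
  exact FreeGroup.isReduced_toWord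

theorem EdgeOver.elt_eq {x : V} {p q : Γ.TreeVertex x} {e : E} (h : Γ.EdgeOver p e q) :
    q.elt = p.elt * Γ.word [e] ∧ Γ.IsPathElement x p.elt (Γ.o e) := by
  have h3 : Γ.word [Γ.inv e] = (Γ.word [e])⁻¹ := by
    rw [← word_invPath]; rfl
  rcases h with h | h
  · refine ⟨by rw [TreeVertex.elt, TreeVertex.elt, h, word_append], ?_⟩
    obtain ⟨y, hy⟩ := q.2.2
    rw [h, isPath_append_iff] at hy
    obtain ⟨v, h1, h2⟩ := hy
    rw [TreeVertex.isPathElement_iff, h2.1]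
    exact h1
  · refine ⟨by rw [TreeVertex.elt, TreeVertex.elt, h, word_append, h3, inv_mul_cancel_right], ?_⟩
    obtain ⟨y, hy⟩ := p.2.2
    rw [TreeVertex.isPathElement_iff]
    have h1 := hy
    rw [h, isPath_append_iff] at h1
    obtain ⟨v, h1, h2, h4⟩ := h1
    rw [t_inv] at h4
    rw [h4]
    exact hy

theorem edgeOver_of_elt_eq {x : V} {p q : Γ.TreeVertex x} {e : E}
    (h : q.elt = p.elt * Γ.word [e]) : Γ.EdgeOver p e q := by
  have h1 := congrArg FreeGroup.toWord h
  have h2 := toWord_mul_letter p.elt (Γ.letter e)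
  have h3 : Γ.word [e] = FreeGroup.mk [Γ.letter e] := rfl
  rw [h3, h2, TreeVertex.elt, TreeVertex.elt, toWord_word p.2.1, toWord_word q.2.1] at h1
  split_ifs at h1 with h4
  · right
    rw [← letter_inv] at h4
    obtain ⟨L, hL⟩ : ∃ L, p.1 = L ++ [Γ.inv e] := by
      rcases List.eq_nil_or_concat' p.1 with h5 | ⟨L, f, h5⟩
      · rw [h5] at h4; simp at h4
      · rw [h5] at h4
        simp only [List.map_append, List.map_cons, List.map_nil, List.getLast?_concat,
          Option.some.injEq, EmbeddingLike.apply_eq_iff_eq] at h4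
        exact ⟨L, by rw [h5, h4]⟩
    rw [hL, List.map_append, List.map_cons, List.map_nil, List.dropLast_concat] at h1
    rw [hL, List.map_injective_iff.2 Γ.letter.injective h1]
  · left
    have : (p.1 ++ [e]).map Γ.letter = p.1.map Γ.letter ++ [Γ.letter e] := by simp
    rw [← this] at h1
    exact List.map_injective_iff.2 Γ.letter.injective h1

/-- Following a lift of `v` multiplies the group element of the vertex by the word of `v`. -/
theorem IsLift.elt_eq {x : V} {p q : Γ.TreeVertex x} {v : List E} (h : Γ.IsLift p v q) {y : V}
    (hy : Γ.IsPathElement x p.elt y) :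
    q.elt = p.elt * Γ.word v ∧ ∃ y', Γ.IsPath y v y' := by
  induction v generalizing p y with
  | nil =>
    have h : p = q := h
    exact ⟨by rw [h, word_nil, mul_one], y, rfl⟩
  | cons e v ih =>
    obtain ⟨r, h1, h2⟩ := h
    obtain ⟨h3, h4⟩ := h1.elt_eq
    have hr : Γ.IsPathElement x r.elt (Γ.t e) := by
      rw [h3]
      exact h4.mul (IsPath.isPathElement ⟨rfl, rfl⟩)
    obtain ⟨h5, y', h6⟩ := ih h2 hr
    refine ⟨by rw [h5, h3, word_cons Γ e v, mul_assoc], y', h4.endpoint_unique hy, h6⟩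

theorem isLift_of_elt_eq {x y y' : V} {p q : Γ.TreeVertex x} {v : List E}
    (h : q.elt = p.elt * Γ.word v) (hp : Γ.IsPathElement x p.elt y) (hv : Γ.IsPath y v y') :
    Γ.IsLift p v q := by
  induction v generalizing p y with
  | nil =>
    rw [word_nil, mul_one] at h
    exact (TreeVertex.elt_injective h).symm
  | cons e v ih =>
    have h1 : Γ.IsPathElement x (p.elt * Γ.word [e]) (Γ.t e) :=
      hp.mul (IsPath.isPathElement ⟨hv.1, rfl⟩)
    obtain ⟨r, hr⟩ := exists_treeVertex h1
    refine ⟨r, edgeOver_of_elt_eq hr, ih ?_ (hr ▸ h1) hv.2⟩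
    rw [h, hr, word_cons Γ e v, mul_assoc]

theorem IsLift.exists_walk {x : V} {p q : Γ.TreeVertex x} {v : List E} (h : Γ.IsLift p v q) :
    ∃ w : (Γ.tree x).Walk p q, w.length = v.length := by
  induction v generalizing p with
  | nil =>
    have h : p = q := h
    subst h
    exact ⟨SimpleGraph.Walk.nil, rfl⟩
  | cons e v ih =>
    obtain ⟨r, h1, h2⟩ := h
    obtain ⟨w, hw⟩ := ih h2
    have hadj : (Γ.tree x).Adj p r := ⟨e, h1⟩
    exact ⟨SimpleGraph.Walk.cons hadj w, by simp [hw]⟩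

theorem norm_le_walk_length {x : V} {p q : Γ.TreeVertex x} (w : (Γ.tree x).Walk p q) :
    (p.elt⁻¹ * q.elt).norm ≤ w.length := by
  induction w with
  | nil => simp
  | @cons p r q h w ih =>
    have h' : ∃ e, Γ.EdgeOver p e r := h
    obtain ⟨e, he⟩ := h'
    rw [SimpleGraph.Walk.length_cons, add_comm]
    refine (norm_triangle _ r.elt _).trans (add_le_add ?_ ih)
    rw [he.elt_eq.1, inv_mul_cancel_left]
    exact Γ.norm_word_le [e]

/-- The distance of the covering tree is the word metric of the free group. -/
theorem tree_dist {x : V} (p q : Γ.TreeVertex x) :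
    (Γ.tree x).dist p q = (p.elt⁻¹ * q.elt).norm := by
  obtain ⟨y, hy⟩ := p.exists_isPathElement
  obtain ⟨y', hy'⟩ := q.exists_isPathElement
  have h1 : Γ.IsPathElement y (p.elt⁻¹ * q.elt) y' := hy.inv.mul hy'
  have h2 : Γ.IsLift p ((p.elt⁻¹ * q.elt).toWord.map Γ.letter.symm) q :=
    isLift_of_elt_eq (by rw [word_map_letter_symm, mul_inv_cancel_left]) hy h1
  obtain ⟨w, hw⟩ := h2.exists_walk
  apply le_antisymm
  · refine (SimpleGraph.dist_le w).trans ?_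
    rw [hw, List.length_map]
    rfl
  · obtain ⟨w', hw'⟩ := w.reachable.exists_walk_length_eq_dist
    rw [← hw']
    exact norm_le_walk_length w'

end SerreGraph

/-! ### Cylinders of the covering tree -/

section Geodesics

variable {B : Type*}

theorem head_pre {x : Boundary B} {k : ℕ} {l : B × Bool} (h : l ∈ (x.pre k).head?) :
    x.1 0 = l := by
  rcases k with _ | k
  · simp at h
  · rw [Boundary.pre_succ'] at h
    simpa using h

variable [DecidableEq B]

theorem norm_prefixElement_inv_mul (x : Boundary B) {a b : ℕ} (h : a ≤ b) :
    ((x.prefixElement a)⁻¹ * x.prefixElement b).norm = b - a := by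
  obtain ⟨d, rfl⟩ := Nat.exists_eq_add_of_le h
  have e : x.prefixElement (a + d) = x.prefixElement a * (x.shift a).prefixElement d := by
    rw [Boundary.prefixElement_eq_mk, Boundary.prefixElement_eq_mk, Boundary.prefixElement_eq_mk,
      FreeGroup.mul_mk, Boundary.pre_add]
  rw [e, inv_mul_cancel_left, Boundary.norm_prefixElement]
  omega

/-- Two words with distinct first letters span a geodesic through `1`. -/
theorem norm_inv_mul_of_ne {x y : Boundary B} (h : x.1 0 ≠ y.1 0) (a b : ℕ) :
    ((x.prefixElement a)⁻¹ * y.prefixElement b).norm = a + b := by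
  have e : (x.prefixElement a)⁻¹ * y.prefixElement b =
      FreeGroup.mk (FreeGroup.invRev (x.pre a) ++ y.pre b) := by
    rw [Boundary.prefixElement_eq_mk, Boundary.prefixElement_eq_mk, FreeGroup.inv_mk,
      FreeGroup.mul_mk]
  have hr : FreeGroup.IsReduced (FreeGroup.invRev (x.pre a) ++ y.pre b) := by
    have h1 : FreeGroup.IsReduced (FreeGroup.invRev (x.pre a)) := by
      rw [← Boundary.toWord_prefixElement, ← FreeGroup.toWord_inv]
      exact FreeGroup.isReduced_toWord
    rw [isReduced_iff] at h1 ⊢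
    refine List.isChain_append.2 ⟨h1, isReduced_iff.1 (y.isReduced_pre b), ?_⟩
    intro l hl m hm
    rw [getLast_invRev] at hl
    obtain ⟨l', h2, rfl⟩ := Option.mem_map.1 hl
    rw [invLetter_invLetter, ← head_pre hm, ← head_pre h2]
    exact h.symm
  rw [FreeGroup.norm, e, toWord_mk_of_isReduced hr]
  simp [FreeGroup.invRev]

/-- If `P ≠ Q` have the same length, then the first step from `P` towards `Q` removes the last
letter of `P`. -/
theorem head_inv_mul {P Q : FreeGroup B} (hl : P.norm = Q.norm) (hne : P ≠ Q) :
    (P⁻¹ * Q).toWord.head? = P.toWord.getLast?.map invLetter := by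
  have key : ∀ a b : List (B × Bool), FreeGroup.IsReduced a → FreeGroup.IsReduced b →
      a.length = b.length → a ≠ b →
      ((FreeGroup.mk a)⁻¹ * FreeGroup.mk b : FreeGroup B).toWord.head? =
        a.getLast?.map invLetter := by
    intro a
    induction a with
    | nil =>
      intro b _ _ h1 h2
      exact absurd (List.length_eq_zero_iff.1 h1.symm).symm h2
    | cons l a ih =>
      rintro (_ | ⟨m, b⟩) ha hb h1 h2
      · simp at h1
      · by_cases hlm : l = m
        · subst hlm
          have h3 : a ≠ b := fun h => h2 (by rw [h])
          have h4 : a.length = b.length := by simpa using h1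
          have ha0 : a ≠ [] := by
            rintro rfl
            exact h3 (List.length_eq_zero_iff.1 h4.symm).symm
          have e : ∀ c : List (B × Bool),
              (FreeGroup.mk (l :: c) : FreeGroup B) = FreeGroup.mk [l] * FreeGroup.mk c := by
            intro c
            rw [FreeGroup.mul_mk]; rfl
          rw [e a, e b, mul_inv_rev, mul_assoc, inv_mul_cancel_left,
            ih b (ha.infix ⟨[l], [], by simp⟩) (hb.infix ⟨[l], [], by simp⟩) h4 h3]
          congr 1
          rw [List.getLast?_cons_of_ne_nil ha0]
        · have hr : FreeGroup.IsReduced (FreeGroup.invRev (l :: a) ++ m :: b) := by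
            have h3 : FreeGroup.IsReduced (FreeGroup.invRev (l :: a)) := by
              rw [← toWord_mk_of_isReduced ha, ← FreeGroup.toWord_inv]
              exact FreeGroup.isReduced_toWord
            rw [isReduced_iff] at h3 hb ⊢
            refine List.isChain_append.2 ⟨h3, hb, ?_⟩
            intro x hx y hy
            rw [getLast_invRev] at hx
            simp only [List.head?_cons, Option.map_some, Option.mem_def, Option.some.injEq] at hx hy
            rw [← hx, ← hy, invLetter_invLetter]
            exact fun h => hlm h.symm
          rw [FreeGroup.inv_mk, FreeGroup.mul_mk, toWord_mk_of_isReduced hr,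
            List.head?_append_of_ne_nil _ (by simp [FreeGroup.invRev]), FreeGroup.invRev,
            List.head?_reverse, List.getLast?_map]
          rfl
  have := key P.toWord Q.toWord FreeGroup.isReduced_toWord FreeGroup.isReduced_toWord hl
    (fun h => hne (FreeGroup.toWord_injective h))
  rwa [FreeGroup.mk_toWord, FreeGroup.mk_toWord] at this

end Geodesics

namespace Chart

open SerreGraph

variable {A V E : Type*} [Fintype A] (Γ : Chart A V E)

instance : Finite Γ.PosEdge :=
  have _ := Γ.finite_E
  inferInstance

/-- The marking as an embedding of `F(A)` into the free group on the chosen edges. -/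
noncomputable def emb : FreeGroup A →* FreeGroup Γ.PosEdge :=
  (Γ.pi1Hom Γ.x₀).comp Γ.marking.toMonoidHom

theorem emb_apply (g : FreeGroup A) : Γ.emb g = Γ.pi1Hom Γ.x₀ (Γ.marking g) := rfl

theorem emb_injective : Function.Injective Γ.emb :=
  (pi1Hom_injective Γ.x₀).comp Γ.marking.injective

theorem mem_range_emb {g : FreeGroup Γ.PosEdge} :
    (∃ a, Γ.emb a = g) ↔ Γ.IsPathElement Γ.x₀ g Γ.x₀ := by
  rw [← mem_range_pi1Hom]
  exact ⟨fun ⟨a, ha⟩ => ⟨_, ha⟩, fun ⟨a, ha⟩ => ⟨Γ.marking.symm a, by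
    rw [emb_apply, MulEquiv.apply_symm_apply, ha]⟩⟩

theorem isPathElement_emb (g : FreeGroup A) : Γ.IsPathElement Γ.x₀ (Γ.emb g) Γ.x₀ :=
  Γ.mem_range_emb.1 ⟨g, rfl⟩

variable {Γ}

theorem isOrbitVertex_iff {g : FreeGroup A} {p : Γ.TreeVertex Γ.x₀} :
    Γ.IsOrbitVertex g p ↔ p.elt = Γ.emb g := by
  constructor
  · rintro ⟨h, h'⟩
    rw [emb_apply, h', pi1Hom_mk]
    rfl
  · intro h
    have h1 := Γ.isPathElement_emb g
    rw [← h, TreeVertex.isPathElement_iff] at h1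
    refine ⟨h1, pi1Hom_injective Γ.x₀ ?_⟩
    rw [pi1Hom_mk, ← emb_apply, ← h]
    rfl

theorem dist_eq (p q : Γ.TreeVertex Γ.x₀) : Γ.T₀.dist p q = (p.elt⁻¹ * q.elt).norm :=
  tree_dist p q

/-- Two vertices of the covering tree span a lift of a reduced edge-path. -/
theorem exists_isLift {p q : Γ.TreeVertex Γ.x₀} (hpq : p ≠ q) :
    ∃ v, v ≠ [] ∧ Γ.IsReducedPath v ∧ Γ.IsLift p v q := by
  obtain ⟨y, hy⟩ := p.exists_isPathElement
  obtain ⟨y', hy'⟩ := q.exists_isPathElement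
  have h : Γ.IsPathElement y (p.elt⁻¹ * q.elt) y' := hy.inv.mul hy'
  refine ⟨(p.elt⁻¹ * q.elt).toWord.map Γ.letter.symm, ?_, ?_, ?_⟩
  · rw [Ne, List.map_eq_nil_iff, FreeGroup.toWord_eq_nil_iff, inv_mul_eq_one]
    exact fun h => hpq (TreeVertex.elt_injective h)
  · apply IsPath.isReducedPath h
    rw [map_letter_map_letter_symm]
    exact FreeGroup.isReduced_toWord
  · exact isLift_of_elt_eq (by rw [word_map_letter_symm, mul_inv_cancel_left]) hy h

theorem EndsAt.of_dist_le {ρ ρ' : ℕ → Γ.TreeVertex Γ.x₀} {x : Boundary A} (h : Γ.EndsAt ρ x)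
    {C : ℕ} (hC : ∀ n, Γ.T₀.dist (ρ' n) (ρ n) ≤ C) : Γ.EndsAt ρ' x := by
  obtain ⟨C', h⟩ := h
  refine ⟨C + C', fun n => ?_⟩
  obtain ⟨m, p, h1, h2⟩ := h n
  refine ⟨m, p, h1, ?_⟩
  have h3 := hC n
  rw [dist_eq] at h2 h3 ⊢
  exact (norm_triangle _ (ρ n).elt _).trans (add_le_add h3 h2)

theorem flipPair_preimage_cylinder (p q : Γ.TreeVertex Γ.x₀) :
    flipPair ⁻¹' Γ.cylinder p q = Γ.cylinder q p := by
  have key : ∀ (p q : Γ.TreeVertex Γ.x₀) z, flipPair z ∈ Γ.cylinder p q →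
      z ∈ Γ.cylinder q p := by
    rintro p q z ⟨γ, ⟨h0, h1, h2⟩, i, j, hij, hi, hj⟩
    refine ⟨fun n => γ (-n), ⟨fun a b => ?_, ?_, ?_⟩, -j, -i, by omega, by simpa using hj,
      by simpa using hi⟩
    · rw [h0]; omega
    · simp only [neg_neg]
      exact h2
    · exact h1
  ext z
  exact ⟨key p q z, fun h => key q p (flipPair z) h⟩

/-- The translate of a vertex of the covering tree. -/
theorem exists_translate (g : FreeGroup A) (p : Γ.TreeVertex Γ.x₀) :
    ∃ p' : Γ.TreeVertex Γ.x₀, p'.elt = Γ.emb g * p.elt := by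
  obtain ⟨y, hy⟩ := p.exists_isPathElement
  exact exists_treeVertex ((Γ.isPathElement_emb g).mul hy)

variable [DecidableEq A]

/-- The identification of `∂F(A)` with the boundary of the covering tree. -/
noncomputable abbrev bd (Γ : Chart A V E) : Boundary A → Boundary Γ.PosEdge :=
  boundaryMap Γ.emb_injective

/-- A geodesic ray from `p` that ends at `x` spells the word `p⁻¹ x`. -/
theorem EndsAt.elt_eq {ρ : ℕ → Γ.TreeVertex Γ.x₀} {x : Boundary A} (h : Γ.EndsAt ρ x)
    (hρ : ∀ i j : ℕ, i ≤ j → Γ.T₀.dist (ρ i) (ρ j) = j - i) (n : ℕ) :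
    (ρ 0).elt⁻¹ * (ρ n).elt = (boundaryAct (ρ 0).elt⁻¹ (Γ.bd x)).prefixElement n := by
  obtain ⟨C, h⟩ := h
  choose m p h1 h2 using h
  have h3 : ∀ n, ((ρ n).elt⁻¹ * Γ.emb (x.prefixElement (m n))).norm ≤ C := by
    intro n
    have := h2 n
    rwa [dist_eq, isOrbitVertex_iff.1 (h1 n)] at this
  have hn0 : ∀ n, ((ρ 0).elt⁻¹ * (ρ n).elt).norm = n := by
    intro n
    rw [← dist_eq, hρ 0 n (Nat.zero_le n), Nat.sub_zero]
  have hm : Tendsto m atTop atTop := by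
    apply tendsto_of_tendsto_norm (u := fun k => Γ.emb (x.prefixElement k))
    rw [tendsto_atTop]
    intro M
    filter_upwards [eventually_ge_atTop (M + C + (ρ 0).elt.norm)] with n hn
    have h4 := FreeGroup.norm_mul_le (ρ 0).elt⁻¹ (ρ n).elt
    rw [hn0, FreeGroup.norm_inv_eq] at h4
    have h5 := norm_le_norm_add (Γ.emb (x.prefixElement (m n))) (ρ n).elt
    rw [norm_mul_inv_comm] at h5
    have := h3 n
    omega
  have h4 : ConvergesTo (fun n => (ρ n).elt) (Γ.bd x) :=
    ((convergesTo_boundaryMap Γ.emb_injective x).comp hm).of_dist_le (C := C) fun n => by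
      rw [norm_mul_inv_comm]
      exact h3 n
  refine (h4.mul_left (ρ 0).elt⁻¹).eq_prefixElement hn0 (fun k => ?_) n
  have h5 := hρ k (k + 1) (by omega)
  rw [dist_eq] at h5
  have e : ((ρ 0).elt⁻¹ * (ρ k).elt)⁻¹ * ((ρ 0).elt⁻¹ * (ρ (k + 1)).elt) =
      (ρ k).elt⁻¹ * (ρ (k + 1)).elt := by group
  rw [e]
  omega

/-- From every vertex `p` of the covering tree a geodesic ray leads to a given boundary point. -/
theorem exists_ray (p : Γ.TreeVertex Γ.x₀) (x : Boundary A) : ∃ ρ : ℕ → Γ.TreeVertex Γ.x₀,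
    (∀ n, (ρ n).elt = p.elt * (boundaryAct p.elt⁻¹ (Γ.bd x)).prefixElement n) ∧
      Γ.EndsAt ρ x := by
  obtain ⟨y, hy⟩ := p.exists_isPathElement
  obtain ⟨K, hK⟩ := exists_norm_map_le Γ.emb
  have hconv := (convergesTo_boundaryMap Γ.emb_injective x).mul_left p.elt⁻¹
  have h1 : ∀ n, ∃ r : Γ.TreeVertex Γ.x₀,
      r.elt = p.elt * (boundaryAct p.elt⁻¹ (Γ.bd x)).prefixElement n := by
    intro n
    obtain ⟨m, hm⟩ := (convergesTo_iff.1 hconv n).exists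
    rw [← Boundary.toWord_prefixElement] at hm
    obtain ⟨w, hw⟩ := (hy.inv.mul (Γ.isPathElement_emb (x.prefixElement m))).of_prefix hm
    exact exists_treeVertex (hy.mul hw)
  choose ρ hρ using h1
  refine ⟨ρ, hρ, K * 1 + 2 * p.elt.norm, fun n => ?_⟩
  obtain ⟨m, hm⟩ := hconv.exists_near (C := K * 1) (fun k => by
    have := norm_map_le_of_le hK (x.norm_inv_mul_succ k)
    simpa [mul_assoc] using this) n
  obtain ⟨q, hq⟩ := exists_treeVertex (Γ.isPathElement_emb (x.prefixElement m))
  refine ⟨m, q, isOrbitVertex_iff.2 hq, ?_⟩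
  rw [dist_eq, hq, hρ, norm_mul_inv_comm]
  have e : (Γ.emb (x.prefixElement 0)) = 1 := by
    simp [Boundary.prefixElement_eq_mk, ← FreeGroup.one_eq_mk]
  simp only [e, mul_one, FreeGroup.norm_inv_eq] at hm
  rw [mul_inv_rev, _root_.inv_inv, mul_assoc] at hm
  simpa using hm

/-- If the distance to `q` increases along the first step of a ray from `p`, then the ray does not
start in the direction of `q`. -/
theorem EndsAt.first_letter_ne {ρ : ℕ → Γ.TreeVertex Γ.x₀} {x : Boundary A} (h : Γ.EndsAt ρ x)
    (hρ : ∀ i j : ℕ, i ≤ j → Γ.T₀.dist (ρ i) (ρ j) = j - i) {q : Γ.TreeVertex Γ.x₀}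
    (hq : Γ.T₀.dist (ρ 1) q = Γ.T₀.dist (ρ 0) q + 1) :
    ∀ l ∈ ((ρ 0).elt⁻¹ * q.elt).toWord.head?,
      (boundaryAct (ρ 0).elt⁻¹ (Γ.bd x)).1 0 ≠ l := by
  intro l hl h'
  have h1 := h.elt_eq hρ 1
  obtain ⟨L, hL⟩ : ∃ L, ((ρ 0).elt⁻¹ * q.elt).toWord = l :: L := by
    rcases hw : ((ρ 0).elt⁻¹ * q.elt).toWord with _ | ⟨l', L⟩
    · rw [hw] at hl; simp at hl
    · rw [hw] at hl
      simp only [List.head?_cons, Option.mem_def, Option.some.injEq] at hl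
      exact ⟨L, by rw [hl]⟩
  have e1 : (boundaryAct (ρ 0).elt⁻¹ (Γ.bd x)).prefixElement 1 = FreeGroup.mk [l] := by
    rw [Boundary.prefixElement_eq_mk, Boundary.pre_succ', h']
    simp
  rw [e1] at h1
  have e2 : (ρ 0).elt⁻¹ * q.elt = FreeGroup.mk [l] * FreeGroup.mk L := by
    rw [FreeGroup.mul_mk, ← FreeGroup.mk_toWord (x := (ρ 0).elt⁻¹ * q.elt), hL]; rfl
  have e3 : (ρ 1).elt⁻¹ * q.elt = FreeGroup.mk L := by
    have : (ρ 1).elt⁻¹ * q.elt = ((ρ 0).elt⁻¹ * (ρ 1).elt)⁻¹ * ((ρ 0).elt⁻¹ * q.elt) := by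
      group
    rw [this, h1, e2, inv_mul_cancel_left]
  rw [dist_eq, dist_eq, e3] at hq
  have h2 : (FreeGroup.mk L).norm ≤ L.length := FreeGroup.norm_mk_le
  have h3 : ((ρ 0).elt⁻¹ * q.elt).norm = L.length + 1 := by rw [FreeGroup.norm, hL]; rfl
  omega

/-- The geodesic from `x` to `y` passes through `[p, q]` if and only if, seen from `p`, the point
`x` is not in the direction of `q`, and seen from `q`, the point `y` is not in the direction of `p`.
-/
theorem mem_cylinder_iff {p q : Γ.TreeVertex Γ.x₀} (hpq : p ≠ q) (z : DoubleBoundary A) :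
    z ∈ Γ.cylinder p q ↔
      (∀ l ∈ (p.elt⁻¹ * q.elt).toWord.head?, (boundaryAct p.elt⁻¹ (Γ.bd z.1.1)).1 0 ≠ l) ∧
      (∀ l ∈ (q.elt⁻¹ * p.elt).toWord.head?, (boundaryAct q.elt⁻¹ (Γ.bd z.1.2)).1 0 ≠ l) := by
  constructor
  · rintro ⟨γ, ⟨hγ, h1, h2⟩, i, j, hij, rfl, rfl⟩
    constructor
    · have he : Γ.EndsAt (fun n : ℕ => γ (i - n)) z.1.1 := by
        refine EndsAt.of_dist_le h1 (C := i.natAbs) fun n => ?_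
        rw [hγ]
        exact le_of_eq (by congr 1; ring)
      have := he.first_letter_ne (q := γ j) (fun a b hab => by rw [hγ]; omega)
        (by rw [hγ, hγ]; omega)
      simpa using this
    · have he : Γ.EndsAt (fun n : ℕ => γ (j + n)) z.1.2 := by
        refine EndsAt.of_dist_le h2 (C := j.natAbs) fun n => ?_
        rw [hγ]
        exact le_of_eq (by congr 1; ring)
      have := he.first_letter_ne (q := γ i) (fun a b hab => by rw [hγ]; omega)
        (by rw [hγ, hγ]; omega)
      simpa using this
  · rintro ⟨h1, h2⟩
    obtain ⟨ρ₁, e1, f1⟩ := exists_ray p z.1.1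
    obtain ⟨ρ₂, e2, f2⟩ := exists_ray p z.1.2
    set w := p.elt⁻¹ * q.elt with hw
    set x₁ := boundaryAct p.elt⁻¹ (Γ.bd z.1.1)
    set x₂ := boundaryAct p.elt⁻¹ (Γ.bd z.1.2)
    have hwinv : q.elt⁻¹ * p.elt = w⁻¹ := by rw [hw]; group
    have hpre : x₂.pre w.norm = w.toWord := by
      rw [pre_norm_eq_iff]
      intro m hm
      have e : boundaryAct w⁻¹ x₂ = boundaryAct q.elt⁻¹ (Γ.bd z.1.2) := by
        rw [← boundaryAct_mul, ← hwinv, mul_inv_cancel_right]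
      rw [e]
      apply h2
      rw [hwinv, FreeGroup.toWord_inv, FreeGroup.invRev, List.head?_reverse, List.getLast?_map,
        Option.mem_def.1 hm]
      rfl
    have hw0 : w.norm ≠ 0 := by
      rw [Ne, FreeGroup.norm_eq_zero, hw, inv_mul_eq_one]
      exact fun h => hpq (TreeVertex.elt_injective h)
    have hne : x₁.1 0 ≠ x₂.1 0 := by
      obtain ⟨n, hn⟩ := Nat.exists_eq_succ_of_ne_zero hw0
      apply h1
      rw [← hpre, hn, Boundary.pre_succ']
      simp
    have d11 : ∀ a b : ℕ, a ≤ b → Γ.T₀.dist (ρ₁ a) (ρ₁ b) = b - a := by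
      intro a b hab
      rw [dist_eq, e1, e1, ← norm_prefixElement_inv_mul x₁ hab, mul_inv_rev, mul_assoc,
        inv_mul_cancel_left]
    have d22 : ∀ a b : ℕ, a ≤ b → Γ.T₀.dist (ρ₂ a) (ρ₂ b) = b - a := by
      intro a b hab
      rw [dist_eq, e2, e2, ← norm_prefixElement_inv_mul x₂ hab, mul_inv_rev, mul_assoc,
        inv_mul_cancel_left]
    have d12 : ∀ a b : ℕ, Γ.T₀.dist (ρ₁ a) (ρ₂ b) = a + b := by
      intro a b
      rw [dist_eq, e1, e2, ← norm_inv_mul_of_ne hne, mul_inv_rev, mul_assoc, inv_mul_cancel_left]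
    have hcomm : ∀ r s, Γ.T₀.dist r s = Γ.T₀.dist s r := fun r s => SimpleGraph.dist_comm
    have hz0 : ρ₁ 0 = ρ₂ 0 := by
      apply TreeVertex.elt_injective
      rw [e1, e2, Boundary.prefixElement_eq_mk, Boundary.prefixElement_eq_mk]
      simp
    have hz1 : ρ₂ 0 = p := by
      apply TreeVertex.elt_injective
      rw [e2, Boundary.prefixElement_eq_mk]
      simp [← FreeGroup.one_eq_mk]
    let γ : ℤ → Γ.TreeVertex Γ.x₀ := fun i => if 0 ≤ i then ρ₂ i.toNat else ρ₁ (-i).toNat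
    have hγ : ∀ i j : ℤ, i ≤ j → Γ.T₀.dist (γ i) (γ j) = (i - j).natAbs := by
      intro i j hij
      simp only [γ]
      split_ifs with ha hb hb
      · rw [d22 _ _ (by omega)]; omega
      · omega
      · rw [d12]; omega
      · rw [hcomm, d11 _ _ (by omega)]; omega
    refine ⟨γ, ⟨fun i j => ?_, ?_, ?_⟩, 0, w.norm, by positivity, ?_, ?_⟩
    · rcases le_total i j with h | h
      · exact hγ i j h
      · rw [hcomm, hγ j i h]; omega
    · convert f1 using 1
      funext n
      rcases n with _ | n
      · simp [γ, hz0]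
      · have h3 : ¬ (0 : ℤ) ≤ -((n + 1 : ℕ) : ℤ) := by omega
        simp only [γ, if_neg h3]
        congr 1
    · convert f2 using 1
      funext n
      simp [γ]
    · simp [γ, hz1]
    · apply TreeVertex.elt_injective
      have : γ (w.norm : ℤ) = ρ₂ w.norm := by simp [γ]
      rw [this, e2, Boundary.prefixElement_eq_mk, hpre, FreeGroup.mk_toWord, hw,
        mul_inv_cancel_left]

theorem doubleAct_preimage_cylinder {g : FreeGroup A} {p q p' q' : Γ.TreeVertex Γ.x₀}
    (hpq : p ≠ q) (hp : p'.elt = Γ.emb g⁻¹ * p.elt) (hq : q'.elt = Γ.emb g⁻¹ * q.elt) :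
    doubleAct g ⁻¹' Γ.cylinder p q = Γ.cylinder p' q' := by
  have hpq' : p' ≠ q' := by
    rintro rfl
    rw [hp] at hq
    exact hpq (TreeVertex.elt_injective (mul_left_cancel hq))
  have e : ∀ (r r' : Γ.TreeVertex Γ.x₀) x, r'.elt = Γ.emb g⁻¹ * r.elt →
      boundaryAct r.elt⁻¹ (Γ.bd (boundaryAct g x)) = boundaryAct r'.elt⁻¹ (Γ.bd x) := by
    intro r r' x hr
    rw [bd, boundaryMap_boundaryAct, ← boundaryAct_mul, hr]
    simp
  ext z
  rw [Set.mem_preimage, mem_cylinder_iff hpq, mem_cylinder_iff hpq', doubleAct, e p p' _ hp,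
    e q q' _ hq, hp, hq]
  simp [mul_assoc]

/-- Rooted cylinders are cylinders of the covering tree. -/
theorem rootedCylinder_eq_cylinder {p q : Γ.TreeVertex Γ.x₀} (hpq : p ≠ q)
    (hl : p.elt.norm = q.elt.norm) :
    rootedCylinder Γ.emb_injective p.elt.toWord q.elt.toWord = Γ.cylinder p q := by
  have hne : p.elt ≠ q.elt := fun h => hpq (TreeVertex.elt_injective h)
  ext z
  have e1 := pre_norm_eq_iff p.elt (Γ.bd z.1.1)
  have e2 := pre_norm_eq_iff q.elt (Γ.bd z.1.2)
  have key : ∀ (P Q : FreeGroup Γ.PosEdge) (x : Boundary Γ.PosEdge), P.norm = Q.norm → P ≠ Q →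
      ((∀ l ∈ (P⁻¹ * Q).toWord.head?, x.1 0 ≠ l) ↔
        ∀ m ∈ P.toWord.getLast?, x.1 0 ≠ invLetter m) := by
    intro P Q x h1 h2
    rw [head_inv_mul h1 h2]
    rcases P.toWord.getLast? with _ | m <;> simp
  rw [mem_cylinder_iff hpq, key _ _ _ hl hne, key _ _ _ hl.symm hne.symm, ← e1, ← e2]
  exact Iff.rfl

/-- A nonempty rooted cylinder is the cylinder of the segment between the vertices represented by
its two words. -/
theorem rootedCylinder_cases {D : Set (DoubleBoundary A)}
    (hD : D ∈ rootedCylinders Γ.emb_injective) :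
    D = ∅ ∨ ∃ p q : Γ.TreeVertex Γ.x₀, p ≠ q ∧ D = Γ.cylinder p q := by
  obtain ⟨a, b, hl, hab, rfl⟩ := hD
  rcases Set.eq_empty_or_nonempty (rootedCylinder Γ.emb_injective a b) with h | ⟨z, h1, h2⟩
  · exact Or.inl h
  right
  obtain ⟨o, ho⟩ := exists_treeVertex (Γ.isPathElement_emb 1)
  rw [map_one] at ho
  obtain ⟨ρ₁, e1, -⟩ := exists_ray o z.1.1
  obtain ⟨ρ₂, e2, -⟩ := exists_ray o z.1.2
  have h3 : (ρ₁ a.length).elt.toWord = a := by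
    rw [e1, ho, one_mul, inv_one, boundaryAct_one, Boundary.toWord_prefixElement]
    exact h1
  have h4 : (ρ₂ b.length).elt.toWord = b := by
    rw [e2, ho, one_mul, inv_one, boundaryAct_one, Boundary.toWord_prefixElement]
    exact h2
  have hne : ρ₁ a.length ≠ ρ₂ b.length := by
    intro h
    rw [h, h4] at h3
    exact hab h3.symm
  refine ⟨_, _, hne, ?_⟩
  rw [← rootedCylinder_eq_cylinder hne (by rw [FreeGroup.norm, FreeGroup.norm, h3, h4, hl]), h3, h4]

end Chart

/-! ### Axes of cyclically reduced words -/

section Periodic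

variable {B : Type*}

theorem isCyclicallyReduced_iff {C : List (B × Bool)} :
    FreeGroup.IsCyclicallyReduced C ↔
      FreeGroup.IsReduced C ∧ ∀ a ∈ C.getLast?, ∀ b ∈ C.head?, b ≠ invLetter a := by
  rw [FreeGroup.isCyclicallyReduced_iff]
  simp only [ne_invLetter_iff]

/-- The infinite periodic word `C C C …`. -/
def periodic (C : List (B × Bool)) (hC : FreeGroup.IsCyclicallyReduced C) (h0 : C ≠ []) :
    Boundary B :=
  Boundary.ofFun (fun i => C[i % C.length]'(Nat.mod_lt _ (List.length_pos_iff.2 h0))) (by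
    intro i
    have hl : 0 < C.length := List.length_pos_iff.2 h0
    obtain ⟨h1, h2⟩ := isCyclicallyReduced_iff.1 hC
    rw [isReduced_iff, List.isChain_iff_getElem] at h1
    have hlt : i % C.length < C.length := Nat.mod_lt _ hl
    by_cases h : i % C.length + 1 < C.length
    · have e : (i + 1) % C.length = i % C.length + 1 := by
        rw [Nat.add_mod, Nat.mod_eq_of_lt (show 1 < C.length by omega), Nat.mod_eq_of_lt h]
      simp only [e]
      exact h1 _ h
    · have e1 : i % C.length = C.length - 1 := by omega
      have e : (i + 1) % C.length = 0 := by
        have h3 := Nat.div_add_mod i C.length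
        have h4 : i + 1 = C.length * (i / C.length + 1) := by rw [mul_add]; omega
        rw [h4, Nat.mul_mod_right]
      simp only [e, e1]
      refine h2 _ ?_ _ ?_
      · rw [List.getLast?_eq_getElem?, List.getElem?_eq_getElem (by omega)]; rfl
      · rw [List.head?_eq_getElem?, List.getElem?_eq_getElem hl]; rfl)

variable {C : List (B × Bool)} (hC : FreeGroup.IsCyclicallyReduced C) (h0 : C ≠ [])

theorem periodic_apply (i : ℕ) : (periodic C hC h0).1 i =
    C[i % C.length]'(Nat.mod_lt _ (List.length_pos_iff.2 h0)) := rfl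

theorem shift_periodic_mul_add (m i : ℕ) :
    (periodic C hC h0).shift (m * C.length + i) = (periodic C hC h0).shift i := by
  apply Subtype.ext
  funext j
  change (periodic C hC h0).1 _ = (periodic C hC h0).1 _
  rw [periodic_apply, periodic_apply]
  congr 1
  rw [add_assoc, Nat.mul_add_mod_self_right]

theorem shift_periodic_mul (m : ℕ) :
    (periodic C hC h0).shift (m * C.length) = periodic C hC h0 := by
  have := shift_periodic_mul_add hC h0 m 0
  rw [add_zero] at this
  rw [this]
  apply Subtype.ext
  funext j
  simp [Boundary.shift]

theorem pre_periodic_length : (periodic C hC h0).pre C.length = C := by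
  rw [Boundary.pre_eq_iff]
  intro i hi
  rw [periodic_apply]
  congr 1
  exact Nat.mod_eq_of_lt hi

theorem prefixElement_add (x : Boundary B) (n k : ℕ) :
    x.prefixElement (n + k) = x.prefixElement n * (x.shift n).prefixElement k := by
  rw [Boundary.prefixElement_eq_mk, Boundary.prefixElement_eq_mk, Boundary.prefixElement_eq_mk,
    FreeGroup.mul_mk, Boundary.pre_add]

theorem prefixElement_succ (x : Boundary B) (n : ℕ) :
    x.prefixElement (n + 1) = x.prefixElement n * FreeGroup.mk [x.1 n] := by
  rw [Boundary.prefixElement_eq_mk, Boundary.prefixElement_eq_mk, FreeGroup.mul_mk,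
    Boundary.pre_succ]

theorem prefixElement_periodic_mul (m : ℕ) :
    (periodic C hC h0).prefixElement (m * C.length) = FreeGroup.mk C ^ m := by
  induction m with
  | zero => simp [Boundary.prefixElement_eq_mk, ← FreeGroup.one_eq_mk]
  | succ m ih =>
    rw [add_mul, one_mul, prefixElement_add, ih, shift_periodic_mul, pow_succ,
      Boundary.prefixElement_eq_mk, pre_periodic_length]

theorem prefixElement_periodic_mul_add (m i : ℕ) :
    (periodic C hC h0).prefixElement (m * C.length + i) =
      FreeGroup.mk C ^ m * (periodic C hC h0).prefixElement i := by
  rw [prefixElement_add, prefixElement_periodic_mul, shift_periodic_mul]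

theorem invRev_ne_nil (h0 : C ≠ []) : FreeGroup.invRev C ≠ [] := by
  simpa [FreeGroup.invRev] using h0

theorem head_invRev (L : List (B × Bool)) :
    (FreeGroup.invRev L).head? = L.getLast?.map invLetter := by
  rw [FreeGroup.invRev, List.head?_reverse, List.getLast?_map]
  rfl

theorem isCyclicallyReduced_invRev (hC : FreeGroup.IsCyclicallyReduced C) :
    FreeGroup.IsCyclicallyReduced (FreeGroup.invRev C) := by
  classical
  rw [isCyclicallyReduced_iff] at hC ⊢
  refine ⟨?_, ?_⟩
  · rw [← toWord_mk_of_isReduced hC.1, ← FreeGroup.toWord_inv]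
    exact FreeGroup.isReduced_toWord
  · intro a ha b hb
    rw [getLast_invRev] at ha
    rw [head_invRev] at hb
    obtain ⟨a', ha', rfl⟩ := Option.mem_map.1 ha
    obtain ⟨b', hb', rfl⟩ := Option.mem_map.1 hb
    rw [invLetter_invLetter]
    exact fun h => hC.2 b' hb' a' ha' h.symm

/-- The opposite end of the axis. -/
def periodicInv (C : List (B × Bool)) (hC : FreeGroup.IsCyclicallyReduced C) (h0 : C ≠ []) :
    Boundary B :=
  periodic (FreeGroup.invRev C) (isCyclicallyReduced_invRev hC) (invRev_ne_nil h0)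

theorem periodicInv_zero_ne : (periodicInv C hC h0).1 0 ≠ (periodic C hC h0).1 0 := by
  have hl : 0 < C.length := List.length_pos_iff.2 h0
  have e1 : (periodicInv C hC h0).1 0 = invLetter (C.getLast h0) := by
    have : (periodicInv C hC h0).1 0 ∈ (FreeGroup.invRev C).head? := by
      rw [List.head?_eq_getElem?, List.getElem?_eq_getElem (by simpa using hl)]
      simp [periodicInv, periodic_apply]
    rw [head_invRev, List.getLast?_eq_some_getLast h0] at this
    exact (Option.some.inj this).symm
  have e2 : (periodic C hC h0).1 0 = C.head h0 := by
    rw [periodic_apply, List.head_eq_getElem]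
    congr 1
  rw [e1, e2]
  exact ((isCyclicallyReduced_iff.1 hC).2 _ (List.getLast?_eq_some_getLast h0) _
    (List.head?_eq_some_head h0)).symm

/-- Read backwards from any period, the positive end of the axis spells the negative end. -/
theorem periodicInv_apply {m j : ℕ} (hj : j < m * C.length) :
    (periodicInv C hC h0).1 j = invLetter ((periodic C hC h0).1 (m * C.length - 1 - j)) := by
  have hl : 0 < C.length := List.length_pos_iff.2 h0
  have hlt : j % C.length < C.length := Nat.mod_lt _ hl
  have e : (m * C.length - 1 - j) % C.length = C.length - 1 - j % C.length := by
    have h1 := Nat.div_add_mod j C.length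
    have h2 : j / C.length < m := (Nat.div_lt_iff_lt_mul hl).2 hj
    obtain ⟨d, rfl⟩ := Nat.exists_eq_add_of_lt h2
    have h3 : (j / C.length + d + 1) * C.length - 1 - j =
        d * C.length + (C.length - 1 - j % C.length) := by
      have : (j / C.length + d + 1) * C.length =
          C.length * (j / C.length) + d * C.length + C.length := by ring
      omega
    rw [h3, Nat.mul_add_mod_self_right, Nat.mod_eq_of_lt (by omega)]
  simp only [periodicInv, periodic_apply, e, FreeGroup.invRev, List.length_reverse, List.length_map,
    List.getElem_reverse, List.getElem_map]
  rfl

theorem prefixElement_mul_prefixElement_inv (m : ℕ) {j : ℕ} (hj : j ≤ m * C.length) :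
    (periodic C hC h0).prefixElement (m * C.length) * (periodicInv C hC h0).prefixElement j =
      (periodic C hC h0).prefixElement (m * C.length - j) := by
  induction j with
  | zero => simp [Boundary.prefixElement_eq_mk, ← FreeGroup.one_eq_mk]
  | succ j ih =>
    obtain ⟨i, hi⟩ : ∃ i, m * C.length - j = i + 1 := ⟨m * C.length - j - 1, by omega⟩
    have hi' : m * C.length - (j + 1) = i := by omega
    have hi2 : m * C.length - 1 - j = i := by omega
    have ih' := ih (show j ≤ m * C.length by omega)
    rw [prefixElement_succ, ← mul_assoc, ih', hi, hi', prefixElement_succ,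
      periodicInv_apply hC h0 (m := m) (by omega), hi2, mul_assoc, mk_singleton_mul_invLetter,
      mul_one]

variable [DecidableEq B]

theorem boundaryAct_prefixElement_inv (x : Boundary B) (n : ℕ) :
    boundaryAct (x.prefixElement n)⁻¹ x = x.shift n := by
  have := shift_eq_boundaryAct (f := x.prefixElement n) (x := x) (by simp)
  rwa [Boundary.norm_prefixElement] at this

theorem boundaryAct_pow_periodic (m : ℕ) :
    boundaryAct (FreeGroup.mk C ^ m) (periodic C hC h0) = periodic C hC h0 := by
  have h1 := boundaryAct_prefixElement_inv (periodic C hC h0) (m * C.length)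
  rw [prefixElement_periodic_mul, shift_periodic_mul] at h1
  conv_lhs => rw [← h1]
  rw [boundaryAct_self_inv]

theorem boundaryAct_zpow_periodic (m : ℤ) :
    boundaryAct (FreeGroup.mk C ^ m) (periodic C hC h0) = periodic C hC h0 := by
  rcases m with m | m
  · simpa using boundaryAct_pow_periodic hC h0 m
  · rw [zpow_negSucc]
    conv_lhs => rw [← boundaryAct_pow_periodic hC h0 (m + 1)]
    rw [boundaryAct_inv_self]

theorem boundaryAct_zpow_periodicInv (m : ℤ) :
    boundaryAct (FreeGroup.mk C ^ m) (periodicInv C hC h0) = periodicInv C hC h0 := by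
  have := boundaryAct_zpow_periodic (isCyclicallyReduced_invRev hC) (invRev_ne_nil h0) (-m)
  rw [← FreeGroup.inv_mk, zpow_neg, inv_zpow, _root_.inv_inv] at this
  exact this

theorem convergesTo_pow_periodic :
    ConvergesTo (fun n => FreeGroup.mk C ^ n) (periodic C hC h0) := by
  have h1 : Tendsto (fun n => n * C.length) atTop atTop :=
    tendsto_id.atTop_mul_const' (List.length_pos_iff.2 h0)
  have h2 := (convergesTo_prefixElement (periodic C hC h0)).comp h1
  simpa only [prefixElement_periodic_mul] using h2

/-- The axis of `C`, translated by `k`, passes through `1` in the direction of the word `v`. -/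
def AxisReads (k : FreeGroup B) (v : List (B × Bool)) : Prop :=
  (∀ l ∈ v.head?, (boundaryAct k (periodicInv C hC h0)).1 0 ≠ l) ∧
    (boundaryAct k (periodic C hC h0)).pre v.length = v

theorem axisReads_mul_zpow (k : FreeGroup B) (v : List (B × Bool)) (m : ℤ) :
    AxisReads hC h0 (k * FreeGroup.mk C ^ m) v ↔ AxisReads hC h0 k v := by
  rw [AxisReads, AxisReads, boundaryAct_mul, boundaryAct_mul, boundaryAct_zpow_periodic,
    boundaryAct_zpow_periodicInv]

theorem axisReads_of_shift {i : ℕ} {v : List (B × Bool)}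
    (h : ((periodic C hC h0).shift i).pre v.length = v) :
    AxisReads hC h0 ((periodic C hC h0).prefixElement i)⁻¹ v := by
  set Y := periodic C hC h0
  have hv0 : ∀ l ∈ v.head?, Y.1 i = l := by
    intro l hl
    rw [← h] at hl
    have := head_pre hl
    simpa [Boundary.shift] using this
  refine ⟨fun l hl => ?_, by rw [boundaryAct_prefixElement_inv]; exact h⟩
  rw [← hv0 l hl]
  rcases i with _ | i
  · have e : (Y.prefixElement 0)⁻¹ = 1 := by
      simp [Boundary.prefixElement_eq_mk, ← FreeGroup.one_eq_mk]
    rw [e, boundaryAct_one]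
    exact periodicInv_zero_ne hC h0
  · have hhead : invLetter (Y.1 i) ∈ ((Y.prefixElement (i + 1))⁻¹).toWord.head? := by
      rw [FreeGroup.toWord_inv, head_invRev, Boundary.toWord_prefixElement, Boundary.pre_succ]
      simp
    rw [boundaryAct_zero_of_not_pre hhead]
    · exact (Y.ne_invLetter i).symm
    · rw [_root_.inv_inv, FreeGroup.norm_inv_eq, Boundary.norm_prefixElement,
        Boundary.toWord_prefixElement, Boundary.pre_succ', Boundary.pre_succ']
      intro h
      exact periodicInv_zero_ne hC h0 (List.cons.inj h).1

/-- If a translate of the axis reads `v` from `1` on, then `1` is a point of this translate, and a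
power of the translation moves the corresponding point of the axis into the first period. -/
theorem AxisReads.exists_shift {k : FreeGroup B} {v : List (B × Bool)} (hv : v ≠ [])
    (h : AxisReads hC h0 k v) : ∃ i, i < C.length ∧ ∃ m : ℤ,
      k * FreeGroup.mk C ^ m = ((periodic C hC h0).prefixElement i)⁻¹ ∧
      ((periodic C hC h0).shift i).pre v.length = v := by
  set Y := periodic C hC h0 with hY
  have hl : 0 < C.length := List.length_pos_iff.2 h0
  -- the statement for `k` a prefix of the positive end of the axis
  have key : ∀ k, AxisReads hC h0 k v → ∀ j, k⁻¹ = Y.prefixElement j → ∃ i, i < C.length ∧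
      ∃ m : ℤ, k * FreeGroup.mk C ^ m = (Y.prefixElement i)⁻¹ ∧
      (Y.shift i).pre v.length = v := by
    intro k hk j hj
    have hk' : k = (Y.prefixElement j)⁻¹ := by rw [← hj, _root_.inv_inv]
    have e := prefixElement_periodic_mul_add hC h0 (j / C.length) (j % C.length)
    have e2 := shift_periodic_mul_add hC h0 (j / C.length) (j % C.length)
    rw [Nat.div_add_mod'] at e e2
    refine ⟨j % C.length, Nat.mod_lt _ hl, (j / C.length : ℕ), ?_, ?_⟩
    · rw [hk', hY, e, zpow_natCast]
      group
    · have h2 := hk.2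
      rw [hk', boundaryAct_prefixElement_inv, hY, e2] at h2
      exact h2
  by_cases h1 : Y.pre k.norm = (k⁻¹).toWord
  · refine key k h k.norm ?_
    rw [Boundary.prefixElement_eq_mk, h1, FreeGroup.mk_toWord]
  · obtain ⟨l, hlk⟩ : ∃ l, l ∈ k.toWord.head? := by
      rcases hw : k.toWord with _ | ⟨l, L⟩
      · exfalso
        apply h1
        rw [FreeGroup.toWord_inv, FreeGroup.norm, hw]
        simp [FreeGroup.invRev]
      · exact ⟨l, rfl⟩
    have e1 := boundaryAct_zero_of_not_pre hlk h1
    have h2 : (periodicInv C hC h0).pre k.norm = (k⁻¹).toWord := by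
      by_contra h2
      have e2 := boundaryAct_zero_of_not_pre hlk h2
      obtain ⟨n, hn⟩ := Nat.exists_eq_succ_of_ne_zero (List.length_pos_iff.2 hv).ne'
      have e3 : (boundaryAct k Y).1 0 ∈ v.head? := by
        rw [← h.2, hn, Boundary.pre_succ']
        rfl
      exact h.1 _ e3 (e2.trans e1.symm)
    have hk : k⁻¹ = (periodicInv C hC h0).prefixElement k.norm := by
      rw [Boundary.prefixElement_eq_mk, h2, FreeGroup.mk_toWord]
    have h3 := (axisReads_mul_zpow hC h0 k v (-(k.norm : ℤ))).2 h
    obtain ⟨i, hi, m, h4, h5⟩ := key _ h3 (k.norm * C.length - k.norm) (by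
      rw [← prefixElement_mul_prefixElement_inv hC h0 _ (Nat.le_mul_of_pos_right _ hl),
        prefixElement_periodic_mul, ← hk]
      simp)
    exact ⟨i, hi, -(k.norm : ℤ) + m, by rw [zpow_add, ← mul_assoc]; exact h4, h5⟩

/-- Distinct positions in the first period are not equivalent under the translation. -/
theorem eq_of_prefixElement_inv_mul_zpow {i j : ℕ} (hi : i < C.length) (hj : j < C.length) {m : ℤ}
    (h : ((periodic C hC h0).prefixElement i)⁻¹ * FreeGroup.mk C ^ m =
      ((periodic C hC h0).prefixElement j)⁻¹) : i = j := by
  have key : ∀ i j (m : ℕ), i < C.length → (periodic C hC h0).prefixElement i =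
      FreeGroup.mk C ^ m * (periodic C hC h0).prefixElement j → i = j := by
    intro i j m hi h
    rw [← prefixElement_periodic_mul_add] at h
    have h1 := congrArg FreeGroup.norm h
    rw [Boundary.norm_prefixElement, Boundary.norm_prefixElement] at h1
    rcases m with _ | m
    · simpa using h1
    · rw [add_mul] at h1; omega
  have h' : (periodic C hC h0).prefixElement i =
      FreeGroup.mk C ^ m * (periodic C hC h0).prefixElement j := by
    rw [inv_mul_eq_iff_eq_mul] at h
    rw [h, inv_mul_cancel_right]
  rcases m with m | m
  · exact key i j m hi (by simpa using h')
  · refine (key j i (m + 1) hj ?_).symm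
    rw [h', zpow_negSucc, mul_inv_cancel_left]

end Periodic

/-! ### Counting currents on cylinders -/

section Counting

open Classical in
/-- The number of occurrences of `v` in the cyclic word `w`. -/
noncomputable def cyclicCount {E : Type*} (w v : List E) : ℕ :=
  ((Finset.range w.length).filter fun i => ∀ j < v.length, w[(i + j) % w.length]? = v[j]?).card

namespace Chart

open SerreGraph

variable {A V E : Type*} [Fintype A] {Γ : Chart A V E}

theorem _root_.GraphWalk.SerreGraph.IsReducedPath.invPath {v : List E} (hv : Γ.IsReducedPath v) :
    Γ.IsReducedPath (Γ.invPath v) := by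
  rcases v with _ | ⟨e, l⟩
  · exact List.isChain_nil
  apply hv.isPath.invPath.isReducedPath
  have h1 : (Γ.word (Γ.invPath (e :: l))).toWord = FreeGroup.invRev (Γ.word (e :: l)).toWord := by
    rw [word_invPath, FreeGroup.toWord_inv]
  rw [toWord_word hv] at h1
  have h2 : (Γ.invPath (e :: l)).map Γ.letter = FreeGroup.invRev ((e :: l).map Γ.letter) := by
    rw [FreeGroup.invRev, SerreGraph.invPath, List.map_reverse, List.map_map, List.map_map]
    congr 2
    funext f
    exact Γ.letter_inv f
  rw [h2, ← h1]
  exact FreeGroup.isReduced_toWord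

theorem _root_.GraphWalk.SerreGraph.IsLift.invPath {v : List E} {p q : Γ.TreeVertex Γ.x₀}
    (h : Γ.IsLift p v q) : Γ.IsLift q (Γ.invPath v) p := by
  obtain ⟨y, hy⟩ := p.exists_isPathElement
  obtain ⟨hqv, y', hvy⟩ := h.elt_eq hy
  have hq : Γ.IsPathElement Γ.x₀ q.elt y' := by
    rw [hqv]
    exact hy.mul hvy.isPathElement
  refine isLift_of_elt_eq ?_ hq hvy.invPath
  rw [hqv, word_invPath, mul_inv_cancel_right]

theorem _root_.GraphWalk.SerreGraph.IsLift.ne {v : List E} {p q : Γ.TreeVertex Γ.x₀}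
    (h : Γ.IsLift p v q) (hv0 : v ≠ []) (hv : Γ.IsReducedPath v) : p ≠ q := by
  obtain ⟨y, hy⟩ := p.exists_isPathElement
  obtain ⟨hqv, y', hvy⟩ := h.elt_eq hy
  rintro rfl
  have h1 : Γ.word v = 1 := by simpa using hqv
  have h2 := toWord_word hv
  rw [h1, FreeGroup.toWord_one] at h2
  exact hv0 (List.map_eq_nil_iff.1 h2.symm)

theorem isCyclicallyReduced_map_letter {e : E} {l : List E}
    (hc : Γ.IsReducedPath (e :: l ++ [e])) :
    FreeGroup.IsCyclicallyReduced ((e :: l).map Γ.letter) := by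
  have h := List.isChain_append.1 hc
  rw [isCyclicallyReduced_iff]
  refine ⟨isReduced_map_letter h.1, ?_⟩
  intro a ha b hb
  rw [List.getLast?_map] at ha
  obtain ⟨f, hf, rfl⟩ := Option.mem_map.1 ha
  have hb : Γ.letter e = b := by simpa using hb
  have h1 := (h.2.2 f hf e rfl).2
  rw [← hb, ← letter_inv]
  exact fun h' => h1 (Γ.letter.injective h')

theorem isPathElement_prefixElement_periodic {e : E} {l : List E}
    (hc : Γ.IsReducedPath (e :: l ++ [e])) (i : ℕ) :
    Γ.IsPathElement (Γ.o e) ((periodic ((e :: l).map Γ.letter)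
      (isCyclicallyReduced_map_letter hc) (by simp)).prefixElement i)
      (Γ.o (Γ.letter.symm ((periodic ((e :: l).map Γ.letter)
      (isCyclicallyReduced_map_letter hc) (by simp)).1 i))) := by
  set Y := periodic ((e :: l).map Γ.letter) (isCyclicallyReduced_map_letter hc) (by simp) with hY
  have hval : ∀ i, Γ.letter.symm (Y.1 i) =
      (e :: l)[i % (e :: l).length]'(Nat.mod_lt _ (by simp)) := by
    intro i
    rw [hY, periodic_apply, Equiv.symm_apply_eq, List.getElem_map]
    simp only [List.length_map]
  have hstep : ∀ i, Γ.t (Γ.letter.symm (Y.1 i)) = Γ.o (Γ.letter.symm (Y.1 (i + 1))) := by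
    intro i
    rw [hval, hval]
    set n := (e :: l).length with hn
    have hn0 : 0 < n := by simp [hn]
    have hlt : i % n < n := Nat.mod_lt _ hn0
    have hch := List.isChain_iff_getElem.1 hc (i % n) (by simp [hn] at hlt ⊢; omega)
    have e1 : (e :: l ++ [e])[i % n]'(by simp [hn] at hlt ⊢; omega) = (e :: l)[i % n] :=
      List.getElem_append_left _
    rw [e1] at hch
    by_cases h : i % n + 1 < n
    · have e3 : (i + 1) % n = i % n + 1 := by
        rw [Nat.add_mod, Nat.mod_eq_of_lt (show 1 < n by omega), Nat.mod_eq_of_lt h]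
      have e2 : (e :: l ++ [e])[i % n + 1]'(by simp [hn] at hlt ⊢; omega) =
          (e :: l)[i % n + 1] := List.getElem_append_left _
      rw [e2] at hch
      rw [hch.1]
      congr 1
      exact getElem_congr_idx e3.symm
    · have e4 : i % n + 1 = n := by omega
      have e3 : (i + 1) % n = 0 := by
        have h3 := Nat.div_add_mod i n
        have h4 : i + 1 = n * (i / n + 1) := by rw [mul_add]; omega
        rw [h4, Nat.mul_mod_right]
      have e2 : (e :: l ++ [e])[i % n + 1]'(by simp [hn] at hlt ⊢; omega) = e := by
        rw [List.getElem_append_right (by omega)]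
        simp
      rw [e2] at hch
      rw [hch.1]
      congr 1
      rw [getElem_congr_idx e3, List.getElem_cons_zero]
  induction i with
  | zero =>
    have e0 : Γ.letter.symm (Y.1 0) = e := by
      rw [hval]
      simp
    rw [e0, Boundary.prefixElement_eq_mk, Boundary.pre_zero, ← FreeGroup.one_eq_mk]
    exact isPathElement_one _
  | succ i ih =>
    rw [prefixElement_succ]
    refine ih.mul ?_
    have : FreeGroup.mk [Y.1 i] = Γ.word [Γ.letter.symm (Y.1 i)] := by simp [word]
    rw [this, ← hstep]
    exact IsPath.isPathElement ⟨rfl, rfl⟩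

theorem isClopen_setOf_forall_letter_ne (o : Option (Γ.PosEdge × Bool)) :
    IsClopen {x : Boundary Γ.PosEdge | ∀ l ∈ o, x.1 0 ≠ l} := by
  rcases o with _ | l
  · simp [isClopen_univ]
  · have : {x : Boundary Γ.PosEdge | ∀ l' ∈ some l, x.1 0 ≠ l'} =
        {x : Boundary Γ.PosEdge | x.pre 1 = [l]}ᶜ := by
      ext x
      simp [Boundary.pre_succ']
    rw [this]
    exact (isClopen_setOf_pre_eq 1 [l]).compl

variable [DecidableEq A]

/-- The attracting pole of a conjugate `d C d⁻¹` is the translate by `d` of the periodic word of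
`C`. -/
theorem bd_pole {g : FreeGroup A} (hg : g ≠ 1) {d : FreeGroup Γ.PosEdge}
    {C : List (Γ.PosEdge × Bool)} (hC : FreeGroup.IsCyclicallyReduced C) (h0 : C ≠ [])
    (h : Γ.emb g = d * FreeGroup.mk C * d⁻¹) :
    Γ.bd (pole g hg) = boundaryAct d (periodic C hC h0) := by
  have hpole : ConvergesTo (fun n => g ^ n) (pole g hg) :=
    Classical.choose_spec (exists_limit_pow hg)
  refine boundaryMap_eq Γ.emb_injective hpole (C := g.norm) (fun n => ?_) ?_
  · rw [pow_succ, inv_mul_cancel_left]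
  · have h1 := ((convergesTo_pow_periodic hC h0).mul_left d).of_dist_le (C := d.norm)
      (v := fun n => Γ.emb (g ^ n)) fun n => by
        rw [map_pow, h, conj_pow, inv_mul_cancel_left, FreeGroup.norm_inv_eq]
    exact h1

/-- A translate of the axis of `g` passes through `[p, q]` if and only if the corresponding
translate of the periodic word reads the word of the segment. -/
theorem doubleAct_poles_mem_cylinder_iff {g : FreeGroup A} (hg : g ≠ 1)
    {d : FreeGroup Γ.PosEdge} {C : List (Γ.PosEdge × Bool)}
    (hC : FreeGroup.IsCyclicallyReduced C) (h0 : C ≠ [])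
    (h : Γ.emb g = d * FreeGroup.mk C * d⁻¹) {p q : Γ.TreeVertex Γ.x₀} (hpq : p ≠ q)
    (a : FreeGroup A) : doubleAct a (poles g hg) ∈ Γ.cylinder p q ↔
      AxisReads hC h0 (p.elt⁻¹ * Γ.emb a * d) (p.elt⁻¹ * q.elt).toWord := by
  have h1 := bd_pole hg hC h0 h
  have h2 : Γ.bd (pole g⁻¹ (inv_ne_one.2 hg)) = boundaryAct d (periodicInv C hC h0) := by
    refine bd_pole (inv_ne_one.2 hg) (isCyclicallyReduced_invRev hC) (invRev_ne_nil h0) ?_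
    rw [map_inv, h, ← FreeGroup.inv_mk]
    group
  have e : ∀ x, Γ.bd (boundaryAct a x) = boundaryAct (Γ.emb a) (Γ.bd x) :=
    boundaryMap_boundaryAct Γ.emb_injective a
  rw [mem_cylinder_iff hpq, AxisReads]
  have e1 : boundaryAct p.elt⁻¹ (Γ.bd (doubleAct a (poles g hg)).1.1) =
      boundaryAct (p.elt⁻¹ * Γ.emb a * d) (periodicInv C hC h0) := by
    rw [boundaryAct_mul, boundaryAct_mul, ← h2, ← e]
    rfl
  have e2 : Γ.bd (doubleAct a (poles g hg)).1.2 =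
      boundaryAct (Γ.emb a * d) (periodic C hC h0) := by
    rw [boundaryAct_mul, ← h1, ← e]
    rfl
  rw [e1, e2]
  refine and_congr Iff.rfl ?_
  set w := p.elt⁻¹ * q.elt with hw
  have hq : q.elt⁻¹ * p.elt = w⁻¹ := by rw [hw]; group
  have h3 := pre_norm_eq_iff w (boundaryAct (p.elt⁻¹ * Γ.emb a * d) (periodic C hC h0))
  have e3 : boundaryAct w⁻¹ (boundaryAct (p.elt⁻¹ * Γ.emb a * d) (periodic C hC h0)) =
      boundaryAct q.elt⁻¹ (boundaryAct (Γ.emb a * d) (periodic C hC h0)) := by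
    rw [← boundaryAct_mul, ← boundaryAct_mul, ← hq]
    congr 1
    group
  rw [e3] at h3
  rw [hq, FreeGroup.toWord_inv, head_invRev]
  refine Iff.trans ?_ h3.symm
  rcases w.toWord.getLast? with _ | m <;> simp

theorem isClopen_cylinder {p q : Γ.TreeVertex Γ.x₀} (hpq : p ≠ q) :
    IsClopen (Γ.cylinder p q) := by
  have h1 := continuous_boundaryMap Γ.emb_injective
  have h2 : Γ.cylinder p q =
      {z | ∀ l ∈ (p.elt⁻¹ * q.elt).toWord.head?, (boundaryAct p.elt⁻¹ (Γ.bd z.1.1)).1 0 ≠ l} ∩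
      {z | ∀ l ∈ (q.elt⁻¹ * p.elt).toWord.head?, (boundaryAct q.elt⁻¹ (Γ.bd z.1.2)).1 0 ≠ l} := by
    ext z
    exact mem_cylinder_iff hpq z
  rw [h2]
  exact ((isClopen_setOf_forall_letter_ne _).preimage ((continuous_boundaryAct _).comp
      (h1.comp (continuous_fst.comp isOpenEmbedding_val.continuous)))).inter
    ((isClopen_setOf_forall_letter_ne _).preimage ((continuous_boundaryAct _).comp
      (h1.comp (continuous_snd.comp isOpenEmbedding_val.continuous))))

open Classical in
/-- The number of translates of the axis of `g` that pass through a given lift of `v`. -/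
theorem tsum_indicator_cylinder {g : FreeGroup A} (hg : g ≠ 1) {d : FreeGroup Γ.PosEdge}
    {e : E} {l : List E} (hc : Γ.IsReducedPath (e :: l ++ [e]))
    (hd : Γ.IsPathElement Γ.x₀ d (Γ.o e)) (h : Γ.emb g = d * Γ.word (e :: l) * d⁻¹)
    {v : List E} (hv0 : v ≠ []) (hv : Γ.IsReducedPath v) {p q : Γ.TreeVertex Γ.x₀}
    (hlift : Γ.IsLift p v q) :
    ∑' a : FreeGroup A ⧸ Subgroup.zpowers g,
      (Γ.cylinder p q).indicator (1 : DoubleBoundary A → ℝ≥0∞) (doubleAct a.out (poles g hg)) =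
        cyclicCount (e :: l) v := by
  obtain ⟨y, hy⟩ := p.exists_isPathElement
  obtain ⟨hqv, y', hvy⟩ := hlift.elt_eq hy
  have hw : p.elt⁻¹ * q.elt = Γ.word v := by rw [hqv, inv_mul_cancel_left]
  have hword : (p.elt⁻¹ * q.elt).toWord = v.map Γ.letter := by rw [hw, toWord_word hv]
  have hmv : v.map Γ.letter ≠ [] := by simpa using hv0
  have hpq : p ≠ q := by
    rintro rfl
    rw [inv_mul_cancel, FreeGroup.toWord_one] at hword
    exact hmv hword.symm
  set C := (e :: l).map Γ.letter with hCdef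
  have hC : FreeGroup.IsCyclicallyReduced C := isCyclicallyReduced_map_letter hc
  have h0 : C ≠ [] := by simp [hCdef]
  have hlen : C.length = (e :: l).length := by simp [hCdef]
  have hg' : Γ.emb g = d * FreeGroup.mk C * d⁻¹ := h
  set Y := periodic C hC h0 with hY
  set k : FreeGroup A → FreeGroup Γ.PosEdge := fun a => p.elt⁻¹ * Γ.emb a * d with hk
  have hkz : ∀ a (m : ℤ), k (a * g ^ m) = k a * FreeGroup.mk C ^ m := by
    intro a m
    simp only [hk]
    rw [map_mul, map_zpow, hg', conj_zpow]
    group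
  have hkinj : ∀ a b, k a = k b → a = b := by
    intro a b hab
    exact Γ.emb_injective (mul_left_cancel (mul_right_cancel hab))
  have hmem : ∀ a : FreeGroup A, doubleAct a (poles g hg) ∈ Γ.cylinder p q ↔
      AxisReads hC h0 (k a) (v.map Γ.letter) := by
    intro a
    rw [doubleAct_poles_mem_cylinder_iff hg hC h0 hg' hpq, hword]
  -- the positions at which the cyclic word reads `v`
  have hpos : ∀ i, (∀ j < v.length, (e :: l)[(i + j) % (e :: l).length]? = v[j]?) ↔
      (Y.shift i).pre (v.map Γ.letter).length = v.map Γ.letter := by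
    intro i
    rw [Boundary.pre_eq_iff]
    simp only [List.length_map]
    refine forall₂_congr fun j hj => ?_
    have e1 : (Y.shift i).1 j =
        Γ.letter ((e :: l)[(i + j) % (e :: l).length]'(Nat.mod_lt _ (by simp))) := by
      change Y.1 (i + j) = _
      rw [hY, periodic_apply]
      simp only [hCdef, List.getElem_map, List.length_map]
    rw [e1, List.getElem_map, Γ.letter.injective.eq_iff, List.getElem?_eq_getElem hj,
      List.getElem?_eq_getElem (Nat.mod_lt _ (by simp)), Option.some.injEq]
  have hex : ∀ i, (Y.shift i).pre (v.map Γ.letter).length = v.map Γ.letter →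
      ∃ a, k a = (Y.prefixElement i)⁻¹ := by
    intro i hi
    obtain ⟨f, v', rfl⟩ := List.exists_cons_of_ne_nil hv0
    have h1 : Γ.letter.symm (Y.1 i) = f := by
      rw [List.map_cons, List.length_cons, Boundary.pre_succ'] at hi
      have : Y.1 i = Γ.letter f := by simpa [Boundary.shift] using (List.cons.inj hi).1
      rw [this, Equiv.symm_apply_apply]
    have h2 := isPathElement_prefixElement_periodic hc i
    rw [← hY, h1, hvy.1] at h2
    obtain ⟨a, ha⟩ := Γ.mem_range_emb.2 ((hy.mul h2.inv).mul hd.inv)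
    exact ⟨a, by simp only [hk, ha]; group⟩
  choose! a ha using hex
  set I := (Finset.range (e :: l).length).filter fun i => ∀ j < v.length,
    (e :: l)[(i + j) % (e :: l).length]? = v[j]? with hI
  have hIpos : ∀ i ∈ I, i < C.length ∧
      (Y.shift i).pre (v.map Γ.letter).length = v.map Γ.letter := by
    intro i hi
    rw [hI, Finset.mem_filter, Finset.mem_range] at hi
    exact ⟨by rw [hlen]; exact hi.1, (hpos i).1 hi.2⟩
  have hout : ∀ a : FreeGroup A, ∃ m : ℤ,
      (Quotient.out (a : FreeGroup A ⧸ Subgroup.zpowers g)) = a * g ^ m := by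
    intro a
    have h1 : (a : FreeGroup A ⧸ Subgroup.zpowers g) =
      (Quotient.out (a : FreeGroup A ⧸ Subgroup.zpowers g) : FreeGroup A) :=
      (QuotientGroup.out_eq' _).symm
    obtain ⟨m, hm⟩ := Subgroup.mem_zpowers_iff.1 (QuotientGroup.eq.1 h1)
    exact ⟨m, by rw [hm, mul_inv_cancel_left]⟩
  have hinj : Set.InjOn (fun i => (a i : FreeGroup A ⧸ Subgroup.zpowers g)) I := by
    intro i hi j hj hij
    obtain ⟨h1, h2⟩ := hIpos i hi
    obtain ⟨h3, h4⟩ := hIpos j hj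
    obtain ⟨m, hm⟩ := Subgroup.mem_zpowers_iff.1 (QuotientGroup.eq.1 hij)
    have h5 : k (a i) * FreeGroup.mk C ^ m = k (a j) := by
      rw [← hkz, hm, mul_inv_cancel_left]
    rw [ha i h2, ha j h4] at h5
    exact eq_of_prefixElement_inv_mul_zpow hC h0 h1 h3 h5
  rw [tsum_eq_sum (s := I.image fun i => (a i : FreeGroup A ⧸ Subgroup.zpowers g)),
    Finset.sum_image hinj, Finset.sum_congr rfl (g := fun _ => 1)]
  · rw [Finset.sum_const, nsmul_eq_mul, mul_one]
    rfl
  · intro i hi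
    obtain ⟨h1, h2⟩ := hIpos i hi
    obtain ⟨m, hm⟩ := hout (a i)
    rw [Set.indicator_of_mem]
    · rfl
    · rw [hm, hmem, hkz, axisReads_mul_zpow, ha i h2]
      exact axisReads_of_shift hC h0 h2
  · intro b hb
    rw [Set.indicator_of_notMem]
    intro hb'
    rw [hmem] at hb'
    obtain ⟨i, hi, m, h1, h2⟩ := hb'.exists_shift hC h0 hmv
    apply hb
    rw [Finset.mem_image]
    refine ⟨i, ?_, ?_⟩
    · rw [hI, Finset.mem_filter, Finset.mem_range]
      exact ⟨by rw [← hlen]; exact hi, (hpos i).2 h2⟩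
    · have h3 : b.out * g ^ m = a i := by
        apply hkinj
        rw [hkz, h1, ha i h2]
      rw [← h3, ← QuotientGroup.out_eq' b]
      symm
      rw [QuotientGroup.eq]
      simp

open Classical in
/-- The counting current of a closed path gives to the cylinder of `v` the number of occurrences
of `v` and of `v⁻¹` in the path, read cyclically. -/
theorem countingMeasure_cylinder {g : FreeGroup A} (hg : g ≠ 1) {d : FreeGroup Γ.PosEdge}
    {e : E} {l : List E} (hc : Γ.IsReducedPath (e :: l ++ [e]))
    (hd : Γ.IsPathElement Γ.x₀ d (Γ.o e)) (h : Γ.emb g = d * Γ.word (e :: l) * d⁻¹)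
    {v : List E} (hv0 : v ≠ []) (hv : Γ.IsReducedPath v) {p q : Γ.TreeVertex Γ.x₀}
    (hlift : Γ.IsLift p v q) :
    countingMeasure g hg (Γ.cylinder p q) =
      ((cyclicCount (e :: l) v + cyclicCount (e :: l) (Γ.invPath v) : ℕ) : ℝ≥0∞) := by
  have hpq := hlift.ne hv0 hv
  have hlift' := hlift.invPath
  have hv' := hv.invPath
  have hv0' : Γ.invPath v ≠ [] := by simpa [SerreGraph.invPath] using hv0
  have hmeas := (isClopen_cylinder hpq).2.measurableSet
  rw [countingMeasure, Measure.sum_apply _ hmeas]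
  simp only [Measure.coe_add, Pi.add_apply, Measure.dirac_apply' _ hmeas]
  rw [ENNReal.tsum_add, tsum_indicator_cylinder hg hc hd h hv0 hv hlift]
  have e2 : ∀ a : FreeGroup A ⧸ Subgroup.zpowers g,
      (Γ.cylinder p q).indicator (1 : DoubleBoundary A → ℝ≥0∞)
        (doubleAct a.out (flipPair (poles g hg))) =
      (Γ.cylinder q p).indicator (1 : DoubleBoundary A → ℝ≥0∞) (doubleAct a.out (poles g hg)) := by
    intro a
    rw [← flipPair_preimage_cylinder p q]
    rfl
  simp only [e2]
  rw [tsum_indicator_cylinder hg hc hd h hv0' hv' hlift', Nat.cast_add]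

end Chart

end Counting

/-! ### Currents with given cylinder weights -/

theorem countingMeasure_ne_zero {A : Type*} [DecidableEq A] {g : FreeGroup A} (hg : g ≠ 1) :
    countingMeasure g hg ≠ 0 := by
  intro h
  have h1 := congrArg (fun m => m Set.univ) h
  simp only [countingMeasure, Measure.coe_zero, Pi.zero_apply] at h1
  rw [Measure.sum_apply _ MeasurableSet.univ, ENNReal.tsum_eq_zero] at h1
  simpa using h1 (1 : FreeGroup A)

namespace Chart

open SerreGraph

variable {A V E : Type*} [Fintype A] {Γ : Chart A V E}

/-- A measure on `∂²F(A)` has the weights `w` if `w v` is the measure of the cylinder of every lift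
of a nondegenerate reduced edge-path `v`. -/
def HasWeights (Γ : Chart A V E) (m : Measure (DoubleBoundary A)) (w : List E → ℝ) : Prop :=
  ∀ v, v ≠ [] → Γ.IsReducedPath v → ∀ p q, Γ.IsLift p v q →
    m (Γ.cylinder p q) ≠ ∞ ∧ m.real (Γ.cylinder p q) = w v

theorem hasWeights_iff {m : Measure (DoubleBoundary A)} {w : List E → ℝ} (hw : ∀ v, 0 ≤ w v) :
    Γ.HasWeights m w ↔ ∀ v, v ≠ [] → Γ.IsReducedPath v → ∀ p q, Γ.IsLift p v q →
      m (Γ.cylinder p q) = ENNReal.ofReal (w v) := by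
  refine forall₃_congr fun v _ _ => forall₃_congr fun p q _ => ?_
  constructor
  · rintro ⟨h1, h2⟩
    rw [← h2, Measure.real, ENNReal.ofReal_toReal h1]
  · intro h
    rw [Measure.real, h, ENNReal.toReal_ofReal (hw v)]
    exact ⟨ENNReal.ofReal_ne_top, rfl⟩

namespace HasWeights

variable {m m' : Measure (DoubleBoundary A)} {w w' : List E → ℝ}

theorem congr (h : Γ.HasWeights m w) (hw : ∀ v, v ≠ [] → Γ.IsReducedPath v → w v = w' v) :
    Γ.HasWeights m w' := fun v h0 hv p q hl => by
  rw [← hw v h0 hv]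
  exact h v h0 hv p q hl

theorem smul (h : Γ.HasWeights m w) (r : ℝ≥0) : Γ.HasWeights (r • m) fun v => r * w v := by
  intro v h0 hv p q hl
  obtain ⟨h1, h2⟩ := h v h0 hv p q hl
  refine ⟨?_, ?_⟩
  · rw [Measure.smul_apply]
    exact ENNReal.mul_ne_top ENNReal.coe_ne_top h1
  · rw [measureReal_nnreal_smul_apply, h2]

variable [DecidableEq A]

theorem ne_top (h : Γ.HasWeights m w) : ∀ D ∈ rootedCylinders Γ.emb_injective, m D ≠ ∞ := by
  intro D hD
  rcases rootedCylinder_cases hD with rfl | ⟨p, q, hpq, rfl⟩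
  · simp
  · obtain ⟨v, h0, hv, hl⟩ := exists_isLift hpq
    exact (h v h0 hv p q hl).1

/-- A measure is determined by its weights. -/
theorem eq (h : Γ.HasWeights m w) (h' : Γ.HasWeights m' w) : m = m' := by
  refine measure_ext_rootedCylinders Γ.emb_injective h.ne_top fun D hD => ?_
  rcases rootedCylinder_cases hD with rfl | ⟨p, q, hpq, rfl⟩
  · simp
  · obtain ⟨v, h0, hv, hl⟩ := exists_isLift hpq
    obtain ⟨h1, h2⟩ := h v h0 hv p q hl
    obtain ⟨h3, h4⟩ := h' v h0 hv p q hl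
    rw [← ENNReal.toReal_eq_toReal_iff' h1 h3]
    exact h2.trans h4.symm

theorem map_doubleAct (h : Γ.HasWeights m w) (g : FreeGroup A) :
    Γ.HasWeights (m.map (doubleAct g)) w := by
  intro v h0 hv p q hl
  have hpq := hl.ne h0 hv
  obtain ⟨y, hy⟩ := p.exists_isPathElement
  obtain ⟨hqv, y', hvy⟩ := hl.elt_eq hy
  obtain ⟨p', hp'⟩ := exists_translate g⁻¹ p
  obtain ⟨q', hq'⟩ := exists_translate g⁻¹ q
  have hl' : Γ.IsLift p' v q' := by
    refine isLift_of_elt_eq (y := y) ?_ ?_ hvy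
    · rw [hq', hqv, hp', mul_assoc]
    · rw [hp']
      exact (Γ.isPathElement_emb _).mul hy
  have e := Measure.map_apply (μ := m) (measurable_doubleAct g)
    (isClopen_cylinder hpq).2.measurableSet
  rw [doubleAct_preimage_cylinder hpq hp' hq'] at e
  rw [Measure.real, e]
  exact h v h0 hv p' q' hl'

theorem map_flipPair (h : Γ.HasWeights m w) :
    Γ.HasWeights (m.map flipPair) fun v => w (Γ.invPath v) := by
  intro v h0 hv p q hl
  have hpq := hl.ne h0 hv
  have e := Measure.map_apply (μ := m) measurable_flipPair (isClopen_cylinder hpq).2.measurableSet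
  rw [flipPair_preimage_cylinder] at e
  rw [Measure.real, e]
  exact h _ (by simpa [SerreGraph.invPath] using h0) hv.invPath q p hl.invPath

/-- A measure with symmetric cylinder weights is a current. -/
def toCurr (h : Γ.HasWeights m w) (hs : ∀ v, w (Γ.invPath v) = w v) : Curr A where
  measure := m
  finite_on_compact K hK :=
    (isFiniteMeasureOnCompacts_of_rootedCylinders Γ.emb_injective h.ne_top).1 hK
  invariant g B hB := by
    rw [← Measure.map_apply (measurable_doubleAct g) hB, (h.map_doubleAct g).eq h]
  flip_invariant B hB := by
    rw [← Measure.map_apply measurable_flipPair hB]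
    have h1 := h.map_flipPair.congr (w' := w) fun v _ _ => hs v
    rw [h1.eq h]

end HasWeights

variable [DecidableEq A]

/-- A cylinder is a product of two closed subsets of the boundary that does not meet the diagonal:
an end that is not in the direction of `q` from `p` is in the direction of `p` from `q`. -/
theorem isCompact_cylinder {p q : Γ.TreeVertex Γ.x₀} (hpq : p ≠ q) :
    IsCompact (Γ.cylinder p q) := by
  rw [isOpenEmbedding_val.isEmbedding.isCompact_iff]
  have h1 := continuous_boundaryMap Γ.emb_injective
  have : (fun z : DoubleBoundary A => z.1) '' Γ.cylinder p q =
      {x : Boundary A | ∀ l ∈ (p.elt⁻¹ * q.elt).toWord.head?,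
        (boundaryAct p.elt⁻¹ (Γ.bd x)).1 0 ≠ l} ×ˢ
      {x : Boundary A | ∀ l ∈ (q.elt⁻¹ * p.elt).toWord.head?,
        (boundaryAct q.elt⁻¹ (Γ.bd x)).1 0 ≠ l} := by
    ext ⟨x, y⟩
    constructor
    · rintro ⟨z, hz, h⟩
      rw [← h]
      exact (mem_cylinder_iff hpq z).1 hz
    · rintro ⟨h2, h3⟩
      refine ⟨⟨(x, y), ?_⟩, (mem_cylinder_iff hpq _).2 ⟨h2, h3⟩, rfl⟩
      rintro (rfl : x = y)
      set w := p.elt⁻¹ * q.elt with hw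
      have hq : q.elt⁻¹ * p.elt = w⁻¹ := by rw [hw]; group
      have hq' : q.elt⁻¹ = w⁻¹ * p.elt⁻¹ := by rw [hw]; group
      have h4 : (boundaryAct p.elt⁻¹ (Γ.bd x)).pre w.norm = w.toWord := by
        rw [pre_norm_eq_iff, ← boundaryAct_mul, ← hq']
        intro m hm
        refine h3 _ ?_
        rw [hq, FreeGroup.toWord_inv, head_invRev]
        exact Option.mem_map_of_mem _ hm
      have hw0 : w.toWord ≠ [] := by
        rw [Ne, FreeGroup.toWord_eq_nil_iff, hw, inv_mul_eq_one]
        exact fun h => hpq (TreeVertex.elt_injective h)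
      have h5 : w.toWord.head hw0 ∈ w.toWord.head? := List.head?_eq_some_head hw0
      exact h2 _ h5 (head_pre (by rw [h4]; exact h5))
  rw [this]
  exact (((isClopen_setOf_forall_letter_ne _).preimage ((continuous_boundaryAct _).comp h1)).1.prod
    ((isClopen_setOf_forall_letter_ne _).preimage ((continuous_boundaryAct _).comp h1)).1).isCompact

/-- Convergence of the weights implies weak-* convergence. -/
theorem tendsto_integral_of_hasWeights {m : ℕ → Measure (DoubleBoundary A)}
    {m₀ : Measure (DoubleBoundary A)} {w : ℕ → List E → ℝ} {w₀ : List E → ℝ}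
    (h : ∀ n, Γ.HasWeights (m n) (w n)) (h₀ : Γ.HasWeights m₀ w₀)
    (hlim : ∀ v, v ≠ [] → Γ.IsReducedPath v → Tendsto (fun n => w n v) atTop (𝓝 (w₀ v)))
    (f : CompactlySupportedContinuousMap (DoubleBoundary A) ℝ) :
    Tendsto (fun n => ∫ z, f z ∂(m n)) atTop (𝓝 (∫ z, f z ∂m₀)) := by
  refine tendsto_integral_of_rootedCylinders Γ.emb_injective (fun n => (h n).ne_top) h₀.ne_top
    (fun D hD => ?_) f
  rcases rootedCylinder_cases hD with rfl | ⟨p, q, hpq, rfl⟩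
  · simp
  · obtain ⟨v, h0, hv, hl⟩ := exists_isLift hpq
    rw [(h₀ v h0 hv p q hl).2]
    exact (hlim v h0 hv).congr fun n => ((h n v h0 hv p q hl).2).symm

/-- Limits of cylinder weights of measures are cylinder weights of a measure. -/
theorem exists_hasWeights {m : ℕ → Measure (DoubleBoundary A)} {w : ℕ → List E → ℝ}
    {w₀ : List E → ℝ} (h : ∀ n, Γ.HasWeights (m n) (w n))
    (hlim : ∀ v, v ≠ [] → Γ.IsReducedPath v → Tendsto (fun n => w n v) atTop (𝓝 (w₀ v))) :
    ∃ ν, Γ.HasWeights ν w₀ := by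
  have h1 : ∀ D ∈ rootedCylinders Γ.emb_injective, Tendsto (fun n => (m n).real D) atTop
      (𝓝 (limUnder atTop fun n => (m n).real D)) := by
    intro D hD
    apply tendsto_nhds_limUnder
    rcases rootedCylinder_cases hD with rfl | ⟨p, q, hpq, rfl⟩
    · exact ⟨0, by simp⟩
    · obtain ⟨v, h0, hv, hl⟩ := exists_isLift hpq
      exact ⟨w₀ v, (hlim v h0 hv).congr fun n => ((h n v h0 hv p q hl).2).symm⟩
  obtain ⟨ν, hν⟩ := exists_measure_of_tendsto Γ.emb_injective (fun n => (h n).ne_top) h1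
  have hνfin := fun D hD => (hν D hD).1
  have _ := isFiniteMeasureOnCompacts_of_rootedCylinders Γ.emb_injective hνfin
  refine ⟨ν, fun v h0 hv p q hl => ?_⟩
  have hpq := hl.ne h0 hv
  refine ⟨(isCompact_cylinder hpq).measure_lt_top.ne, ?_⟩
  -- the cylinder is open and compact, so that its indicator is a test function
  let f : CompactlySupportedContinuousMap (DoubleBoundary A) ℝ :=
    { toFun := (Γ.cylinder p q).indicator fun _ => 1
      continuous_toFun := continuous_const.indicator fun z hz => by
        rw [(isClopen_cylinder hpq).frontier_eq] at hz
        exact absurd hz (Set.notMem_empty z)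
      hasCompactSupport' := HasCompactSupport.intro (isCompact_cylinder hpq)
        fun z hz => Set.indicator_of_notMem hz _ }
  have hf : ∀ m' : Measure (DoubleBoundary A), ∫ z, f z ∂m' = m'.real (Γ.cylinder p q) := by
    intro m'
    change ∫ z, (Γ.cylinder p q).indicator (fun _ => (1 : ℝ)) z ∂m' = _
    rw [integral_indicator_const _ (isClopen_cylinder hpq).2.measurableSet, smul_eq_mul, mul_one]
  have h2 := tendsto_integral_of_rootedCylinders Γ.emb_injective (fun n => (h n).ne_top) hνfin
    (fun D hD => by rw [(hν D hD).2]; exact h1 D hD) f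
  simp only [hf] at h2
  refine tendsto_nhds_unique h2 ?_
  exact (hlim v h0 hv).congr fun n => ((h n v h0 hv p q hl).2).symm

/-- Projective convergence of counting currents, from the convergence of the cylinder weights
after normalization by the factors `N n`. -/
theorem exists_tendsto_countingMeasure {ν : Curr A} (hν : ν.measure ≠ 0) {w₀ : List E → ℝ}
    (hw₀ : Γ.HasWeights ν.measure w₀) {g : ℕ → FreeGroup A} {N : ℕ → ℕ} {w : ℕ → List E → ℝ}
    (hg : ∀ᶠ n in atTop, 0 < N n ∧ (∀ v, w n (Γ.invPath v) = w n v) ∧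
      ∃ hg : g n ≠ 1, Γ.HasWeights (countingMeasure (g n) hg) (w n))
    (hlim : ∀ v, v ≠ [] → Γ.IsReducedPath v →
      Tendsto (fun n => w n v / N n) atTop (𝓝 (w₀ v))) :
    ∃ c : ℕ → NonzeroCurr A,
      (∀ᶠ n in atTop, ∃ h : g n ≠ 1, (c n).1.measure = countingMeasure (g n) h) ∧
      Tendsto (fun n => (Quot.mk _ (c n) : PCurr A)) atTop (𝓝 (Quot.mk _ ⟨ν, hν⟩)) := by
  have key : ∀ n, ∃ c d : NonzeroCurr A, (Quot.mk _ c : PCurr A) = Quot.mk _ d ∧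
      ∃ u, Γ.HasWeights d.1.measure u ∧
        ((0 < N n ∧ (∀ v, w n (Γ.invPath v) = w n v) ∧
          ∃ hg : g n ≠ 1, Γ.HasWeights (countingMeasure (g n) hg) (w n)) →
        (∃ h : g n ≠ 1, c.1.measure = countingMeasure (g n) h) ∧ ∀ v, u v = w n v / N n) := by
    intro n
    by_cases h : 0 < N n ∧ (∀ v, w n (Γ.invPath v) = w n v) ∧
      ∃ hg : g n ≠ 1, Γ.HasWeights (countingMeasure (g n) hg) (w n)
    · obtain ⟨hN, hs, hg, hw⟩ := h
      have hr : 0 < ((N n : ℝ≥0)⁻¹) := by positivity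
      have hw' := hw.smul (N n : ℝ≥0)⁻¹
      refine ⟨⟨hw.toCurr hs, countingMeasure_ne_zero hg⟩,
        ⟨hw'.toCurr fun v => by rw [hs], ?_⟩, Quot.sound ⟨(N n : ℝ≥0)⁻¹, hr, rfl⟩,
        _, hw', fun _ => ⟨⟨hg, rfl⟩, fun v => ?_⟩⟩
      · intro h0
        have h1 : (N n : ℝ≥0)⁻¹ • countingMeasure (g n) hg = 0 := h0
        have h2 := congrArg (fun m => (N n : ℝ≥0) • m) h1
        simp only [smul_zero] at h2
        rw [smul_inv_smul₀ (by positivity)] at h2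
        exact countingMeasure_ne_zero hg h2
      · push_cast
        rw [div_eq_inv_mul]
    · exact ⟨⟨ν, hν⟩, ⟨ν, hν⟩, rfl, w₀, hw₀, fun h' => absurd h' h⟩
  choose c d hcd u hu hc using key
  refine ⟨c, hg.mono fun n hn => (hc n hn).1, ?_⟩
  have hd : Tendsto d atTop (𝓝 ⟨ν, hν⟩) := by
    rw [tendsto_subtype_rng, nhds_induced, tendsto_comap_iff, tendsto_pi_nhds]
    intro f
    refine tendsto_integral_of_hasWeights hu hw₀ (fun v h0 hv => ?_) f
    refine (hlim v h0 hv).congr' ?_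
    filter_upwards [hg] with n hn
    exact ((hc n hn).2 v).symm
  simp only [hcd]
  exact (continuous_quot_mk.tendsto _).comp hd

end Chart

/-! ### Finite-state Markov chains -/

namespace MarkovChain

variable {S : Type*} [Fintype S] {X : MarkovChain S}

theorem le_one (X : MarkovChain S) (s s' : S) : X.p s s' ≤ 1 := by
  rw [← X.sum_eq_one s]
  exact Finset.single_le_sum (fun r _ => X.nonneg s r) (Finset.mem_univ s')

theorem pathProb_nonneg (X : MarkovChain S) (s : S) (w : List S) : 0 ≤ X.pathProb s w := by
  induction w generalizing s with
  | nil => exact zero_le_one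
  | cons a w ih => exact mul_nonneg (X.nonneg _ _) (ih a)

theorem pathProb_le_one (X : MarkovChain S) (s : S) (w : List S) : X.pathProb s w ≤ 1 := by
  induction w generalizing s with
  | nil => exact le_rfl
  | cons a w ih => exact mul_le_one₀ (X.le_one _ _) (X.pathProb_nonneg _ _) (ih a)

theorem pathProb_append (X : MarkovChain S) (s : S) (v w : List S) :
    X.pathProb s (v ++ w) =
      X.pathProb s v * X.pathProb ((s :: v).getLast (List.cons_ne_nil _ _)) w := by
  induction v generalizing s with
  | nil => simp [pathProb]
  | cons a v ih =>
    rw [List.cons_append, pathProb, ih a, pathProb, mul_assoc,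
      List.getLast_cons (List.cons_ne_nil a v)]

theorem wordProb_append (X : MarkovChain S) (μ : S → ℝ) {v : List S} (hv : v ≠ []) (w : List S) :
    X.wordProb μ (v ++ w) = X.wordProb μ v * X.pathProb (v.getLast hv) w := by
  obtain ⟨a, v, rfl⟩ := List.exists_cons_of_ne_nil hv
  rw [List.cons_append, wordProb, pathProb_append, wordProb, mul_assoc]

theorem wordProb_nonneg (X : MarkovChain S) {μ : S → ℝ} (hμ : ∀ s, 0 ≤ μ s) (w : List S) :
    0 ≤ X.wordProb μ w := by
  rcases w with _ | ⟨a, w⟩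
  · exact zero_le_one
  · exact mul_nonneg (hμ a) (X.pathProb_nonneg a w)

theorem step_nonneg (X : MarkovChain S) (n : ℕ) (s s' : S) : 0 ≤ X.step n s s' := by
  induction n generalizing s' with
  | zero => exact X.nonneg s s'
  | succ n ih => exact Finset.sum_nonneg fun r _ => mul_nonneg (ih r) (X.nonneg r s')

theorem exists_step_of_step_succ_pos {n : ℕ} {s s' : S} (h : 0 < X.step (n + 1) s s') :
    ∃ r, 0 < X.step n s r ∧ 0 < X.p r s' := by
  obtain ⟨r, -, hr⟩ := Finset.exists_lt_of_sum_lt (s := Finset.univ) (f := fun _ : S => (0 : ℝ))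
    (g := fun r => X.step n s r * X.p r s') (by
      rw [Finset.sum_const_zero]; exact h)
  rcases (X.step_nonneg n s r).eq_or_lt with h1 | h1
  · rw [← h1, zero_mul] at hr
    exact absurd hr (lt_irrefl _)
  · exact ⟨r, h1, pos_of_mul_pos_right hr h1.le⟩

theorem sum_mul_step {κ : S → ℝ} (hκ : ∀ s', ∑ s, κ s * X.p s s' = κ s') (n : ℕ) (s' : S) :
    ∑ s, κ s * X.step n s s' = κ s' := by
  induction n generalizing s' with
  | zero => exact hκ s'
  | succ n ih =>
    simp only [step, Finset.mul_sum]
    rw [Finset.sum_comm, ← hκ s']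
    refine Finset.sum_congr rfl fun r _ => ?_
    rw [← ih r, Finset.sum_mul]
    exact Finset.sum_congr rfl fun s _ => by ring

/-- A nonnegative invariant vector of an irreducible chain that vanishes somewhere is zero. -/
theorem eq_zero_of_invariant (hX : X.IsIrreducible) {κ : S → ℝ} (h0 : ∀ s, 0 ≤ κ s)
    (hκ : ∀ s', ∑ s, κ s * X.p s s' = κ s') {a : S} (ha : κ a = 0) (s : S) : κ s = 0 := by
  obtain ⟨n, hn⟩ := hX s a
  have h1 := sum_mul_step hκ n a
  rw [ha, Finset.sum_eq_zero_iff_of_nonneg fun r _ => mul_nonneg (h0 r) (X.step_nonneg n r a)] at h1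
  exact (mul_eq_zero.1 (h1 s (Finset.mem_univ s))).resolve_right hn.ne'

/-- The states of probability `0` would be closed under taking predecessors, hence all states
by irreducibility. -/
theorem IsStationary.pos (hX : X.IsIrreducible) {μ : S → ℝ} (hμ : X.IsStationary μ) (s : S) :
    0 < μ s := by
  refine (hμ.1.1 s).lt_of_ne fun h => ?_
  have h1 := eq_zero_of_invariant hX hμ.1.1 hμ.2 h.symm
  have h2 := hμ.1.2
  simp [h1] at h2

theorem IsStationary.unique (hX : X.IsIrreducible) {μ μ' : S → ℝ} (hμ : X.IsStationary μ)
    (hμ' : X.IsStationary μ') : μ = μ' := by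
  have hne : Nonempty S := by
    by_contra h
    have h1 := hμ.1.2
    simp [not_nonempty_iff.1 h] at h1
  -- subtract the largest multiple of `μ` below `μ'`
  obtain ⟨a, ha⟩ := Finite.exists_min fun s => μ' s / μ s
  set t := μ' a / μ a with ht
  have hpos := fun s => hμ.pos hX s
  have h1 : ∀ s, μ' s - t * μ s = 0 := by
    refine eq_zero_of_invariant hX (a := a) (fun s => ?_) (fun s' => ?_) ?_
    · have := (le_div_iff₀ (hpos s)).1 (ha s)
      linarith
    · simp only [sub_mul, Finset.sum_sub_distrib, mul_assoc, ← Finset.mul_sum]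
      rw [hμ.2, hμ'.2]
    · rw [ht, div_mul_cancel₀ _ (hpos a).ne', sub_self]
  have h2 : ∀ s, μ' s = t * μ s := fun s => by linarith [h1 s]
  have h3 : t = 1 := by
    have h4 := hμ'.1.2
    simp only [h2, ← Finset.mul_sum] at h4
    rwa [hμ.1.2, mul_one] at h4
  funext s
  rw [h2, h3, one_mul]

theorem eq_of_p_eq_one {s a b : S} (ha : X.p s a = 1) (hb : 0 < X.p s b) : b = a := by
  classical
  by_contra h
  have h1 := X.sum_eq_one s
  rw [← Finset.add_sum_erase _ _ (Finset.mem_univ a), ha] at h1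
  have h2 : X.p s b ≤ ∑ x ∈ Finset.univ.erase a, X.p s x :=
    Finset.single_le_sum (fun r _ => X.nonneg s r) (Finset.mem_erase.2 ⟨h, Finset.mem_univ b⟩)
  linarith

theorem p_eq_one_of_pathProb_eq_one {s : S} {w : List S} (h : X.pathProb s w = 1) (i : ℕ)
    (hi : i < w.length) :
    X.p ((s :: w)[i]'(by simp; omega)) ((s :: w)[i + 1]'(by simp; omega)) = 1 := by
  induction w generalizing s i with
  | nil => simp at hi
  | cons a w ih =>
    have h1 := X.le_one s a
    have h2 := X.pathProb_le_one a w
    have h3 := X.nonneg s a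
    have h4 := X.pathProb_nonneg a w
    rw [pathProb] at h
    rcases i with _ | i
    · simp only [List.getElem_cons_zero, List.getElem_cons_succ]
      nlinarith
    · simp only [List.getElem_cons_succ]
      exact ih (by nlinarith) i (by simpa using hi)

/-- A path of probability `1` determines the states reached from its origin. -/
theorem eq_getElem_of_step_pos {s : S} {w : List S} (h : X.pathProb s w = 1) (i : ℕ)
    (hi : i < w.length) {x : S} (hx : 0 < X.step i s x) :
    x = (s :: w)[i + 1]'(by simp; omega) := by
  induction i generalizing x with
  | zero => exact eq_of_p_eq_one (p_eq_one_of_pathProb_eq_one h 0 hi) hx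
  | succ i ih =>
    obtain ⟨r, h1, h2⟩ := exists_step_of_step_succ_pos hx
    have h3 := p_eq_one_of_pathProb_eq_one h (i + 1) hi
    rw [← ih (by omega) h1] at h3
    exact eq_of_p_eq_one h3 h2

/-- If some state has no deterministic transition, then no long path is deterministic. -/
theorem exists_pathProb_lt_one (hX : X.IsIrreducible) {a : S} (ha : ∀ y, X.p a y ≠ 1) :
    ∃ K, ∀ s w, w.length = K → X.pathProb s w < 1 := by
  choose n hn using fun s => hX s a
  obtain ⟨N, hN⟩ := (Set.finite_range n).bddAbove
  refine ⟨N + 2, fun s w hw => (X.pathProb_le_one s w).lt_of_ne fun h => ?_⟩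
  have h1 : n s ≤ N := hN ⟨s, rfl⟩
  have h2 := eq_getElem_of_step_pos h (n s) (by omega) (hn s)
  have h3 := p_eq_one_of_pathProb_eq_one h (n s + 1) (by omega)
  rw [← h2] at h3
  exact ha _ h3

theorem pathProb_le_pow {K : ℕ} {θ : ℝ} (hθ : ∀ s w, w.length = K → X.pathProb s w ≤ θ) (j : ℕ)
    (s : S) (w : List S) (hw : K * j ≤ w.length) : X.pathProb s w ≤ θ ^ j := by
  induction j generalizing s w with
  | zero => simpa using X.pathProb_le_one s w
  | succ j ih =>
    rw [mul_add, mul_one] at hw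
    rw [← List.take_append_drop K w, pathProb_append, pow_succ, mul_comm]
    have h1 := hθ s (w.take K) (by rw [List.length_take]; omega)
    exact mul_le_mul (ih _ _ (by rw [List.length_drop]; omega)) h1 (X.pathProb_nonneg _ _)
      (pow_nonneg ((X.pathProb_nonneg _ _).trans h1) j)

theorem exists_pathProb_le [Nonempty S] {K : ℕ} (hK : ∀ s w, w.length = K → X.pathProb s w < 1) :
    ∃ θ < 1, 0 ≤ θ ∧ ∀ s w, w.length = K → X.pathProb s w ≤ θ := by
  obtain ⟨⟨a, v⟩, h⟩ := Finite.exists_max fun q : S × (Fin K → S) => X.pathProb q.1 (List.ofFn q.2)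
  refine ⟨_, hK a (List.ofFn v) (by simp), X.pathProb_nonneg _ _, fun s w hw => ?_⟩
  subst hw
  simpa using h (s, w.get)

end MarkovChain

/-! ### A law of large numbers for bounded orthogonal random variables -/

section Orthogonal

variable {Ω : Type*} [MeasurableSpace Ω] {P : Measure Ω} [IsProbabilityMeasure P]

/-- By orthogonality only the diagonal terms contribute to the second moment. -/
theorem integral_sq_sum_le {D : ℕ → Ω → ℝ} (hD : ∀ i, Measurable (D i)) (hb : ∀ i ω, |D i ω| ≤ 1)
    (ho : ∀ i j, i < j → ∫ ω, D i ω * D j ω ∂P = 0) (n : ℕ) :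
    ∫ ω, (∑ i ∈ Finset.range n, D i ω) ^ 2 ∂P ≤ n := by
  have hint : ∀ i j, Integrable (fun ω => D i ω * D j ω) P := fun i j =>
    Integrable.of_bound ((hD i).mul (hD j)).aestronglyMeasurable 1 (ae_of_all _ fun ω => by
      rw [Real.norm_eq_abs, abs_mul]
      exact mul_le_one₀ (hb i ω) (abs_nonneg _) (hb j ω))
  simp only [sq, Finset.sum_mul_sum]
  rw [integral_finsetSum _ fun i _ => integrable_finsetSum _ fun j _ => hint i j]
  calc ∑ i ∈ Finset.range n, ∫ ω, ∑ j ∈ Finset.range n, D i ω * D j ω ∂P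
      ≤ ∑ i ∈ Finset.range n, (1 : ℝ) := Finset.sum_le_sum fun i hi => ?_
    _ = n := by simp
  rw [integral_finsetSum _ fun j _ => hint i j, Finset.sum_eq_single_of_mem i hi]
  · calc ∫ ω, D i ω * D i ω ∂P ≤ ∫ _, (1 : ℝ) ∂P := by
          refine integral_mono (hint i i) (integrable_const 1) fun ω => ?_
          have := hb i ω
          rw [← abs_mul_abs_self (D i ω)]
          exact mul_le_one₀ this (abs_nonneg _) this
      _ = 1 := by simp
  · intro j _ hj
    rcases lt_or_gt_of_ne hj with h | h
    · simpa only [mul_comm] using ho j i h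
    · exact ho i j h

/-- The averages of a bounded sequence converge if they converge along the squares, because the gap
between `k ^ 2` and `(k + 1) ^ 2` is of order `k`. -/
theorem tendsto_sum_div_of_sq {d : ℕ → ℝ} (hb : ∀ i, |d i| ≤ 1)
    (h : Tendsto (fun k : ℕ => (∑ i ∈ Finset.range (k ^ 2), d i) / (k : ℝ) ^ 2) atTop (𝓝 0)) :
    Tendsto (fun n : ℕ => (∑ i ∈ Finset.range n, d i) / n) atTop (𝓝 0) := by
  have hs : Tendsto Nat.sqrt atTop atTop := by
    refine tendsto_atTop.2 fun k => ?_
    filter_upwards [eventually_ge_atTop (k * k)] with n hn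
    exact Nat.le_sqrt.2 hn
  have h1 : Tendsto (fun n : ℕ => |(∑ i ∈ Finset.range (n.sqrt ^ 2), d i) / (n.sqrt : ℝ) ^ 2| +
      2 / (n.sqrt : ℝ)) atTop (𝓝 0) := by
    have h2 := (h.comp hs).abs.add ((tendsto_const_div_atTop_nhds_zero_nat (2 : ℝ)).comp hs)
    simpa using h2
  refine squeeze_zero_norm' ?_ h1
  filter_upwards [eventually_ge_atTop 1] with n hn
  set k := n.sqrt with hk
  have hk0 : 0 < k := Nat.sqrt_pos.2 hn
  have hk1 : k ^ 2 ≤ n := by rw [sq]; exact Nat.sqrt_le n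
  have hk2 : n ≤ k ^ 2 + 2 * k := by
    have := Nat.sqrt_le_add n
    rw [← hk] at this
    nlinarith
  have hkR : (0 : ℝ) < k := by exact_mod_cast hk0
  have hnR : (k : ℝ) ^ 2 ≤ n := by exact_mod_cast hk1
  have hn2 : (n : ℝ) ≤ (k : ℝ) ^ 2 + 2 * k := by exact_mod_cast hk2
  have h3 : |∑ i ∈ Finset.Ico (k ^ 2) n, d i| ≤ 2 * k := by
    refine (Finset.abs_sum_le_sum_abs _ _).trans ((Finset.sum_le_sum fun i _ => hb i).trans ?_)
    rw [Finset.sum_const, Nat.card_Ico, nsmul_eq_mul, mul_one, Nat.cast_sub hk1]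
    push_cast
    linarith
  have h4 := Finset.sum_range_add_sum_Ico d hk1
  have h5 : |∑ i ∈ Finset.range n, d i| ≤ |∑ i ∈ Finset.range (k ^ 2), d i| + 2 * k := by
    rw [← h4]
    exact (abs_add_le _ _).trans (by gcongr)
  rw [Real.norm_eq_abs, abs_div, abs_div, Nat.abs_cast,
    abs_of_pos (show (0 : ℝ) < (k : ℝ) ^ 2 by positivity)]
  calc |∑ i ∈ Finset.range n, d i| / (n : ℝ)
      ≤ (|∑ i ∈ Finset.range (k ^ 2), d i| + 2 * k) / (k : ℝ) ^ 2 := by gcongr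
    _ = _ := by field_simp

/-- Second moments give convergence along the squares, and bounded terms fill the gaps. -/
theorem ae_tendsto_sum_div_of_orthogonal {D : ℕ → Ω → ℝ} (hD : ∀ i, Measurable (D i))
    (hb : ∀ i ω, |D i ω| ≤ 1) (ho : ∀ i j, i < j → ∫ ω, D i ω * D j ω ∂P = 0) :
    ∀ᵐ ω ∂P, Tendsto (fun n : ℕ => (∑ i ∈ Finset.range n, D i ω) / n) atTop (𝓝 0) := by
  set Z : ℕ → Ω → ℝ := fun k ω => ((∑ i ∈ Finset.range (k ^ 2), D i ω) / (k : ℝ) ^ 2) ^ 2 with hZ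
  have hZm : ∀ k, Measurable (Z k) := fun k =>
    ((Finset.measurable_sum _ fun i _ => hD i).div_const _).pow_const 2
  have hZb : ∀ k ω, Z k ω ≤ 1 := by
    intro k ω
    have h1 : |∑ i ∈ Finset.range (k ^ 2), D i ω| ≤ (k : ℝ) ^ 2 := by
      refine (Finset.abs_sum_le_sum_abs _ _).trans
        ((Finset.sum_le_sum fun i _ => hb i ω).trans ?_)
      simp
    rw [hZ, sq_le_one_iff_abs_le_one, abs_div, abs_of_nonneg (sq_nonneg (k : ℝ))]
    exact div_le_one_of_le₀ h1 (sq_nonneg _)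
  have hZi : ∀ k, Integrable (Z k) P := fun k =>
    Integrable.of_bound (hZm k).aestronglyMeasurable 1 (ae_of_all _ fun ω => by
      rw [Real.norm_eq_abs, abs_of_nonneg (sq_nonneg _)]
      exact hZb k ω)
  have hZe : ∀ k, ∫ ω, Z k ω ∂P ≤ 1 / (k : ℝ) ^ 2 := by
    intro k
    simp only [hZ, div_pow]
    rw [integral_div]
    have h1 := integral_sq_sum_le (P := P) hD hb ho (k ^ 2)
    rcases Nat.eq_zero_or_pos k with rfl | hk
    · simp
    · rw [div_le_div_iff₀ (by positivity) (by positivity)]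
      push_cast at h1
      have : (0 : ℝ) ≤ (k : ℝ) ^ 2 := by positivity
      nlinarith
  have hfin : ∑' k, ∫⁻ ω, ENNReal.ofReal (Z k ω) ∂P ≠ ∞ := by
    have h1 : Summable fun k : ℕ => 1 / (k : ℝ) ^ 2 := Real.summable_one_div_nat_pow.2 one_lt_two
    refine ne_top_of_le_ne_top h1.tsum_ofReal_ne_top (ENNReal.tsum_le_tsum fun k => ?_)
    rw [← ofReal_integral_eq_lintegral_ofReal (hZi k) (ae_of_all _ fun ω => sq_nonneg _)]
    exact ENNReal.ofReal_le_ofReal (hZe k)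
  rw [← lintegral_tsum fun k => (hZm k).ennreal_ofReal.aemeasurable] at hfin
  have hae := ae_lt_top' (AEMeasurable.tsum fun k => (hZm k).ennreal_ofReal.aemeasurable)
    hfin
  filter_upwards [hae] with ω hω
  refine tendsto_sum_div_of_sq (fun i => hb i ω) ?_
  have h1 := ENNReal.tendsto_atTop_zero_of_tsum_ne_top hω.ne
  have h2 : Tendsto (fun k => Z k ω) atTop (𝓝 0) := by
    have h3 := (ENNReal.tendsto_toReal ENNReal.zero_ne_top).comp h1
    exact h3.congr fun k => ENNReal.toReal_ofReal (sq_nonneg _)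
  have h4 := (Real.continuous_sqrt.tendsto 0).comp h2
  rw [Real.sqrt_zero] at h4
  rw [tendsto_zero_iff_abs_tendsto_zero]
  refine h4.congr fun k => ?_
  simp only [Function.comp_apply, hZ, Real.sqrt_sq_eq_abs]

end Orthogonal

/-! ### Trajectories of a Markov process -/

section Trajectory

variable {S Ω : Type*}

/-- The first `n` states of a trajectory. -/
def traj (ξ : ℕ → Ω → S) (n : ℕ) (ω : Ω) : List S := List.ofFn fun i : Fin n => ξ i ω

variable {ξ : ℕ → Ω → S}

@[simp]
theorem length_traj (n : ℕ) (ω : Ω) : (traj ξ n ω).length = n := by simp [traj]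

theorem traj_succ (n : ℕ) (ω : Ω) : traj ξ (n + 1) ω = traj ξ n ω ++ [ξ n ω] := by
  simp only [traj, List.ofFn_succ', Fin.val_castSucc, Fin.val_last, List.concat_eq_append]

theorem getElem_traj {n i : ℕ} (ω : Ω) (h : i < (traj ξ n ω).length) :
    (traj ξ n ω)[i] = ξ i ω := by simp [traj]

theorem take_traj {m n : ℕ} (h : m ≤ n) (ω : Ω) : (traj ξ n ω).take m = traj ξ m ω := by
  apply List.ext_getElem
  · simpa using h
  · intro i h1 h2
    rw [List.getElem_take, getElem_traj, getElem_traj]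

theorem traj_eq_iff {n : ℕ} {ω : Ω} {w : Fin n → S} :
    traj ξ n ω = List.ofFn w ↔ ∀ i : Fin n, ξ i ω = w i := by
  rw [traj, List.ofFn_inj, funext_iff]

open Classical in
/-- Functions of the first `n` states are finite sums of indicators. -/
theorem apply_traj_eq_sum [Fintype S] (F : List S → ℝ) (n : ℕ) (ω : Ω) :
    F (traj ξ n ω) = ∑ w : Fin n → S, F (List.ofFn w) *
      {ω | traj ξ n ω = List.ofFn w}.indicator (fun _ => (1 : ℝ)) ω := by
  rw [Finset.sum_eq_single_of_mem (fun i : Fin n => ξ i ω) (Finset.mem_univ _)]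
  · rw [Set.indicator_of_mem, mul_one]
    · rfl
    · rfl
  · intro w _ hw
    rw [Set.indicator_of_notMem, mul_zero]
    intro h
    apply hw
    funext i
    exact (traj_eq_iff.1 h i).symm

end Trajectory

namespace MarkovChain

variable {S Ω : Type*} [Fintype S] {X : MarkovChain S} [MeasurableSpace Ω] {μ : S → ℝ}
  {P : Measure Ω} {ξ : ℕ → Ω → S}

namespace HasMarkovLaw

theorem measurableSet_traj_eq (h : X.HasMarkovLaw μ P ξ) (n : ℕ) (w : List S) :
    MeasurableSet {ω | traj ξ n ω = w} := by
  induction n generalizing w with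
  | zero =>
    have : {ω | traj ξ 0 ω = w} = {_ω : Ω | [] = w} := by simp [traj]
    rw [this]
    exact MeasurableSet.const _
  | succ n ih =>
    rcases List.eq_nil_or_concat' w with rfl | ⟨u, a, rfl⟩
    · convert MeasurableSet.empty
      ext ω
      simp [traj_succ]
    · have : {ω | traj ξ (n + 1) ω = u ++ [a]} = {ω | traj ξ n ω = u} ∩ {ω | ξ n ω = a} := by
        ext ω
        simp [traj_succ, List.append_singleton_inj]
      rw [this]
      exact (ih u).inter (h.1 n a)

theorem measure_traj_eq (h : X.HasMarkovLaw μ P ξ) (w : List S) :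
    P {ω | traj ξ w.length ω = w} = ENNReal.ofReal (X.wordProb μ w) := by
  have h1 := h.2 w.length w.get
  rw [List.ofFn_get] at h1
  rw [← h1]
  congr 1
  ext ω
  have := traj_eq_iff (ξ := ξ) (ω := ω) (w := w.get)
  rw [List.ofFn_get] at this
  exact this

theorem measurable_apply_traj (h : X.HasMarkovLaw μ P ξ) (F : List S → ℝ) (n : ℕ) :
    Measurable fun ω => F (traj ξ n ω) := by
  simp only [apply_traj_eq_sum F n]
  exact Finset.measurable_sum _ fun w _ =>
    (measurable_const.indicator (h.measurableSet_traj_eq n _)).const_mul _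

theorem integrable_apply_traj [IsFiniteMeasure P] (h : X.HasMarkovLaw μ P ξ) (F : List S → ℝ)
    (n : ℕ) : Integrable (fun ω => F (traj ξ n ω)) P := by
  simp only [apply_traj_eq_sum F n]
  exact integrable_finsetSum _ fun w _ =>
    ((integrable_const (1 : ℝ)).indicator (h.measurableSet_traj_eq n _)).const_mul _

theorem setIntegral_apply_traj [IsFiniteMeasure P] (h : X.HasMarkovLaw μ P ξ) (F : List S → ℝ)
    (n : ℕ) {B : Set Ω} (hB : MeasurableSet B) :
    ∫ ω, F (traj ξ n ω) * B.indicator (fun _ => (1 : ℝ)) ω ∂P =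
      ∑ w : Fin n → S, F (List.ofFn w) * P.real ({ω | traj ξ n ω = List.ofFn w} ∩ B) := by
  have e : ∀ ω, F (traj ξ n ω) * B.indicator (fun _ => (1 : ℝ)) ω = ∑ w : Fin n → S,
      F (List.ofFn w) * ({ω | traj ξ n ω = List.ofFn w} ∩ B).indicator (fun _ => (1 : ℝ)) ω := by
    intro ω
    rw [apply_traj_eq_sum F n ω, Finset.sum_mul]
    refine Finset.sum_congr rfl fun w _ => ?_
    classical
    rw [mul_assoc, Set.indicator_apply, Set.indicator_apply, Set.indicator_apply]
    simp only [Set.mem_inter_iff, ite_and, mul_ite, mul_one, mul_zero]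
    split_ifs <;> rfl
  simp only [e]
  have hm := fun w : Fin n → S => (h.measurableSet_traj_eq n (List.ofFn w)).inter hB
  rw [integral_finsetSum _ fun w _ => ((integrable_const (1 : ℝ)).indicator (hm w)).const_mul _]
  refine Finset.sum_congr rfl fun w _ => ?_
  rw [integral_const_mul, integral_indicator_const _ (hm w), smul_eq_mul, mul_one]

/-- The Markov property. -/
theorem integral_mul_next (hμ : IsDistribution μ) [IsFiniteMeasure P] (h : X.HasMarkovLaw μ P ξ)
    (F : List S → ℝ) (n : ℕ) (s : S) :
    ∫ ω, F (traj ξ (n + 1) ω) * {ω | ξ (n + 1) ω = s}.indicator (fun _ => (1 : ℝ)) ω ∂P =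
      ∫ ω, F (traj ξ (n + 1) ω) * X.p (ξ n ω) s ∂P := by
  rw [h.setIntegral_apply_traj F (n + 1) (h.1 _ s)]
  set G : List S → ℝ := fun l => F l * (l.getLast?.map fun a => X.p a s).getD 0 with hG
  have e : ∀ ω, F (traj ξ (n + 1) ω) * X.p (ξ n ω) s = G (traj ξ (n + 1) ω) *
        Set.univ.indicator (fun _ => (1 : ℝ)) ω := by
    intro ω
    simp [hG, traj_succ]
  rw [integral_congr_ae (ae_of_all _ e), h.setIntegral_apply_traj _ (n + 1) MeasurableSet.univ]
  refine Finset.sum_congr rfl fun w _ => ?_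
  have hne : List.ofFn w ≠ [] := by simp
  have hlen : (List.ofFn w ++ [s]).length = n + 1 + 1 := by simp
  have h1 := h.measure_traj_eq (List.ofFn w ++ [s])
  have h2 := h.measure_traj_eq (List.ofFn w)
  rw [hlen] at h1
  rw [List.length_ofFn] at h2
  have e1 : {ω | traj ξ (n + 1) ω = List.ofFn w} ∩ {ω | ξ (n + 1) ω = s} =
      {ω | traj ξ (n + 1 + 1) ω = List.ofFn w ++ [s]} := by
    ext ω
    rw [Set.mem_ofPred_eq, traj_succ (n + 1), List.append_singleton_inj]
    rfl
  rw [e1, Set.inter_univ, Measure.real, h1, Measure.real, h2,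
    ENNReal.toReal_ofReal (X.wordProb_nonneg hμ.1 _),
    ENNReal.toReal_ofReal (X.wordProb_nonneg hμ.1 _), wordProb_append X μ hne]
  simp only [hG, List.getLast?_eq_some_getLast hne, pathProb, mul_one,
    Option.map_some, Option.getD_some]
  ring

open Classical in
/-- Almost surely all transitions of the trajectory have positive probability. -/
theorem ae_p_pos (hμ : IsDistribution μ) [IsFiniteMeasure P] (h : X.HasMarkovLaw μ P ξ) :
    ∀ᵐ ω ∂P, ∀ i, 0 < X.p (ξ i ω) (ξ (i + 1) ω) := by
  rw [ae_all_iff]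
  intro i
  have key : ∀ s, ∀ᵐ ω ∂P, ¬ (X.p (ξ i ω) s = 0 ∧ ξ (i + 1) ω = s) := by
    intro s
    set F : List S → ℝ := fun l => if (l.getLast?.map fun a => X.p a s).getD 0 = 0 then 1 else 0
      with hF
    have hFω : ∀ ω, F (traj ξ (i + 1) ω) = if X.p (ξ i ω) s = 0 then 1 else 0 := by
      intro ω
      simp [hF, traj_succ]
    have h1 := h.integral_mul_next hμ F i s
    have h2 : ∀ ω, F (traj ξ (i + 1) ω) * X.p (ξ i ω) s = 0 := by
      intro ω
      rw [hFω]
      split_ifs with h3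
      · rw [h3, mul_zero]
      · rw [zero_mul]
    simp only [h2, integral_zero] at h1
    rw [integral_eq_zero_iff_of_nonneg] at h1
    · filter_upwards [h1] with ω hω
      rintro ⟨h3, h4⟩
      have h5 : ω ∈ {ω | ξ (i + 1) ω = s} := h4
      simp only [hFω, if_pos h3, Set.indicator_of_mem h5, Pi.zero_apply] at hω
      norm_num at hω
    · intro ω
      have h3 : 0 ≤ {ω | ξ (i + 1) ω = s}.indicator (fun _ => (1 : ℝ)) ω :=
        Set.indicator_nonneg (fun _ _ => zero_le_one) ω
      simp only [hFω, Pi.zero_apply]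
      split_ifs
      · simpa using h3
      · simp
    · have hB := (integrable_const (μ := P) (1 : ℝ)).indicator (h.1 (i + 1) s)
      refine hB.bdd_mul (c := 1) (h.measurable_apply_traj F (i + 1)).aestronglyMeasurable
        (ae_of_all _ fun ω => ?_)
      rw [hFω]
      split_ifs <;> simp
  rw [← ae_all_iff] at key
  filter_upwards [key] with ω hω
  exact (X.nonneg _ _).lt_of_ne fun h1 => hω _ ⟨h1.symm, rfl⟩

/-- Law of large numbers for the transitions of the process. -/
theorem ae_tendsto_sum_next (hμ : IsDistribution μ) [IsProbabilityMeasure P]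
    (h : X.HasMarkovLaw μ P ξ) {F : ℕ → List S → ℝ} (hF : ∀ n l, |F n l| ≤ 1) (s : S) :
    ∀ᵐ ω ∂P, Tendsto (fun n : ℕ => (∑ m ∈ Finset.range n, F m (traj ξ (m + 1) ω) *
      ({ω | ξ (m + 1) ω = s}.indicator (fun _ => (1 : ℝ)) ω - X.p (ξ m ω) s)) / n) atTop (𝓝 0) := by
  classical
  set G : ℕ → List S → ℝ := fun m l => F m (l.take (m + 1)) *
    ((if l[m + 1]? = some s then 1 else 0) - (l[m]?.map fun a => X.p a s).getD 0) with hG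
  have hGω : ∀ m n, m + 2 ≤ n → ∀ ω, G m (traj ξ n ω) = F m (traj ξ (m + 1) ω) *
      ({ω | ξ (m + 1) ω = s}.indicator (fun _ => (1 : ℝ)) ω - X.p (ξ m ω) s) := by
    intro m n hmn ω
    simp only [hG]
    rw [take_traj (by omega), List.getElem?_eq_getElem (by rw [length_traj]; omega), getElem_traj,
      List.getElem?_eq_getElem (by rw [length_traj]; omega), getElem_traj]
    simp [Set.indicator_apply]
  have hb : ∀ m ω, |F m (traj ξ (m + 1) ω) *
      ({ω | ξ (m + 1) ω = s}.indicator (fun _ => (1 : ℝ)) ω - X.p (ξ m ω) s)| ≤ 1 := by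
    intro m ω
    rw [abs_mul]
    refine mul_le_one₀ (hF _ _) (abs_nonneg _) ?_
    have h1 := X.nonneg (ξ m ω) s
    have h2 := X.le_one (ξ m ω) s
    rw [Set.indicator_apply, abs_le]
    split_ifs <;> constructor <;> linarith
  refine ae_tendsto_sum_div_of_orthogonal (fun m => ?_) hb fun i j hij => ?_
  · have := h.measurable_apply_traj (G m) (m + 2)
    simpa only [hGω m (m + 2) le_rfl] using this
  · have h1 := h.integral_mul_next hμ (fun l => G i l * F j l) j s
    have hi : ∀ ω, G i (traj ξ (j + 1) ω) = _ := hGω i (j + 1) (by omega)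
    rw [← sub_eq_zero, ← integral_sub] at h1
    · rw [← h1]
      refine integral_congr_ae (ae_of_all _ fun ω => ?_)
      simp only [hi]
      ring
    · have := h.integrable_apply_traj (fun l => G i (l.take (j + 1)) * F j (l.take (j + 1)) *
        (if l[j + 1]? = some s then 1 else 0)) (j + 2)
      refine this.congr (ae_of_all _ fun ω => ?_)
      simp only
      rw [take_traj (by omega), List.getElem?_eq_getElem (by rw [length_traj]; omega), getElem_traj]
      simp [Set.indicator_apply]
    · have := h.integrable_apply_traj (fun l => G i l * F j l *
        (l[j]?.map fun a => X.p a s).getD 0) (j + 1)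
      refine this.congr (ae_of_all _ fun ω => ?_)
      simp only
      rw [List.getElem?_eq_getElem (by rw [length_traj]; omega), getElem_traj]
      simp

end HasMarkovLaw

end MarkovChain

/-! ### Frequencies of words along a trajectory -/

theorem concat_suffix_concat_iff {S : Type*} {w l : List S} {s x : S} :
    w ++ [s] <:+ l ++ [x] ↔ w <:+ l ∧ s = x := by
  rw [← List.reverse_prefix, List.reverse_append, List.reverse_append,
    ← List.reverse_prefix (l₁ := w)]
  simp only [List.reverse_singleton, List.singleton_append, List.cons_prefix_cons]
  exact and_comm

section EndCount

variable {S Ω : Type*} {ξ : ℕ → Ω → S}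

open Classical in
/-- The number of occurrences of `w` in the first `n` states, counted by their last letter. -/
noncomputable def endCount (ξ : ℕ → Ω → S) (w : List S) (n : ℕ) (ω : Ω) : ℕ :=
  ((Finset.range n).filter fun m => w <:+ traj ξ (m + 1) ω).card

open Classical in
theorem endCount_eq_sum (w : List S) (n : ℕ) (ω : Ω) : (endCount ξ w n ω : ℝ) =
    ∑ m ∈ Finset.range n, if w <:+ traj ξ (m + 1) ω then 1 else 0 := by
  rw [endCount, Finset.sum_boole]

theorem endCount_succ_le (w : List S) (n : ℕ) (ω : Ω) :
    (endCount ξ w n ω : ℝ) ≤ endCount ξ w (n + 1) ω ∧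
      (endCount ξ w (n + 1) ω : ℝ) ≤ endCount ξ w n ω + 1 := by
  rw [endCount_eq_sum, endCount_eq_sum, Finset.sum_range_succ]
  split_ifs <;> constructor <;> linarith

open Classical in
theorem endCount_concat (w : List S) (s : S) (n : ℕ) (ω : Ω) :
    (endCount ξ (w ++ [s]) (n + 1) ω : ℝ) = (∑ m ∈ Finset.range n,
      (if w <:+ traj ξ (m + 1) ω then 1 else 0) *
        {ω | ξ (m + 1) ω = s}.indicator (fun _ => (1 : ℝ)) ω) +
      if w ++ [s] <:+ traj ξ 1 ω then 1 else 0 := by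
  rw [endCount_eq_sum, Finset.sum_range_succ']
  congr 1
  refine Finset.sum_congr rfl fun m _ => ?_
  rw [traj_succ (m + 1), Set.indicator_apply]
  simp only [concat_suffix_concat_iff, Set.mem_ofPred_eq, eq_comm (a := s), ite_and, mul_ite,
    mul_one, mul_zero]
  split_ifs <;> rfl

theorem sum_endCount_singleton [Fintype S] (n : ℕ) (ω : Ω) (f : S → ℝ) :
    ∑ s, (endCount ξ [s] n ω : ℝ) * f s = ∑ m ∈ Finset.range n, f (ξ m ω) := by
  classical
  simp only [endCount_eq_sum, Finset.sum_mul]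
  rw [Finset.sum_comm]
  refine Finset.sum_congr rfl fun m _ => ?_
  have e : ∀ s, [s] <:+ traj ξ (m + 1) ω ↔ s = ξ m ω := by
    intro s
    rw [traj_succ, ← List.nil_append [s], concat_suffix_concat_iff]
    simp
  simp [e]

/-- The frequencies of the words along a trajectory obey the transition law asymptotically. -/
def IsTypical [Fintype S] (X : MarkovChain S) (ξ : ℕ → Ω → S) (ω : Ω) : Prop :=
  ∀ w s, Tendsto (fun n : ℕ => ((endCount ξ (w ++ [s]) n ω : ℝ) - ∑ m ∈ Finset.range n,
    ({ω | w <:+ traj ξ (m + 1) ω}.indicator (fun _ => (1 : ℝ)) ω) * X.p (ξ m ω) s) / n) atTop (𝓝 0)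

end EndCount

namespace MarkovChain

variable {S Ω : Type*} [Fintype S] {X : MarkovChain S} {ξ : ℕ → Ω → S}

/-- The centred indicators of a transition out of `w` are orthogonal by the Markov property, so the
law of large numbers applies. -/
theorem HasMarkovLaw.ae_isTypical [MeasurableSpace Ω] {μ : S → ℝ} (hμ : IsDistribution μ)
    {P : Measure Ω} [IsProbabilityMeasure P] (h : X.HasMarkovLaw μ P ξ) :
    ∀ᵐ ω ∂P, IsTypical X ξ ω := by
  classical
  simp only [IsTypical]
  rw [ae_all_iff]
  intro w
  rw [ae_all_iff]
  intro s
  have h1 := h.ae_tendsto_sum_next hμ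
    (F := fun _ l => if w <:+ l then 1 else 0) (fun n l => by split_ifs <;> simp) s
  filter_upwards [h1] with ω hω
  have h2 := hω.add (tendsto_const_div_atTop_nhds_zero_nat (2 : ℝ))
  have h3 := hω.sub (tendsto_const_div_atTop_nhds_zero_nat (2 : ℝ))
  rw [add_zero] at h2
  rw [sub_zero] at h3
  have key : ∀ n : ℕ, |((endCount ξ (w ++ [s]) n ω : ℝ) - ∑ m ∈ Finset.range n,
      ({ω | w <:+ traj ξ (m + 1) ω}.indicator (fun _ => (1 : ℝ)) ω) * X.p (ξ m ω) s) -
      ∑ m ∈ Finset.range n, (if w <:+ traj ξ (m + 1) ω then (1 : ℝ) else 0) *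
        ({ω | ξ (m + 1) ω = s}.indicator (fun _ => (1 : ℝ)) ω - X.p (ξ m ω) s)| ≤ 2 := by
    intro n
    have h4 := endCount_succ_le (ξ := ξ) (w ++ [s]) n ω
    have h5 := endCount_concat (ξ := ξ) w s n ω
    simp only [mul_sub, Finset.sum_sub_distrib]
    have h6 : ∀ m, {ω | w <:+ traj ξ (m + 1) ω}.indicator (fun _ => (1 : ℝ)) ω =
        if w <:+ traj ξ (m + 1) ω then (1 : ℝ) else 0 := fun m => by
      rw [Set.indicator_apply]; rfl
    simp only [h6]
    rw [abs_le]
    split_ifs at h5 <;> constructor <;> linarith [h4.1, h4.2]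
  refine tendsto_of_tendsto_of_tendsto_of_le_of_le h3 h2 (fun n => ?_) (fun n => ?_)
  · simp only
    rw [← sub_div]
    exact div_le_div_of_nonneg_right (by linarith [(abs_le.1 (key n)).1]) (Nat.cast_nonneg n)
  · simp only
    rw [← add_div]
    exact div_le_div_of_nonneg_right (by linarith [(abs_le.1 (key n)).2]) (Nat.cast_nonneg n)

end MarkovChain

namespace IsTypical

variable {S Ω : Type*} [Fintype S] {X : MarkovChain S} {ξ : ℕ → Ω → S} {ω : Ω}

/-- Typicality for the empty word says that the occupation frequencies are asymptotically invariant.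
-/
theorem tendsto_occupation (h : IsTypical X ξ ω) (s : S) :
    Tendsto (fun n : ℕ => (endCount ξ [s] n ω : ℝ) / n -
      ∑ r, (endCount ξ [r] n ω : ℝ) / n * X.p r s) atTop (𝓝 0) := by
  refine (h [] s).congr fun n => ?_
  have h1 := sum_endCount_singleton (ξ := ξ) n ω fun r => X.p r s
  simp only [List.nil_append, List.nil_suffix, Set.ofPred_true, Set.indicator_univ, one_mul]
  rw [sub_div, ← h1]
  simp only [div_mul_eq_mul_div, Finset.sum_div]

theorem occupation_mem_stdSimplex {n : ℕ} (hn : 0 < n) :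
    (fun s => (endCount ξ [s] n ω : ℝ) / n) ∈ stdSimplex ℝ S := by
  refine ⟨fun s => by positivity, ?_⟩
  have h1 := sum_endCount_singleton (ξ := ξ) n ω fun _ => 1
  simp only [mul_one] at h1
  rw [← Finset.sum_div, h1]
  simp [hn.ne']

theorem isStationary_of_mapClusterPt (h : IsTypical X ξ ω) {y : S → ℝ} (hy : y ∈ stdSimplex ℝ S)
    (hc : MapClusterPt y atTop fun n : ℕ => fun s => (endCount ξ [s] n ω : ℝ) / n) :
    X.IsStationary y := by
  refine ⟨hy, fun s => ?_⟩
  set Φ : (S → ℝ) → ℝ := fun x => x s - ∑ r, x r * X.p r s with hΦ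
  have hcont : Continuous Φ := by fun_prop
  have h1 := hc.continuousAt_comp hcont.continuousAt
  have h2 : Tendsto (Φ ∘ fun n : ℕ => fun s => (endCount ξ [s] n ω : ℝ) / n) atTop (𝓝 0) :=
    h.tendsto_occupation s
  have h3 : Φ y = 0 := by
    have : (𝓝 (Φ y) ⊓ 𝓝 0).NeBot := h1.neBot.mono (inf_le_inf_left _ h2)
    exact eq_of_nhds_neBot this
  simp only [hΦ] at h3
  linarith

theorem exists_isStationary (h : IsTypical X ξ ω) : ∃ μ₀, X.IsStationary μ₀ := by
  have h1 : ∀ᶠ n : ℕ in atTop, (fun s => (endCount ξ [s] n ω : ℝ) / n) ∈ stdSimplex ℝ S := by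
    filter_upwards [eventually_gt_atTop 0] with n hn using occupation_mem_stdSimplex hn
  obtain ⟨y, hy, hc⟩ := (isCompact_stdSimplex ℝ S).exists_mapClusterPt_of_frequently h1.frequently
  exact ⟨y, h.isStationary_of_mapClusterPt hy hc⟩

/-- By induction on the length of the word; for single states by compactness of the simplex and
uniqueness of the stationary distribution. -/
theorem tendsto_frequency (h : IsTypical X ξ ω) (hX : X.IsIrreducible) {μ₀ : S → ℝ}
    (hμ₀ : X.IsStationary μ₀) {w : List S} (hw : w ≠ []) :
    Tendsto (fun n : ℕ => (endCount ξ w n ω : ℝ) / n) atTop (𝓝 (X.wordProb μ₀ w)) := by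
  induction w using List.reverseRecOn with
  | nil => exact absurd rfl hw
  | append_singleton w s ih =>
    rcases List.eq_nil_or_concat' w with rfl | ⟨u, a, rfl⟩
    · have h1 : ∀ᶠ n : ℕ in atTop, (fun s => (endCount ξ [s] n ω : ℝ) / n) ∈ stdSimplex ℝ S := by
        filter_upwards [eventually_gt_atTop 0] with n hn using occupation_mem_stdSimplex hn
      have h2 := (isCompact_stdSimplex ℝ S).tendsto_nhds_of_unique_mapClusterPt h1
        (y := μ₀) fun y hy hc => (h.isStationary_of_mapClusterPt hy hc).unique hX hμ₀
      simpa [MarkovChain.wordProb, MarkovChain.pathProb] using (tendsto_pi_nhds.1 h2) s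
    · have h1 := (h (u ++ [a]) s).add ((ih (by simp)).mul_const (X.p a s))
      rw [zero_add] at h1
      rw [MarkovChain.wordProb_append X μ₀ (by simp)]
      simp only [List.getLast_append_singleton, MarkovChain.pathProb, mul_one]
      refine h1.congr fun n => ?_
      have h2 : ∑ m ∈ Finset.range n, ({ω | u ++ [a] <:+ traj ξ (m + 1) ω}.indicator
          (fun _ => (1 : ℝ)) ω) * X.p (ξ m ω) s = endCount ξ (u ++ [a]) n ω * X.p a s := by
        classical
        rw [endCount_eq_sum, Finset.sum_mul]
        refine Finset.sum_congr rfl fun m _ => ?_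
        rw [Set.indicator_apply]
        simp only [Set.mem_ofPred_eq]
        split_ifs with h3
        · rw [traj_succ, concat_suffix_concat_iff] at h3
          rw [h3.2]
        · simp
      rw [h2]
      ring

end IsTypical

/-! ### Trajectories do not retrace themselves -/

namespace MarkovChain

variable {S Ω : Type*} [Fintype S] {X : MarkovChain S} {ξ : ℕ → Ω → S}

/-- For a deterministic chain the trajectories are periodic; if the end of a trajectory is the
mirror image of its beginning, then by periodicity so is the middle, which is impossible. -/
theorem exists_not_mirror_of_deterministic (hX : X.IsIrreducible) (hdet : ∀ a, ∃ y, X.p a y = 1)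
    {R : S → S → Prop} (hirr : ∀ a, ¬ R a a) (htr : ∀ a b, 0 < X.p a b → ¬ R a b) {x : ℕ → S}
    (hx : ∀ i, 0 < X.p (x i) (x (i + 1))) :
    ∀ᶠ n in atTop, ∃ i < n / 4, ¬ R (x i) (x (n - 1 - i)) := by
  choose nxt hnxt using hdet
  have hsurj : Function.Surjective nxt := by
    intro s
    obtain ⟨n, hn⟩ := hX s s
    rcases n with _ | n
    · exact ⟨s, (eq_of_p_eq_one (hnxt s) hn).symm⟩
    · obtain ⟨r, -, hr⟩ := exists_step_of_step_succ_pos hn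
      exact ⟨r, (eq_of_p_eq_one (hnxt r) hr).symm⟩
  set σ : Equiv.Perm S := Equiv.ofBijective nxt ⟨Finite.injective_iff_surjective.2 hsurj, hsurj⟩
  have hσ : ∀ i k, x (i + k) = (σ ^ k) (x i) := by
    intro i k
    induction k with
    | zero => rfl
    | succ k ih =>
      rw [pow_succ', Equiv.Perm.mul_apply, ← ih]
      exact eq_of_p_eq_one (hnxt _) (hx (i + k))
  set T := orderOf σ
  have hT : 0 < T := orderOf_pos σ
  have hper : ∀ i, x (i + T) = x i := by
    intro i
    rw [hσ, pow_orderOf_eq_one]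
    rfl
  filter_upwards [eventually_ge_atTop (4 * (T + 1))] with n hn
  by_contra! h
  have key : ∀ i, i < n → R (x i) (x (n - 1 - i)) := by
    intro i
    induction i using Nat.strong_induction_on with
    | _ i ih =>
      intro hi
      by_cases h1 : i < n / 4
      · exact h i h1
      · have h2 := ih (i - T) (by omega) (by omega)
        have e1 : x i = x (i - T) := by
          rw [← hper (i - T)]
          congr 1
          omega
        have e2 : x (n - 1 - (i - T)) = x (n - 1 - i) := by
          rw [← hper (n - 1 - i)]
          congr 1
          omega
        rwa [e1, ← e2]
  rcases Nat.even_or_odd' (n - 1) with ⟨i, hi | hi⟩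
  · have := key i (by omega)
    rw [show n - 1 - i = i by omega] at this
    exact hirr _ this
  · have := key i (by omega)
    rw [show n - 1 - i = i + 1 by omega] at this
    exact htr _ _ (hx i) this

theorem summable_pow_div {θ : ℝ} (h0 : 0 ≤ θ) (h1 : θ < 1) {M : ℕ} (hM : 0 < M) :
    Summable fun n : ℕ => θ ^ (n / M) := by
  have _ : NeZero M := ⟨hM.ne'⟩
  have h2 : Summable fun q : ℕ × Fin M => θ ^ q.1 * (1 : ℝ) :=
    (summable_geometric_of_lt_one h0 h1).mul_of_nonneg (g := fun _ : Fin M => (1 : ℝ))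
      (Summable.of_finite) (fun n => pow_nonneg h0 n) fun _ => zero_le_one
  refine ((Nat.divModEquiv M).summable_iff.2 h2).congr fun n => ?_
  simp [Nat.divModEquiv]

namespace HasMarkovLaw

variable [MeasurableSpace Ω] {μ : S → ℝ} {P : Measure Ω} [IsProbabilityMeasure P]

/-- The probability that the states after time `r` are a prescribed function of the first `r`. -/
theorem measure_traj_eq_append_le (hμ : IsDistribution μ) (h : X.HasMarkovLaw μ P ξ) {r m : ℕ}
    (hr : 0 < r) (φ : List S → List S) (hφ : ∀ u : List S, u.length = r → (φ u).length = m) {q : ℝ}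
    (hq : ∀ s w, w.length = m → X.pathProb s w ≤ q) :
    P {ω | traj ξ (r + m) ω = traj ξ r ω ++ φ (traj ξ r ω)} ≤ ENNReal.ofReal q := by
  have h1 : {ω | traj ξ (r + m) ω = traj ξ r ω ++ φ (traj ξ r ω)} ⊆
      ⋃ u : Fin r → S, {ω | traj ξ (r + m) ω = List.ofFn u ++ φ (List.ofFn u)} :=
    fun ω hω => Set.mem_iUnion.2 ⟨fun i => ξ i ω, hω⟩
  have hsum : ∑ u : Fin r → S, X.wordProb μ (List.ofFn u) = 1 := by
    have h2 := h.setIntegral_apply_traj (fun _ => 1) r MeasurableSet.univ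
    simp only [Set.indicator_univ, mul_one, one_mul, Set.inter_univ] at h2
    rw [integral_const, probReal_univ, one_smul] at h2
    rw [h2]
    refine Finset.sum_congr rfl fun u _ => ?_
    have h3 := h.measure_traj_eq (List.ofFn u)
    rw [List.length_ofFn] at h3
    rw [Measure.real, h3, ENNReal.toReal_ofReal (X.wordProb_nonneg hμ.1 _)]
  calc P {ω | traj ξ (r + m) ω = traj ξ r ω ++ φ (traj ξ r ω)}
      ≤ ∑ u : Fin r → S, P {ω | traj ξ (r + m) ω = List.ofFn u ++ φ (List.ofFn u)} :=
        (measure_mono h1).trans (measure_iUnion_fintype_le _ _)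
    _ ≤ ∑ u : Fin r → S, ENNReal.ofReal (X.wordProb μ (List.ofFn u) * q) := by
        refine Finset.sum_le_sum fun u _ => ?_
        have hne : List.ofFn u ≠ [] := by
          rw [Ne, List.ofFn_eq_nil_iff]
          omega
        have hlen := hφ (List.ofFn u) (by simp)
        have h3 := h.measure_traj_eq (List.ofFn u ++ φ (List.ofFn u))
        rw [List.length_append, List.length_ofFn, hlen, wordProb_append X μ hne] at h3
        rw [h3]
        exact ENNReal.ofReal_le_ofReal
          (mul_le_mul_of_nonneg_left (hq _ _ hlen) (X.wordProb_nonneg hμ.1 _))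
    _ = ENNReal.ofReal q := by
        have hq0 : Nonempty (Fin r → S) → 0 ≤ q := fun ⟨u⟩ =>
          (X.pathProb_nonneg (u ⟨0, hr⟩) _).trans (hq (u ⟨0, hr⟩) _ (hφ (List.ofFn u) (by simp)))
        rw [← ENNReal.ofReal_sum_of_nonneg fun u _ =>
          mul_nonneg (X.wordProb_nonneg hμ.1 _) (hq0 ⟨u⟩), ← Finset.sum_mul, hsum, one_mul]

/-- Almost surely the last quarter of the trajectory is, for large times, not the mirror image of
the first. The relation `R a b` stands for `b = a⁻¹`. -/
theorem ae_eventually_not_mirror (hX : X.IsIrreducible) (hμ : IsDistribution μ)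
    (h : X.HasMarkovLaw μ P ξ) {R : S → S → Prop} (hfun : ∀ a b b', R a b → R a b' → b = b')
    (hirr : ∀ a, ¬ R a a) (htr : ∀ a b, 0 < X.p a b → ¬ R a b) :
    ∀ᵐ ω ∂P, ∀ᶠ n in atTop, ∃ i < n / 4, ¬ R (ξ i ω) (ξ (n - 1 - i) ω) := by
  classical
  by_cases hdet : ∀ a, ∃ y, X.p a y = 1
  · filter_upwards [h.ae_p_pos hμ] with ω hω
    exact exists_not_mirror_of_deterministic hX hdet hirr htr hω
  push Not at hdet
  obtain ⟨a, ha⟩ := hdet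
  have _ : Nonempty S := ⟨a⟩
  obtain ⟨K, hK⟩ := exists_pathProb_lt_one hX ha
  have hK0 : 0 < K := by
    rcases Nat.eq_zero_or_pos K with rfl | hK0
    · exact absurd (hK a [] rfl) (lt_irrefl _)
    · exact hK0
  obtain ⟨θ, hθ1, hθ0, hθ⟩ := exists_pathProb_le hK
  -- the state forced by the mirror condition
  set c : S → S := fun b => if hb : ∃ b', R b b' then hb.choose else b with hc
  have hcR : ∀ b b', R b b' → b' = c b := by
    intro b b' hb
    have hb' : ∃ b', R b b' := ⟨b', hb⟩
    simp only [hc, dif_pos hb']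
    exact hfun _ _ _ hb hb'.choose_spec
  have hbound : ∀ n, P {ω | ∀ i < n / 4, R (ξ i ω) (ξ (n - 1 - i) ω)} ≤
      ENNReal.ofReal (θ ^ (n / (4 * K))) := by
    intro n
    rcases Nat.eq_zero_or_pos n with rfl | hn
    · simp
    obtain ⟨r, hr⟩ : ∃ r, n = r + n / 4 := ⟨n - n / 4, by omega⟩
    set m := n / 4 with hm
    refine (measure_mono ?_).trans (h.measure_traj_eq_append_le hμ (r := r) (m := m) (by omega)
      (fun u => (u.take m).reverse.map c) ?_ (q := θ ^ (n / (4 * K))) ?_)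
    · intro ω hω
      rw [Set.mem_ofPred_eq, take_traj (by omega)]
      apply List.ext_getElem
      · simp
      · intro i h1 h2
        rw [getElem_traj, List.getElem_append]
        split_ifs with h3
        · rw [getElem_traj]
        · rw [length_traj] at h1 h3
          rw [List.getElem_map, List.getElem_reverse, getElem_traj]
          simp only [length_traj]
          have h4 := hcR _ _ (hω (m - 1 - (i - r)) (by omega))
          rwa [show n - 1 - (m - 1 - (i - r)) = i by omega] at h4
    · intro u hu
      simp only [List.length_map, List.length_reverse, List.length_take]
      omega
    · intro s w hw
      refine pathProb_le_pow hθ _ s w ?_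
      rw [hw, ← Nat.div_div_eq_div_mul, ← hm, mul_comm]
      exact Nat.div_mul_le_self m K
  have hsum : ∑' n, P {ω | ∀ i < n / 4, R (ξ i ω) (ξ (n - 1 - i) ω)} ≠ ∞ := by
    have h1 := summable_pow_div hθ0 hθ1 (show 0 < 4 * K by omega)
    exact ne_top_of_le_ne_top h1.tsum_ofReal_ne_top (ENNReal.tsum_le_tsum hbound)
  filter_upwards [ae_eventually_notMem hsum] with ω hω
  filter_upwards [hω] with n hn
  by_contra! h'
  exact hn h'

end HasMarkovLaw

end MarkovChain

/-! ### Cyclic reductions and closings -/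

namespace SerreGraph

variable {V E : Type*} {Γ : SerreGraph V E}

theorem invPath_invPath (l : List E) : Γ.invPath (Γ.invPath l) = l := by
  simp only [invPath, List.map_reverse, List.reverse_reverse, List.map_map]
  exact (List.map_congr_left fun e _ => Γ.inv_inv e).trans (List.map_id' l)

theorem invPath_concat (l : List E) (e : E) : Γ.invPath (l ++ [e]) = Γ.inv e :: Γ.invPath l := by
  simp [invPath]

@[simp]
theorem length_invPath (l : List E) : (Γ.invPath l).length = l.length := by simp [invPath]

theorem IsPath.eq_of_invPath {u v w : V} {l : List E} (h : Γ.IsPath u l v)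
    (h' : Γ.IsPath w (Γ.invPath l) u) : w = v := by
  have := h'.invPath
  rw [invPath_invPath] at this
  exact this.endpoint_unique h

/-- The maximal cyclic reduction cuts off a path and its inverse. -/
theorem exists_eq_append_cyc (l : List E) : ∃ u, l = u ++ Γ.cyc l ++ Γ.invPath u := by
  classical
  induction l using List.bidirectionalRec with
  | nil => exact ⟨[], by simp [cyc, invPath]⟩
  | singleton e => exact ⟨[], by simp [cyc, invPath]⟩
  | cons_append e l f ih =>
    have h1 : Γ.cyc (e :: (l ++ [f])) = if f = Γ.inv e then Γ.cyc l else e :: l ++ [f] := by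
      rw [cyc, List.bidirectionalRec_cons_append]
      rfl
    rw [h1]
    split_ifs with hf
    · obtain ⟨u, hu⟩ := ih
      refine ⟨e :: u, ?_⟩
      conv_lhs => rw [hu]
      simp [invPath, hf]
    · exact ⟨[], by simp [invPath]⟩

/-- The maximal cyclic reduction cannot be reduced further. -/
theorem cyc_ends (l : List E) {e f : E} {m : List E} (h : Γ.cyc l = e :: (m ++ [f])) :
    f ≠ Γ.inv e := by
  classical
  induction l using List.bidirectionalRec with
  | nil => simp [cyc] at h
  | singleton a =>
    have := congrArg List.length h
    simp [cyc] at this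
  | cons_append a l b ih =>
    have h1 : Γ.cyc (a :: (l ++ [b])) = if b = Γ.inv a then Γ.cyc l else a :: l ++ [b] := by
      rw [cyc, List.bidirectionalRec_cons_append]
      rfl
    rw [h1] at h
    split_ifs at h with hf
    · exact ih h
    · rw [List.cons_append] at h
      obtain ⟨rfl, h2⟩ := List.cons.inj h
      obtain ⟨-, rfl⟩ := List.append_singleton_inj.1 h2
      exact hf

theorem IsReducedPath.cyc_ne_nil {l : List E} (h : Γ.IsReducedPath l) (h0 : l ≠ []) :
    Γ.cyc l ≠ [] := by
  intro hc
  obtain ⟨u, hu⟩ := exists_eq_append_cyc (Γ := Γ) l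
  rw [hc, List.append_nil] at hu
  rcases List.eq_nil_or_concat' u with rfl | ⟨u, e, rfl⟩
  · exact h0 (by simpa [SerreGraph.invPath] using hu)
  · rw [hu, invPath_concat, List.append_assoc] at h
    have h1 := (List.isChain_append.1 h).2.1
    rw [List.singleton_append] at h1
    exact (List.isChain_cons_cons.1 h1).1.2 rfl

/-- The maximal cyclic reduction of a closed reduced path is a cyclically reduced closed path. -/
theorem IsReducedPath.cyc_cyclicallyReduced {l : List E} (h : Γ.IsReducedPath l)
    (hcl : Γ.IsClosedPath l) {e : E} {m : List E} (hm : Γ.cyc l = e :: m) :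
    Γ.IsReducedPath (e :: m ++ [e]) := by
  obtain ⟨v, hv⟩ := hcl
  obtain ⟨u, hu⟩ := exists_eq_append_cyc (Γ := Γ) l
  rw [hm] at hu
  have hred : Γ.IsReducedPath (e :: m) :=
    List.IsChain.infix h ⟨u, Γ.invPath u, hu.symm⟩
  rw [hu, isPath_append_iff] at hv
  obtain ⟨z, hz, hz'⟩ := hv
  obtain ⟨y, hy, hyz⟩ := isPath_append_iff.1 hz
  have hzy : z = y := hy.eq_of_invPath hz'
  have hend : z = Γ.t ((e :: m).getLast (List.cons_ne_nil _ _)) := by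
    have h1 := hred.isPath
    rw [hyz.1] at h1
    exact hyz.endpoint_unique h1
  refine List.isChain_append.2 ⟨hred, List.isChain_singleton _, ?_⟩
  intro a ha b hb
  obtain rfl : e = b := by simpa using hb
  rw [List.getLast?_eq_some_getLast (List.cons_ne_nil e m)] at ha
  obtain rfl := Option.some.inj ha
  refine ⟨by rw [← hend, hzy, hyz.1], fun h1 => ?_⟩
  rcases List.eq_nil_or_concat' m with rfl | ⟨m, f, rfl⟩
  · exact Γ.inv_ne e h1.symm
  · refine cyc_ends l hm ?_
    have h2 : (e :: (m ++ [f])).getLast (List.cons_ne_nil _ _) = f := by simp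
    rw [h2] at h1
    rw [h1, Γ.inv_inv]

theorem closing_cyclicallyReduced {β : E → E → List E} (hβ : Γ.IsClosingSystem β) {e : E}
    {m : List E} (h : Γ.IsReducedPath (e :: m)) :
    Γ.IsReducedPath (closing β (e :: m) ++ [e]) := by
  have h1 := (hβ ((e :: m).getLast (List.cons_ne_nil _ _)) e).2
  rw [closing, List.append_assoc]
  have h2 := List.dropLast_append_getLast (List.cons_ne_nil e m)
  have h3 : Γ.IsReducedPath ((e :: m).dropLast ++ [(e :: m).getLast (List.cons_ne_nil e m)]) := by
    rw [h2]; exact h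
  have h4 : Γ.IsReducedPath ([(e :: m).getLast (List.cons_ne_nil e m)] ++
      (β ((e :: m).getLast (List.cons_ne_nil e m)) e ++ [e])) := h1
  have h5 := List.IsChain.append_overlap h3 h4 (by simp)
  rwa [h2] at h5

theorem exists_length_closing_le [Finite E] (β : E → E → List E) :
    ∃ B, ∀ e e', (β e e').length ≤ B := by
  obtain ⟨B, hB⟩ := (Set.finite_range fun q : E × E => (β q.1 q.2).length).bddAbove
  exact ⟨B, fun e e' => hB ⟨(e, e'), rfl⟩⟩

theorem length_modifiedClosing_le {β : E → E → List E} {B : ℕ}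
    (hB : ∀ e e', (β e e').length ≤ B) (l : List E) :
    (Γ.modifiedClosing β l).length ≤ l.length + B := by
  rw [modifiedClosing]
  split_ifs
  · obtain ⟨u, hu⟩ := exists_eq_append_cyc (Γ := Γ) l
    have := congrArg List.length hu
    simp only [List.length_append] at this
    omega
  · rcases l with _ | ⟨e, l⟩
    · simp [closing]
    · rw [closing, List.length_append]
      exact Nat.add_le_add_left (hB _ _) _

/-- The modified closing of a reduced path is a cyclically reduced closed path, and it differs
from the given path by a piece, its inverse, and a piece of bounded length. -/
theorem exists_modifiedClosing_eq {β : E → E → List E} (hβ : Γ.IsClosingSystem β) {B : ℕ}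
    (hB : ∀ e e', (β e e').length ≤ B) {l : List E} (h : Γ.IsReducedPath l) (h0 : l ≠ []) :
    ∃ e m u mid tail, Γ.modifiedClosing β l = e :: m ∧ Γ.IsReducedPath (e :: m ++ [e]) ∧
      l = u ++ mid ++ Γ.invPath u ∧ e :: m = mid ++ tail ∧ tail.length ≤ B := by
  rw [modifiedClosing]
  split_ifs with hcl
  · obtain ⟨e, m, hm⟩ := List.exists_cons_of_ne_nil (h.cyc_ne_nil h0)
    obtain ⟨u, hu⟩ := exists_eq_append_cyc (Γ := Γ) l
    exact ⟨e, m, u, Γ.cyc l, [], hm, h.cyc_cyclicallyReduced hcl hm, hu, by simp [hm], by simp⟩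
  · obtain ⟨e, m, rfl⟩ := List.exists_cons_of_ne_nil h0
    have h1 := closing_cyclicallyReduced hβ h
    refine ⟨e, m ++ β ((e :: m).getLast (List.cons_ne_nil _ _)) e, [], e :: m, _, rfl, h1, ?_,
      rfl, hB _ _⟩
    simp [invPath]

end SerreGraph

/-! ### Frequencies in cyclic words -/

section Occurrences

variable {E : Type*}

open Classical in
/-- The number of occurrences of `v` in the sequence `f` that start before time `n`. -/
noncomputable def occurrences (f : ℕ → E) (v : List E) (n : ℕ) : ℕ :=
  ((Finset.range n).filter fun m => ∀ j < v.length, some (f (m + j)) = v[j]?).card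

/-- A cyclic word that shares its first `L` letters with a segment of the sequence `f` has, up to a
bounded error, the same number of occurrences of `v`. -/
theorem abs_cyclicCount_sub_le {f : ℕ → E} {v w : List E} {k L : ℕ} (hL : L ≤ w.length)
    (hc : ∀ i < L, w[i]? = some (f (k + i))) :
    |(cyclicCount w v : ℝ) - ((occurrences f v (k + L) : ℝ) - occurrences f v k)| ≤
      v.length + (w.length - L) := by
  classical
  set a : ℕ → ℝ := fun i => if ∀ j < v.length, w[(i + j) % w.length]? = v[j]? then 1 else 0
    with ha
  set b : ℕ → ℝ := fun i => if ∀ j < v.length, some (f (k + i + j)) = v[j]? then 1 else 0 with hb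
  have hab : ∀ x, (0 ≤ a x ∧ a x ≤ 1) ∧ (0 ≤ b x ∧ b x ≤ 1) := by
    intro x
    simp only [ha, hb]
    split_ifs <;> norm_num
  have e1 : (cyclicCount w v : ℝ) = ∑ i ∈ Finset.range w.length, a i := by
    rw [cyclicCount, Finset.sum_boole]
  have e2 : (occurrences f v (k + L) : ℝ) - occurrences f v k = ∑ i ∈ Finset.range L, b i := by
    rw [occurrences, occurrences, ← Finset.sum_boole, ← Finset.sum_boole,
      Finset.sum_range_add, add_sub_cancel_left]
  set L₀ := L - v.length with hL₀
  have e3 : ∑ i ∈ Finset.range L₀, a i = ∑ i ∈ Finset.range L₀, b i := by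
    refine Finset.sum_congr rfl fun i hi => ?_
    rw [Finset.mem_range] at hi
    simp only [ha, hb]
    congr 1
    refine propext (forall₂_congr fun j hj => ?_)
    rw [Nat.mod_eq_of_lt (by omega), hc _ (by omega), add_assoc]
  have h1 := Finset.sum_range_add_sum_Ico a (show L₀ ≤ w.length by omega)
  have h2 := Finset.sum_range_add_sum_Ico b (show L₀ ≤ L by omega)
  have h3 : ∑ i ∈ Finset.Ico L₀ w.length, a i ≤ w.length - L₀ := by
    refine (Finset.sum_le_sum fun i _ => (hab i).1.2).trans ?_
    rw [Finset.sum_const, Nat.card_Ico, nsmul_eq_mul, mul_one, Nat.cast_sub (by omega)]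
  have h4 : ∑ i ∈ Finset.Ico L₀ L, b i ≤ L - L₀ := by
    refine (Finset.sum_le_sum fun i _ => (hab i).2.2).trans ?_
    rw [Finset.sum_const, Nat.card_Ico, nsmul_eq_mul, mul_one, Nat.cast_sub (by omega)]
  have h5 : 0 ≤ ∑ i ∈ Finset.Ico L₀ w.length, a i := Finset.sum_nonneg fun i _ => (hab i).1.1
  have h6 : 0 ≤ ∑ i ∈ Finset.Ico L₀ L, b i := Finset.sum_nonneg fun i _ => (hab i).2.1
  have h7 : (L : ℝ) ≤ L₀ + v.length := by exact_mod_cast (by omega : L ≤ L₀ + v.length)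
  have h8 : (L : ℝ) ≤ w.length := by exact_mod_cast hL
  rw [e1, e2, ← h1, ← h2, e3, abs_le]
  constructor <;> linarith

/-- If `x n = o(n)`, then also the maximum of `|x m|` over `m ≤ n` is `o(n)`. -/
theorem exists_forall_abs_le_of_tendsto {x : ℕ → ℝ}
    (hx : Tendsto (fun n : ℕ => x n / n) atTop (𝓝 0)) {ε : ℝ} (hε : 0 < ε) :
    ∃ N : ℕ, ∀ n, N ≤ n → ∀ m, m ≤ n → |x m| ≤ ε * n := by
  obtain ⟨M, hM⟩ := eventually_atTop.1 (Metric.tendsto_nhds.1 hx ε hε)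
  obtain ⟨C, hC⟩ := ((Set.finite_Iio (M + 1)).image fun m => |x m|).bddAbove
  refine ⟨⌈C / ε⌉₊, fun n hn m hm => ?_⟩
  by_cases h : m < M + 1
  · have h1 : |x m| ≤ C := hC ⟨m, h, rfl⟩
    have h2 : C / ε ≤ n := (Nat.le_ceil _).trans (by exact_mod_cast hn)
    rw [div_le_iff₀ hε] at h2
    linarith
  · have h1 := hM m (by omega)
    have hm0 : (0 : ℝ) < m := by exact_mod_cast (by omega : 0 < m)
    rw [dist_zero_right, Real.norm_eq_abs, abs_div, Nat.abs_cast, div_lt_iff₀ hm0] at h1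
    have h2 : (m : ℝ) ≤ n := by exact_mod_cast hm
    nlinarith

/-- If the cyclic words `w n` agree, up to pieces of bounded length, with long segments of the
sequence `f`, then they have the same frequencies of subwords. -/
theorem tendsto_cyclicCount_div {f : ℕ → E} {v : List E} {a : ℝ}
    (ha : Tendsto (fun n : ℕ => (occurrences f v n : ℝ) / n) atTop (𝓝 a)) {w : ℕ → List E}
    {B : ℕ} (h : ∀ᶠ n in atTop, ∃ k L, k + L ≤ n ∧ n ≤ 2 * L ∧ L ≤ (w n).length ∧
      (w n).length ≤ L + B ∧ ∀ i < L, (w n)[i]? = some (f (k + i))) :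
    Tendsto (fun n => (cyclicCount (w n) v : ℝ) / (w n).length) atTop (𝓝 a) := by
  have hx : Tendsto (fun n : ℕ => ((occurrences f v n : ℝ) - a * n) / n) atTop (𝓝 0) := by
    have h1 := ha.sub_const a
    rw [sub_self] at h1
    refine h1.congr' ?_
    filter_upwards [eventually_gt_atTop 0] with n hn
    have : (n : ℝ) ≠ 0 := by exact_mod_cast hn.ne'
    field_simp
  rw [Metric.tendsto_nhds]
  intro ε hε
  obtain ⟨N, hN⟩ := exists_forall_abs_le_of_tendsto hx (show 0 < ε / 8 by positivity)
  set D : ℝ := v.length + B + |a| * B with hD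
  have hlarge : ∀ᶠ n : ℕ in atTop, 8 * D / ε < n :=
    tendsto_natCast_atTop_atTop.eventually (eventually_gt_atTop _)
  filter_upwards [h, eventually_ge_atTop N, hlarge, eventually_gt_atTop 0] with n h1 h2 h3 h4
  obtain ⟨k, L, hk, hn, hL, hB, hc⟩ := h1
  have h5 := abs_cyclicCount_sub_le (v := v) hL hc
  have h6 := hN n h2 (k + L) hk
  have h7 := hN n h2 k (by omega)
  have hnL : (n : ℝ) ≤ 2 * L := by exact_mod_cast hn
  have hLc : (L : ℝ) ≤ (w n).length := by exact_mod_cast hL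
  have hcB : ((w n).length : ℝ) ≤ L + B := by exact_mod_cast hB
  have hn0 : (0 : ℝ) < n := by exact_mod_cast h4
  have hc0 : (0 : ℝ) < (w n).length := by linarith
  rw [div_lt_iff₀ hε] at h3
  have h8 : |a * ((w n).length - L)| ≤ |a| * B := by
    rw [abs_mul]
    refine mul_le_mul_of_nonneg_left ?_ (abs_nonneg a)
    rw [abs_of_nonneg (by linarith)]
    linarith
  have h9 : |(cyclicCount (w n) v : ℝ) - a * (w n).length| ≤ D + ε / 8 * n + ε / 8 * n := by
    push_cast at h6
    rw [abs_le] at h5 h6 h7 h8 ⊢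
    constructor <;> linarith [h5.1, h5.2, h6.1, h6.2, h7.1, h7.2, h8.1, h8.2]
  have e : (cyclicCount (w n) v : ℝ) / (w n).length - a =
      ((cyclicCount (w n) v : ℝ) - a * (w n).length) / (w n).length := by
    field_simp
  rw [Real.dist_eq, e, abs_div, abs_of_pos hc0, div_lt_iff₀ hc0]
  have h10 : ε * n ≤ ε * (2 * (w n).length) := mul_le_mul_of_nonneg_left (by linarith) hε.le
  have h11 : 0 < ε * n := mul_pos hε hn0
  linarith

end Occurrences

/-! ### Frequencies of edge-paths along a walk -/

namespace IsTypical

variable {E Ω : Type*} {S : Finset E} {X : MarkovChain S} {ξ : ℕ → Ω → S} {ω : Ω}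

theorem occurrences_map {w : List S} (hw : w ≠ []) (n : ℕ) :
    occurrences (fun i => (ξ i ω : E)) (w.map Subtype.val) n =
      endCount ξ w (n + (w.length - 1)) ω := by
  classical
  have hl : 0 < w.length := List.length_pos_iff.2 hw
  have e : ∀ m, (∀ j < (w.map Subtype.val).length,
      some (ξ (m + j) ω : E) = (w.map Subtype.val)[j]?) ↔
        w <:+ traj ξ (m + (w.length - 1) + 1) ω := by
    intro m
    have h1 : m + (w.length - 1) + 1 = m + w.length := by omega
    rw [h1, List.suffix_iff_eq_drop, length_traj, Nat.add_sub_cancel]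
    constructor
    · intro h
      apply List.ext_getElem
      · simp
      · intro i h2 h3
        have h4 := h i (by simpa using h2)
        rw [List.getElem?_eq_getElem (by simpa using h2), List.getElem_map, Option.some.injEq] at h4
        rw [List.getElem_drop, getElem_traj]
        exact (Subtype.ext h4).symm
    · intro h j hj
      rw [List.length_map] at hj
      have h2 : w[j]? = some (ξ (m + j) ω) := by
        rw [h, List.getElem?_drop, List.getElem?_eq_getElem (by rw [length_traj]; omega),
          getElem_traj]
      rw [List.getElem?_map, h2]
      rfl
  have h3 : ∀ m < w.length - 1, ¬ w <:+ traj ξ (m + 1) ω := by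
    intro m hm h
    have := h.length_le
    rw [length_traj] at this
    omega
  have h4 : (endCount ξ w (n + (w.length - 1)) ω : ℝ) =
      (occurrences (fun i => (ξ i ω : E)) (w.map Subtype.val) n : ℝ) := by
    rw [endCount_eq_sum, occurrences, ← Finset.sum_boole, add_comm n, Finset.sum_range_add,
      Finset.sum_eq_zero, zero_add]
    · refine Finset.sum_congr rfl fun m _ => ?_
      rw [add_comm (w.length - 1) m]
      by_cases hm : w <:+ traj ξ (m + (w.length - 1) + 1) ω
      · rw [if_pos hm, if_pos ((e m).2 hm)]
      · rw [if_neg hm, if_neg fun h => hm ((e m).1 h)]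
    · intro m hm
      rw [if_neg (h3 m (Finset.mem_range.1 hm))]
  exact_mod_cast h4.symm

theorem tendsto_occurrences (h : IsTypical X ξ ω) (hX : X.IsIrreducible) {μ₀ : S → ℝ}
    (hμ₀ : X.IsStationary μ₀) {v : List E} (hv : v ≠ []) :
    Tendsto (fun n : ℕ => (occurrences (fun i => (ξ i ω : E)) v n : ℝ) / n) atTop
      (𝓝 (Chart.pathWeight X μ₀ v)) := by
  classical
  rw [Chart.pathWeight]
  split_ifs with hS
  · set w := v.pmap Subtype.mk hS with hw
    have hvw : v = w.map Subtype.val := by rw [hw, List.map_pmap]; simp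
    have hw0 : w ≠ [] := by simpa [hw] using hv
    rw [hvw]
    simp only [occurrences_map hw0]
    set k := w.length - 1
    have h1 := (tendsto_add_atTop_iff_nat k).2 (h.tendsto_frequency hX hμ₀ hw0)
    have h2 : Tendsto (fun n : ℕ => ((n + k : ℕ) : ℝ) / n) atTop (𝓝 1) := by
      have h3 := (tendsto_const_div_atTop_nhds_zero_nat (k : ℝ)).const_add 1
      rw [add_zero] at h3
      refine h3.congr' ?_
      filter_upwards [eventually_gt_atTop 0] with n hn
      have : (n : ℝ) ≠ 0 := by exact_mod_cast hn.ne'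
      push_cast
      field_simp
    have h3 := h1.mul h2
    rw [mul_one] at h3
    refine h3.congr' ?_
    filter_upwards [eventually_gt_atTop 0] with n hn
    rw [div_mul_div_cancel₀]
    exact_mod_cast (by omega : n + k ≠ 0)
  · have h0 : ∀ n, occurrences (fun i => (ξ i ω : E)) v n = 0 := by
      intro n
      rw [occurrences, Finset.card_eq_zero, Finset.filter_eq_empty_iff]
      intro m _ hm
      apply hS
      intro e he
      obtain ⟨j, hj, rfl⟩ := List.getElem_of_mem he
      have h1 := hm j hj
      rw [List.getElem?_eq_getElem hj, Option.some.injEq] at h1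
      rw [← h1]
      exact (ξ (m + j) ω).2
    simp [h0]

end IsTypical

/-! ### Group elements of closed paths -/

namespace Chart

open SerreGraph

variable {A V E : Type*} [Fintype A] {Γ : Chart A V E}

theorem emb_marking_symm_mk {l : List E} (h : Γ.IsPath Γ.x₀ l Γ.x₀) :
    Γ.emb (Γ.marking.symm (Pi1.mk l h)) = Γ.word l := by
  rw [emb_apply, MulEquiv.apply_symm_apply, pi1Hom_mk]

theorem emb_pathElement {δ : V → List E} (hδ : ∀ v, Γ.IsPath Γ.x₀ (δ v) v) {e : E} {l : List E}
    (h : Γ.IsPath (Γ.o e) (e :: l) (Γ.o e)) :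
    Γ.emb (Γ.pathElement δ (e :: l)) =
      Γ.word (δ (Γ.o e)) * Γ.word (e :: l) * (Γ.word (δ (Γ.o e)))⁻¹ := by
  have h1 : Γ.IsPath Γ.x₀ (δ (Γ.o e) ++ (e :: l) ++ Γ.invPath (δ (Γ.o e))) Γ.x₀ :=
    ((hδ _).append h).append (hδ _).invPath
  rw [pathElement, dif_pos h1, emb_marking_symm_mk, word_append, word_append, word_invPath]

theorem isPath_of_cyclicallyReduced {e : E} {l : List E} (h : Γ.IsReducedPath (e :: l ++ [e])) :
    Γ.IsPath (Γ.o e) (e :: l) (Γ.o e) := by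
  have h1 := List.isChain_append.1 h
  have h2 := IsReducedPath.isPath h1.1
  rwa [(h1.2.2 _ (List.getLast?_eq_some_getLast (List.cons_ne_nil e l)) e rfl).1] at h2

theorem pathElement_ne_one {δ : V → List E} (hδ : ∀ v, Γ.IsPath Γ.x₀ (δ v) v) {e : E} {l : List E}
    (h : Γ.IsReducedPath (e :: l ++ [e])) : Γ.pathElement δ (e :: l) ≠ 1 := by
  intro h1
  have h2 := emb_pathElement hδ (isPath_of_cyclicallyReduced h)
  rw [h1, map_one, eq_comm, mul_inv_eq_one, mul_eq_left] at h2
  have h3 := toWord_word (List.isChain_append.1 h).1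
  rw [h2, FreeGroup.toWord_one] at h3
  simp at h3

/-- The group element of an edge-path, closed up by the paths `δ`, is a product of contributions of
the edges. Hence its length with respect to any basis is at most linear. -/
theorem exists_norm_le_mul_length {B : Type*} [DecidableEq B] {δ : V → List E}
    (hδ : ∀ v, Γ.IsPath Γ.x₀ (δ v) v) (φ : FreeGroup A →* FreeGroup B) :
    ∃ M : ℕ, ∀ y c z, Γ.IsPath y c z → ∃ g, (φ g).norm ≤ M * c.length ∧
      Γ.emb g = Γ.word (δ y) * Γ.word c * (Γ.word (δ z))⁻¹ := by
  have h1 : ∀ e, Γ.IsPath Γ.x₀ (δ (Γ.o e) ++ [e] ++ Γ.invPath (δ (Γ.t e))) Γ.x₀ := fun e =>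
    ((hδ _).append (isPath_singleton.2 ⟨rfl, rfl⟩)).append (hδ _).invPath
  set κ : E → FreeGroup A := fun e => Γ.marking.symm (Pi1.mk _ (h1 e)) with hκ
  have hκe : ∀ e, Γ.emb (κ e) = Γ.word (δ (Γ.o e)) * Γ.word [e] * (Γ.word (δ (Γ.t e)))⁻¹ := by
    intro e
    rw [hκ, emb_marking_symm_mk, word_append, word_append, word_invPath]
  have _ := Γ.finite_E
  obtain ⟨M, hM⟩ := (Set.finite_range fun e => (φ (κ e)).norm).bddAbove
  refine ⟨M, fun y c z h => ?_⟩
  induction c generalizing y with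
  | nil =>
    obtain rfl : y = z := h
    exact ⟨1, by simp, by simp [word_nil]⟩
  | cons e c ih =>
    obtain ⟨rfl, h2⟩ := h
    obtain ⟨g, h3, h4⟩ := ih _ h2
    refine ⟨κ e * g, ?_, ?_⟩
    · rw [map_mul, List.length_cons, mul_add, mul_one, add_comm]
      exact (FreeGroup.norm_mul_le _ _).trans (add_le_add (hM ⟨e, rfl⟩) h3)
    · rw [map_mul, hκe, h4, word_cons Γ.toSerreGraph e c]
      group

theorem exists_norm_pathElement_le {B : Type*} [DecidableEq B] {δ : V → List E}
    (hδ : ∀ v, Γ.IsPath Γ.x₀ (δ v) v) (φ : FreeGroup A →* FreeGroup B) :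
    ∃ M : ℕ, ∀ c, (φ (Γ.pathElement δ c)).norm ≤ M * c.length := by
  obtain ⟨M, hM⟩ := exists_norm_le_mul_length hδ φ
  refine ⟨M, fun c => ?_⟩
  rcases c with _ | ⟨e, l⟩
  · simp [pathElement]
  by_cases h : Γ.IsPath Γ.x₀ (δ (Γ.o e) ++ (e :: l) ++ Γ.invPath (δ (Γ.o e))) Γ.x₀
  · obtain ⟨z, h1, h2⟩ := isPath_append_iff.1 h
    obtain ⟨y, h3, h4⟩ := isPath_append_iff.1 h1
    obtain rfl : y = Γ.o e := h3.endpoint_unique (hδ _)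
    obtain rfl : z = Γ.o e := (hδ _).eq_of_invPath h2
    obtain ⟨g, h5, h6⟩ := hM _ _ _ h4
    rw [← emb_pathElement hδ h4] at h6
    rwa [Γ.emb_injective h6] at h5
  · rw [pathElement, dif_neg h]
    simp

/-- The modified walk is tame: each step changes the closed path by a bounded amount. -/
theorem isTame_modifiedWalk [DecidableEq A] {Ω : Type*} {S : Finset E} (β : E → E → List E)
    {δ : V → List E} (hδ : ∀ v, Γ.IsPath Γ.x₀ (δ v) v) (ξ : ℕ → Ω → S) :
    IsTame (Γ.modifiedWalk β δ ξ) := by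
  have _ := Γ.finite_E
  obtain ⟨D, hD⟩ := exists_length_closing_le β
  intro B
  obtain ⟨M, hM⟩ := exists_norm_pathElement_le hδ (B.repr : FreeGroup A →* FreeGroup A)
  refine ⟨(M : ℝ) * (1 + D) + 1, by positivity, fun n hn ω => ?_⟩
  have h1 := length_modifiedClosing_le (Γ := Γ.toSerreGraph) hD (walk ξ n ω)
  have h2 : (walk ξ n ω).length = n := by simp [walk]
  have h3 := hM (Γ.modifiedClosing β (walk ξ n ω))
  have h4 : ((B.repr (Γ.modifiedWalk β δ ξ n ω)).norm : ℝ) ≤ (M : ℝ) * (n + D) := by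
    rw [h2] at h1
    exact_mod_cast h3.trans (Nat.mul_le_mul_left M h1)
  have h5 : (1 : ℝ) ≤ n := by exact_mod_cast hn
  have h6 : (D : ℝ) ≤ D * n := le_mul_of_one_le_right (Nat.cast_nonneg D) h5
  calc ((B.repr (Γ.modifiedWalk β δ ξ n ω)).norm : ℝ) ≤ (M : ℝ) * (n + D) := h4
    _ ≤ (M : ℝ) * (n + D * n) := by gcongr
    _ ≤ ((M : ℝ) * (1 + D) + 1) * n := by nlinarith

end Chart

/-! ### The modified closings of a typical trajectory -/

namespace Chart

open SerreGraph

variable {A V E : Type*} [Fintype A] {Γ : Chart A V E} {S : Finset E} {X : MarkovChain S}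

theorem pathWeight_nonneg {μ₀ : S → ℝ} (hμ₀ : X.IsStationary μ₀) (v : List E) :
    0 ≤ pathWeight X μ₀ v := by
  rw [pathWeight]
  split_ifs
  · exact X.wordProb_nonneg hμ₀.1.1 _
  · exact le_rfl

/-- The weights of the characteristic current. -/
noncomputable def currentWeight (Γ : Chart A V E) (X : MarkovChain S) (μ₀ : S → ℝ) (v : List E) :
    ℝ :=
  pathWeight X μ₀ v + pathWeight X μ₀ (Γ.invPath v)

theorem currentWeight_nonneg {μ₀ : S → ℝ} (hμ₀ : X.IsStationary μ₀) (v : List E) :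
    0 ≤ Γ.currentWeight X μ₀ v :=
  add_nonneg (pathWeight_nonneg hμ₀ _) (pathWeight_nonneg hμ₀ _)

theorem currentWeight_invPath (μ₀ : S → ℝ) (v : List E) :
    Γ.currentWeight X μ₀ (Γ.invPath v) = Γ.currentWeight X μ₀ v := by
  rw [currentWeight, currentWeight, invPath_invPath, add_comm]

/-- The number of occurrences of `v` and of `v⁻¹` in a cyclic word. -/
noncomputable def unorientedCount (Γ : Chart A V E) (c v : List E) : ℕ :=
  cyclicCount c v + cyclicCount c (Γ.invPath v)

theorem isReducedPath_walk {Ω : Type*} (hbased : Γ.IsBased X) {ξ : ℕ → Ω → S} {ω : Ω}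
    (hω : ∀ i, 0 < X.p (ξ i ω) (ξ (i + 1) ω)) (n : ℕ) : Γ.IsReducedPath (walk ξ n ω) := by
  refine List.isChain_iff_getElem.2 fun i hi => ?_
  simp only [walk, List.getElem_ofFn]
  exact hbased.2 _ _ (hω i)

/-- The data on a trajectory that imply convergence of the modified closings. -/
structure IsGoodTrajectory {Ω : Type*} (Γ : Chart A V E) (X : MarkovChain S) (ξ : ℕ → Ω → S)
    (ω : Ω) : Prop where
  pos : ∀ i, 0 < X.p (ξ i ω) (ξ (i + 1) ω)
  typical : IsTypical X ξ ω
  not_mirror : ∀ᶠ n in atTop, ∃ i < n / 4, (ξ (n - 1 - i) ω : E) ≠ Γ.inv (ξ i ω)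

theorem ae_isGoodTrajectory {Ω : Type*} [MeasurableSpace Ω] {P : Measure Ω} [IsProbabilityMeasure P]
    (hbased : Γ.IsBased X) (hirr : X.IsIrreducible) {μ : S → ℝ} (hμ : IsDistribution μ)
    {ξ : ℕ → Ω → S} (hξ : X.HasMarkovLaw μ P ξ) : ∀ᵐ ω ∂P, Γ.IsGoodTrajectory X ξ ω := by
  have h1 := hξ.ae_eventually_not_mirror hirr hμ (R := fun a b => (b : E) = Γ.inv a)
    (fun a b b' h h' => Subtype.ext (h.trans h'.symm)) (fun a h => Γ.inv_ne a h.symm)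
    (fun a b h => (hbased.2 a b h).2)
  filter_upwards [hξ.ae_p_pos hμ, hξ.ae_isTypical hμ, h1] with ω h2 h3 h4
  exact ⟨h2, h3, h4⟩

namespace IsGoodTrajectory

variable {Ω : Type*} {ξ : ℕ → Ω → S} {ω : Ω} {β : E → E → List E}

/-- The modified closing is a segment of the trajectory of length at least `n / 2`, followed by a
path of length at most `B`. -/
theorem exists_segment (h : Γ.IsGoodTrajectory X ξ ω) (hbased : Γ.IsBased X)
    (hβ : Γ.IsClosingSystem β) {B : ℕ} (hB : ∀ e e', (β e e').length ≤ B) :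
    ∀ᶠ n in atTop, ∃ e l, Γ.modifiedClosing β (walk ξ n ω) = e :: l ∧
      Γ.IsReducedPath (e :: l ++ [e]) ∧ ∃ k L, k + L ≤ n ∧ n ≤ 2 * L ∧ L ≤ (e :: l).length ∧
        (e :: l).length ≤ L + B ∧ ∀ i < L, (e :: l)[i]? = some (ξ (k + i) ω : E) := by
  filter_upwards [h.not_mirror, eventually_gt_atTop 0] with n h1 hn
  have hlen : (walk ξ n ω).length = n := by simp [walk]
  have hne : walk ξ n ω ≠ [] := by
    rw [← List.length_pos_iff, hlen]
    exact hn
  have hget : ∀ j < n, (walk ξ n ω)[j]? = some (ξ j ω : E) := by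
    intro j hj
    rw [List.getElem?_eq_getElem (by rw [hlen]; exact hj)]
    simp [walk]
  obtain ⟨e, l, u, mid, tail, h2, h3, h4, h5, h6⟩ :=
    exists_modifiedClosing_eq hβ hB (isReducedPath_walk hbased h.pos n) hne
  have h7 := congrArg List.length h4
  rw [hlen, List.length_append, List.length_append, length_invPath] at h7
  have h8 := congrArg List.length h5
  rw [List.length_append] at h8
  have hu : u.length ≤ n / 4 := by
    by_contra! hu
    obtain ⟨i, hi, h9⟩ := h1
    apply h9
    have e1 := hget i (by omega)
    have e2 := hget (n - 1 - i) (by omega)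
    rw [h4, List.append_assoc, List.getElem?_append_left (by omega)] at e1
    rw [h4, List.getElem?_append_right (by rw [List.length_append]; omega), List.length_append,
      invPath, List.getElem?_reverse (by rw [List.length_map]; omega), List.length_map,
      show u.length - 1 - (n - 1 - i - (u.length + mid.length)) = i by omega, List.getElem?_map,
      e1] at e2
    exact (Option.some.inj e2).symm
  refine ⟨e, l, h2, h3, u.length, mid.length, by omega, by omega, by omega, by omega, ?_⟩
  intro i hi
  have e1 := hget (u.length + i) (by omega)
  rw [h4, List.append_assoc, List.getElem?_append_right (by omega),
    List.getElem?_append_left (by omega), Nat.add_sub_cancel_left] at e1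
  rw [h5, List.getElem?_append_left hi, e1]

theorem tendsto_unorientedCount (h : Γ.IsGoodTrajectory X ξ ω) (hbased : Γ.IsBased X)
    (hirr : X.IsIrreducible) (hβ : Γ.IsClosingSystem β) {μ₀ : S → ℝ} (hμ₀ : X.IsStationary μ₀)
    {v : List E} (hv : v ≠ []) :
    Tendsto (fun n => (Γ.unorientedCount (Γ.modifiedClosing β (walk ξ n ω)) v : ℝ) /
      (Γ.modifiedClosing β (walk ξ n ω)).length) atTop (𝓝 (Γ.currentWeight X μ₀ v)) := by
  have _ := Γ.finite_E
  obtain ⟨B, hB⟩ := exists_length_closing_le β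
  have h1 : ∀ᶠ n in atTop, ∃ k L, k + L ≤ n ∧ n ≤ 2 * L ∧
      L ≤ (Γ.modifiedClosing β (walk ξ n ω)).length ∧
      (Γ.modifiedClosing β (walk ξ n ω)).length ≤ L + B ∧
      ∀ i < L, (Γ.modifiedClosing β (walk ξ n ω))[i]? = some (ξ (k + i) ω : E) := by
    filter_upwards [h.exists_segment hbased hβ hB] with n hn
    obtain ⟨e, l, h2, -, h3⟩ := hn
    rw [h2]
    exact h3
  have hv' : Γ.invPath v ≠ [] := by simpa [invPath] using hv
  refine ((tendsto_cyclicCount_div (h.typical.tendsto_occurrences hirr hμ₀ hv) h1).add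
    (tendsto_cyclicCount_div (h.typical.tendsto_occurrences hirr hμ₀ hv') h1)).congr fun n => ?_
  rw [unorientedCount, Nat.cast_add, add_div]

variable [DecidableEq A]

theorem eventually_hasWeights (h : Γ.IsGoodTrajectory X ξ ω) (hbased : Γ.IsBased X)
    (hβ : Γ.IsClosingSystem β) {δ : V → List E} (hδ : ∀ v, Γ.IsPath Γ.x₀ (δ v) v) :
    ∀ᶠ n in atTop, 0 < (Γ.modifiedClosing β (walk ξ n ω)).length ∧
      (∀ v, (Γ.unorientedCount (Γ.modifiedClosing β (walk ξ n ω)) (Γ.invPath v) : ℝ) =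
        Γ.unorientedCount (Γ.modifiedClosing β (walk ξ n ω)) v) ∧
      ∃ hg : Γ.modifiedWalk β δ ξ n ω ≠ 1,
        Γ.HasWeights (countingMeasure (Γ.modifiedWalk β δ ξ n ω) hg)
          fun v => Γ.unorientedCount (Γ.modifiedClosing β (walk ξ n ω)) v := by
  have _ := Γ.finite_E
  obtain ⟨B, hB⟩ := exists_length_closing_le β
  filter_upwards [h.exists_segment hbased hβ hB] with n hn
  obtain ⟨e, l, h1, h2, -⟩ := hn
  rw [modifiedWalk, h1]
  refine ⟨by simp, fun v => ?_, pathElement_ne_one hδ h2, ?_⟩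
  · rw [unorientedCount, unorientedCount, invPath_invPath, add_comm]
  · intro v hv0 hv p q hl
    have h3 := countingMeasure_cylinder (pathElement_ne_one hδ h2) h2
      (hδ (Γ.o e)).isPathElement (emb_pathElement hδ (isPath_of_cyclicallyReduced h2)) hv0 hv hl
    rw [Measure.real, h3]
    exact ⟨ENNReal.natCast_ne_top _, ENNReal.toReal_natCast _⟩

/-- The characteristic current arises as the limit of the normalized counting currents along any
good trajectory. -/
theorem exists_measure (h : Γ.IsGoodTrajectory X ξ ω) (hbased : Γ.IsBased X)
    (hirr : X.IsIrreducible) (hβ : Γ.IsClosingSystem β) {δ : V → List E}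
    (hδ : ∀ v, Γ.IsPath Γ.x₀ (δ v) v) {μ₀ : S → ℝ} (hμ₀ : X.IsStationary μ₀) :
    ∃ ν, Γ.HasWeights ν (Γ.currentWeight X μ₀) := by
  obtain ⟨N, hN⟩ := eventually_atTop.1 (h.eventually_hasWeights hbased hβ hδ)
  choose hlen hsymm hg hw using fun n => hN (N + n) (Nat.le_add_right N n)
  refine exists_hasWeights (fun n =>
    (hw n).smul ((Γ.modifiedClosing β (walk ξ (N + n) ω)).length : ℝ≥0)⁻¹) fun v hv _ => ?_
  have h1 := (h.tendsto_unorientedCount hbased hirr hβ hμ₀ hv).comp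
    (tendsto_add_atTop_nat N)
  refine h1.congr fun n => ?_
  simp only [Function.comp_apply, add_comm n N]
  push_cast
  rw [div_eq_inv_mul]

end IsGoodTrajectory

/-- The cylinder of a lift of a state has positive measure. -/
theorem HasWeights.ne_zero {m : Measure (DoubleBoundary A)} (hirr : X.IsIrreducible) {μ₀ : S → ℝ}
    (hμ₀ : X.IsStationary μ₀) (h : Γ.HasWeights m (Γ.currentWeight X μ₀)) (s : S) : m ≠ 0 := by
  obtain ⟨d, hd⟩ := Γ.connected Γ.x₀ (Γ.o s)
  obtain ⟨p, hp⟩ := exists_treeVertex hd.isPathElement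
  have hs : Γ.IsPath (Γ.o s) [(s : E)] (Γ.t s) := ⟨rfl, rfl⟩
  obtain ⟨q, hq⟩ := exists_treeVertex (hd.isPathElement.mul hs.isPathElement)
  have hl : Γ.IsLift p [(s : E)] q := isLift_of_elt_eq (by rw [hq, hp])
    (by rw [hp]; exact hd.isPathElement) hs
  have h1 := (h [(s : E)] (by simp) (List.isChain_singleton _) p q hl).2
  rintro rfl
  have h2 : pathWeight X μ₀ [(s : E)] = μ₀ s := by
    simp [pathWeight, MarkovChain.wordProb, MarkovChain.pathProb]
  have h3 := hμ₀.pos hirr s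
  have h4 := pathWeight_nonneg hμ₀ (Γ.invPath [(s : E)])
  rw [currentWeight, h2] at h1
  simp at h1
  linarith

variable [DecidableEq A]

theorem isCharacteristicCurrent_iff {ν : Curr A} :
    Γ.IsCharacteristicCurrent X ν ↔
      ∃ μ₀, X.IsStationary μ₀ ∧ Γ.HasWeights ν.measure (Γ.currentWeight X μ₀) := by
  refine exists_congr fun μ₀ => and_congr_right fun hμ₀ => ?_
  rw [hasWeights_iff (currentWeight_nonneg hμ₀)]
  rfl

end Chart

end GraphWalk

theorem theoremt {A V E Ω : Type*} [Fintype A] [DecidableEq A] [MeasurableSpace Ω]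
    (hN : 2 ≤ Fintype.card A) (Γ : Chart A V E)
    (S : Finset E) (X : MarkovChain S) (hbased : Γ.IsBased X) (hirr : X.IsIrreducible)
    (μ : S → ℝ) (hμ : IsDistribution μ)
    (P : Measure Ω) [IsProbabilityMeasure P] (ξ : ℕ → Ω → S) (hξ : X.HasMarkovLaw μ P ξ)
    (β : E → E → List E) (hβ : Γ.IsClosingSystem β)
    (δ : V → List E) (hδ : ∀ v, Γ.IsPath Γ.x₀ (δ v) v) :
    ∃ ν : Curr A, Γ.IsCharacteristicCurrent X ν ∧
      (∀ ν' : Curr A, Γ.IsCharacteristicCurrent X ν' → ν' = ν) ∧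
      IsTame (Γ.modifiedWalk β δ ξ) ∧ IsAdapted P (Γ.modifiedWalk β δ ξ) ν := by
  have hgood := Γ.ae_isGoodTrajectory hbased hirr hμ hξ
  obtain ⟨ω₀, hω₀⟩ := hgood.exists
  obtain ⟨μ₀, hμ₀⟩ := hω₀.typical.exists_isStationary
  obtain ⟨m, hm⟩ := hω₀.exists_measure hbased hirr hβ hδ hμ₀
  set ν : Curr A := hm.toCurr fun v => Chart.currentWeight_invPath μ₀ v with hν
  have hw : Γ.HasWeights ν.measure (Γ.currentWeight X μ₀) := hm
  refine ⟨ν, Chart.isCharacteristicCurrent_iff.2 ⟨μ₀, hμ₀, hw⟩, fun ν' hν' => ?_,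
    Chart.isTame_modifiedWalk β hδ ξ, hw.ne_zero hirr hμ₀ (ξ 0 ω₀), ?_⟩
  · obtain ⟨μ₁, hμ₁, hw'⟩ := Chart.isCharacteristicCurrent_iff.1 hν'
    rw [hμ₁.unique hirr hμ₀] at hw'
    have h1 := hw'.eq hw
    cases ν'
    cases h : ν
    rw [h] at h1
    cases h1
    rfl
  · filter_upwards [hgood] with ω hω
    exact Chart.exists_tendsto_countingMeasure _ hw (hω.eventually_hasWeights hbased hβ hδ)
      fun v hv _ => hω.tendsto_unorientedCount hbased hirr hβ hμ₀ hv
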